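/- Let $\mathbb R^\infty=\bigcup_k\mathbb R^k$, $\mathbb Q^\infty=\bigcup_k\mathbb Q^k$, $\mathbb Z^\infty=\bigcup_k\mathbb Z^k$, and let $Q$ be an inner product on $\mathbb R^\infty$ with $Q(\mathbb Z^\infty\times\mathbb Z^\infty)\subset\mathbb Q$. A *lattice cone* is a pair $(C,\Lambda_C)$ where $C\subset\mathbb R^\infty$ is a cone generated by finitely many vectors of $\mathbb Q^\infty$ and $\Lambda_C\subset\mathbb Q^\infty$ is a finitely generated subgroup whose real span is the linear span $\mathrm{lin}(C)$ of $C$. Write $C^o$ for the relative interior of $C$. Let $\mathfrak C$ be the set of lattice cones. Put $(C,\Lambda_C)\cdot(D,\Lambda_D)=(C+D,\Lambda_C+\Lambda_D)$, and write $(C,\Lambda_C)\perp^Q(D,\Lambda_D)$ if $Q(u,v)=0$ for all $u\in\Lambda_C$, $v\in\Lambda_D$. Let $\mathcal M_{\mathbb Q}(\mathbb C^m)$ be the ring of germs at $0$ of the form $h/(L_1\cdots L_r)$, where $h$ is a holomorphic germ at $0\in\mathbb C^m$ with rational Taylor coefficients and the $L_i$ are nonzero linear forms with rational coefficients, and let $\mathcal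 M_{\mathbb Q}$ be the union of these rings over all $m$ (germs in finitely many of the variables $z_1,z_2,\dots$). A vector $u\in\mathbb Q^\infty$ is regarded as the linear form $z\mapsto\langle u,z\rangle$. For $f,f'\in\mathcal M_{\mathbb Q}$ write $f\perp^Q f'$ if there are linear forms $L_1,\dots,L_m,L'_1,\dots,L'_n\in\mathbb Q^\infty$ with $Q(L_i,L'_j)=0$ for all $i,j$, and $g\in\mathcal M_{\mathbb Q}(\mathbb C^m)$, $g'\in\mathcal M_{\mathbb Q}(\mathbb C^n)$, such that $f=g(L_1,\dots,L_m)$ and $f'=g'(L'_1,\dots,L'_n)$ (these substitutions being defined). For a strongly convex lattice cone $(C,\Lambda_C)$ and a real linear form $z$ with $\langle x,z\rangle<0$ for all $x\in C\setminus\{0\}$, put $$S(C,\Lambda_C)(z)=\sum_{n\in C^o\cap\Lambda_C}e^{\langle n,z\rangle},\qquad I(C,\Lambda_C)(z)=\int_C e^{\langle x,z\rangle}\,d\Lambda_x,$$ where $d\Lambda_x$ is Lebesgue measure on $\mathrm{lin}(C)$ normalised so that the parallelepiped spanned by a $\mathbb Z$-basis of $\Lambda_C$ has volume $1$. The sum and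 the integral converge and are regarded as the elements of $\mathcal M_{\mathbb Q}$ that they define. They are extended to all lattice cones by subdivision: if $C^o$ is the disjoint union of the relative interiors of strongly convex lattice cones $(P_1,\Lambda_{P_1}),\dots,(P_n,\Lambda_{P_n})$ with $\Lambda_{P_i}=\Lambda_C\cap\mathrm{lin}(P_i)$, then $$S(C,\Lambda_C)=\sum_i S(P_i,\Lambda_{P_i}),\qquad I(C,\Lambda_C)=\sum_{i:\ \mathrm{lin}(P_i)=\mathrm{lin}(C)}I(P_i,\Lambda_{P_i}).$$ A *locality semigroup* is a set $X$ with a symmetric relation $\top$ and a product defined on the pairs in $\top$ such that, for every $U\subset X$ with polar $U^\top=\{x: u\top x\ \forall u\in U\}$, $x,y\in U^\top$ and $x\top y$ imply $xy\in U^\top$, and such that $(xy)z=x(yz)$ whenever $x,y,z$ are pairwise related. A *homomorphism* of locality semigroups is a map $\varphi$ such that $x\top y$ implies $\varphi(x)\top\varphi(y)$ and $\varphi(xy)=\varphi(x)\varphi(y)$. **Proposition.** The maps $S,I:\mathfrak C\to\mathcal M_{\mathbb Q}$ are well defined: every lattice cone has such subdivisions, and the resulting germs in $\mathcal M_{\mathbb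 Q}$ exist and do not depend on the subdivision. If $(C,\Lambda_C)\perp^Q(D,\Lambda_D)$, then $$S((C,\Lambda_C)\cdot(D,\Lambda_D))=S(C,\Lambda_C)\,S(D,\Lambda_D),\qquad I((C,\Lambda_C)\cdot(D,\Lambda_D))=I(C,\Lambda_C)\,I(D,\Lambda_D).$$ Moreover $(\mathfrak C,\perp^Q)$ with the product $\cdot$ and $(\mathcal M_{\mathbb Q},\perp^Q)$ with multiplication are locality semigroups, and $S$ and $I$ are homomorphisms of locality semigroups from the former to the latter. -/

import Mathlib

open Filter Topology

noncomputable section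

namespace LocCones

/-! ### Holomorphic and meromorphic germs with rational coefficients

The index type `σ` numbers the variables. With `σ = Fin m` one gets germs at `0` on `ℂ^m`; with
`σ = ℕ` one gets the union over `k` of the germs in the first `k` variables, since a germ below
depends on finitely many variables only, and neighbourhoods of `0` in the product topology of
`ℕ → ℂ` constrain finitely many coordinates only. -/

variable {σ : Type*}

/-- The monomial `z ^ m`. -/
def monomialAt (z : σ → ℂ) (m : σ →₀ ℕ) : ℂ := m.prod fun i e => z i ^ e

/-- Near `0` the function `F` is the sum of an absolutely convergent power series in finitely many
variables with rational coefficients, that is, `F` is holomorphic near `0`, depends on finitely many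
variables and has rational Taylor coefficients at `0`. -/
def IsRatHolomorphic (F : (σ → ℂ) → ℂ) : Prop :=
  ∃ (t : Finset σ) (p : MvPowerSeries σ ℚ),
    (∀ m : σ →₀ ℕ, MvPowerSeries.coeff m p ≠ 0 → m.support ⊆ t) ∧
    ∀ᶠ z in 𝓝 (0 : σ → ℂ),
      HasSum (fun m : σ →₀ ℕ => ((MvPowerSeries.coeff m p : ℚ) : ℂ) * monomialAt z m) (F z)

/-- The linear form `z ↦ ⟨L, z⟩` with rational coefficient vector `L`. -/
def linEval (L : σ →₀ ℚ) (z : σ → ℂ) : ℂ := L.sum fun i a => (a : ℂ) * z i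

theorem monomialAt_zero (z : σ → ℂ) : monomialAt z 0 = 1 := by simp [monomialAt]

theorem monomialAt_add (z : σ → ℂ) (m n : σ →₀ ℕ) :
    monomialAt z (m + n) = monomialAt z m * monomialAt z n := by
  classical
  exact Finsupp.prod_add_index' (fun _ => pow_zero _) (fun _ _ _ => pow_add _ _ _)

theorem isRatHolomorphic_const (q : ℚ) : IsRatHolomorphic (fun _ : σ → ℂ => (q : ℂ)) := by
  classical
  refine ⟨∅, MvPowerSeries.monomial 0 q, ?_, Eventually.of_forall fun z => ?_⟩
  · intro m hm
    have : m = 0 := by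
      by_contra h
      exact hm (MvPowerSeries.coeff_monomial_ne h q)
    simp [this]
  · have h := hasSum_single (f := fun m : σ →₀ ℕ =>
      ((MvPowerSeries.coeff m (MvPowerSeries.monomial 0 q) : ℚ) : ℂ) * monomialAt z m) 0
      (fun m hm => by rw [MvPowerSeries.coeff_monomial_ne hm]; simp)
    rw [MvPowerSeries.coeff_monomial_same, monomialAt_zero, mul_one] at h
    exact h

theorem isRatHolomorphic_coord (i : σ) : IsRatHolomorphic (fun z : σ → ℂ => z i) := by
  classical
  refine ⟨{i}, MvPowerSeries.monomial (Finsupp.single i 1) 1, ?_, Eventually.of_forall fun z => ?_⟩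
  · intro m hm
    have : m = Finsupp.single i 1 := by
      by_contra h
      exact hm (MvPowerSeries.coeff_monomial_ne h 1)
    rw [this]
    exact Finsupp.support_single_subset
  · have h := hasSum_single (f := fun m : σ →₀ ℕ =>
      ((MvPowerSeries.coeff m (MvPowerSeries.monomial (Finsupp.single i 1) (1 : ℚ)) : ℚ) : ℂ)
        * monomialAt z m) (Finsupp.single i 1)
      (fun m hm => by simp [MvPowerSeries.coeff_monomial_ne hm])
    simpa [MvPowerSeries.coeff_monomial_same, monomialAt] using h

theorem IsRatHolomorphic.add {F G : (σ → ℂ) → ℂ} (hF : IsRatHolomorphic F)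
    (hG : IsRatHolomorphic G) : IsRatHolomorphic (F + G) := by
  classical
  obtain ⟨t, p, hp, hFp⟩ := hF
  obtain ⟨u, q, hq, hGq⟩ := hG
  refine ⟨t ∪ u, p + q, ?_, ?_⟩
  · intro m hm
    by_cases h : MvPowerSeries.coeff m p = 0
    · have : MvPowerSeries.coeff m q ≠ 0 := by
        intro h'
        exact hm (by simp [h, h'])
      exact (hq m this).trans Finset.subset_union_right
    · exact (hp m h).trans Finset.subset_union_left
  · filter_upwards [hFp, hGq] with z h1 h2
    have h := h1.add h2
    simpa [add_mul] using h

theorem IsRatHolomorphic.neg {F : (σ → ℂ) → ℂ} (hF : IsRatHolomorphic F) :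
    IsRatHolomorphic (-F) := by
  obtain ⟨t, p, hp, hFp⟩ := hF
  refine ⟨t, -p, ?_, ?_⟩
  · intro m hm
    exact hp m (by simpa using hm)
  · filter_upwards [hFp] with z h1
    simpa using h1.neg

theorem IsRatHolomorphic.mul {F G : (σ → ℂ) → ℂ} (hF : IsRatHolomorphic F)
    (hG : IsRatHolomorphic G) : IsRatHolomorphic (F * G) := by
  classical
  obtain ⟨t, p, hp, hFp⟩ := hF
  obtain ⟨u, q, hq, hGq⟩ := hG
  refine ⟨t ∪ u, p * q, ?_, ?_⟩
  · intro m hm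
    rw [MvPowerSeries.coeff_mul] at hm
    obtain ⟨x, hx, hne⟩ := Finset.exists_ne_zero_of_sum_ne_zero hm
    rw [← Finset.HasAntidiagonal.mem_antidiagonal.1 hx]
    refine Finsupp.support_add.trans (Finset.union_subset_union (hp _ ?_) (hq _ ?_))
    · exact left_ne_zero_of_mul hne
    · exact right_ne_zero_of_mul hne
  · filter_upwards [hFp, hGq] with z h1 h2
    have hcauchy : ∀ {a b : (σ →₀ ℕ) → ℂ} {x y : ℂ}, HasSum a x → HasSum b y →
        HasSum (fun m => ∑ k ∈ Finset.HasAntidiagonal.antidiagonal m, a k.1 * b k.2) (x * y) := by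
      intro a b x y ha hb
      have hs : Summable fun x : (σ →₀ ℕ) × (σ →₀ ℕ) => a x.1 * b x.2 :=
        summable_mul_of_summable_norm (summable_norm_iff.2 ha.summable)
          (summable_norm_iff.2 hb.summable)
      have hsum := (summable_sum_mul_antidiagonal_of_summable_mul hs).hasSum
      rwa [← ha.summable.tsum_mul_tsum_eq_tsum_sum_antidiagonal hb.summable hs,
        ha.tsum_eq, hb.tsum_eq] at hsum
    rw [Pi.mul_apply]
    convert hcauchy h1 h2 using 1
    funext m
    rw [MvPowerSeries.coeff_mul]
    push_cast
    rw [Finset.sum_mul]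
    refine Finset.sum_congr rfl fun x hx => ?_
    rw [← Finset.HasAntidiagonal.mem_antidiagonal.1 hx, monomialAt_add]
    ring

theorem isRatHolomorphic_linEval (L : σ →₀ ℚ) : IsRatHolomorphic (linEval L) := by
  classical
  induction L using Finsupp.induction_linear with
  | zero =>
    have h : linEval (0 : σ →₀ ℚ) = fun _ => ((0 : ℚ) : ℂ) := by
      funext z
      simp [linEval]
    rw [h]
    exact isRatHolomorphic_const 0
  | add L M hL hM =>
    have h : linEval (L + M) = linEval L + linEval M := by
      funext z
      exact Finsupp.sum_add_index' (fun i => by simp) (fun i a b => by push_cast; ring)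
    rw [h]
    exact hL.add hM
  | single i a =>
    have h : linEval (Finsupp.single i a) = (fun _ => (a : ℂ)) * fun z : σ → ℂ => z i := by
      funext z
      simp [linEval]
    rw [h]
    exact (isRatHolomorphic_const a).mul (isRatHolomorphic_coord i)

variable (σ) in
/-- The ring of germs at `0` of holomorphic functions, in finitely many of the variables indexed by
`σ`, with rational Taylor coefficients. -/
def HolGerm : Subring (Germ (𝓝 (0 : σ → ℂ)) ℂ) where
  carrier := {G | ∃ F : (σ → ℂ) → ℂ, IsRatHolomorphic F ∧ (F : Germ (𝓝 (0 : σ → ℂ)) ℂ) = G}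
  mul_mem' := by
    rintro _ _ ⟨F, hF, rfl⟩ ⟨G, hG, rfl⟩
    exact ⟨F * G, hF.mul hG, rfl⟩
  one_mem' := ⟨fun _ => ((1 : ℚ) : ℂ), isRatHolomorphic_const 1, by simp; rfl⟩
  add_mem' := by
    rintro _ _ ⟨F, hF, rfl⟩ ⟨G, hG, rfl⟩
    exact ⟨F + G, hF.add hG, rfl⟩
  zero_mem' := ⟨fun _ => ((0 : ℚ) : ℂ), isRatHolomorphic_const 0, by simp; rfl⟩
  neg_mem' := by
    rintro _ ⟨F, hF, rfl⟩
    exact ⟨-F, hF.neg, rfl⟩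

/-- The germ at `0` of a function that is holomorphic with rational coefficients. -/
def IsRatHolomorphic.germ {F : (σ → ℂ) → ℂ} (hF : IsRatHolomorphic F) : HolGerm σ :=
  ⟨(F : Germ (𝓝 (0 : σ → ℂ)) ℂ), F, hF, rfl⟩

/-- The germ of the linear form with coefficient vector `L`. -/
def linGerm (L : σ →₀ ℚ) : HolGerm σ := (isRatHolomorphic_linEval L).germ

variable (σ) in
/-- The multiplicative set of finite products of nonzero rational linear forms. -/
def linProducts : Submonoid (HolGerm σ) :=
  Submonoid.closure {g | ∃ L : σ →₀ ℚ, L ≠ 0 ∧ linGerm L = g}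

variable (σ) in
/-- Meromorphic germs at `0` with linear poles and rational coefficients: fractions
`h / (L₁ ⋯ Lₙ)` with `h` a holomorphic germ with rational coefficients and `L₁, …, Lₙ` nonzero
rational linear forms. -/
abbrev Mero : Type _ := Localization (linProducts σ)

/-- A holomorphic germ as a meromorphic germ. -/
def toMero (h : HolGerm σ) : Mero σ := algebraMap (HolGerm σ) (Mero σ) h

/-- The product of a list of linear forms, as a meromorphic germ. -/
def linProd (s : List (σ →₀ ℚ)) : Mero σ := toMero (s.map linGerm).prod

/-! ### The rational Euclidean lattice space `(ℝ^∞, ℤ^∞, Q)` -/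

/-- `ℝ^∞`, the union of all `ℝ^k`. -/
abbrev V : Type := ℕ →₀ ℝ

/-- The inclusion of `ℚ^∞` in `ℝ^∞`. -/
def ratVec (u : ℕ →₀ ℚ) : V := u.mapRange (fun q : ℚ => (q : ℝ)) Rat.cast_zero

/-- The inclusion of `ℤ^∞` in `ℝ^∞`. -/
def intVec (u : ℕ →₀ ℤ) : V := u.mapRange (fun n : ℤ => (n : ℝ)) Int.cast_zero

/-- An inner product on `ℝ^∞` (equivalently, a compatible family of inner products on all `ℝ^k`)
with rational values on `ℤ^∞`. -/
structure RatInnerProduct where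
  form : V →ₗ[ℝ] V →ₗ[ℝ] ℝ
  symm : ∀ x y, form x y = form y x
  pos : ∀ x, x ≠ 0 → 0 < form x x
  rational : ∀ u v : ℕ →₀ ℤ, ∃ q : ℚ, form (intVec u) (intVec v) = q

/-- The pairing of a vector with a linear form on `ℝ^∞`, given by its values on the basis. -/
def pairing (x : V) (z : ℕ → ℝ) : ℝ := x.sum fun i a => a * z i

/-! ### Lattice cones -/

/-- A lattice cone: a polyhedral cone generated by finitely many rational vectors, with a lattice
(a finitely generated group of rational vectors of full rank) in its linear span. -/
structure LatticeCone where
  cone : PointedCone ℝ V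
  lattice : AddSubgroup V
  cone_gen : ∃ s : Finset (ℕ →₀ ℚ), cone = PointedCone.hull ℝ (ratVec '' (s : Set (ℕ →₀ ℚ)))
  lattice_gen : ∃ s : Finset (ℕ →₀ ℚ), lattice = AddSubgroup.closure (ratVec '' (s : Set (ℕ →₀ ℚ)))
  span_eq : Submodule.span ℝ (lattice : Set V) = Submodule.span ℝ (cone : Set V)

namespace LatticeCone

/-- The linear span of a lattice cone. -/
def linSpan (C : LatticeCone) : Submodule ℝ V := Submodule.span ℝ (C.cone : Set V)

/-- The relative interior of the cone: the points from which one can move a little, inside the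
cone, in the direction opposite to any point of the cone. -/
def relInterior (C : LatticeCone) : Set V :=
  {x | x ∈ C.cone ∧ ∀ y ∈ C.cone, ∃ ε : ℝ, 0 < ε ∧ x - ε • y ∈ C.cone}

/-- Strongly convex: the cone contains no line. -/
def StronglyConvex (C : LatticeCone) : Prop := C.cone.toConvexCone.Salient

/-- The linear forms that are negative on the cone outside the origin. -/
def negDual (C : LatticeCone) : Set (ℕ → ℝ) := {z | ∀ x ∈ C.cone, x ≠ 0 → pairing x z < 0}

/-- The Minkowski product. -/
instance : Mul LatticeCone where
  mul C D :=
    { cone := C.cone ⊔ D.cone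
      lattice := C.lattice ⊔ D.lattice
      cone_gen := by
        classical
        obtain ⟨s, hs⟩ := C.cone_gen
        obtain ⟨t, ht⟩ := D.cone_gen
        refine ⟨s ∪ t, ?_⟩
        rw [hs, ht, Finset.coe_union, Set.image_union]
        exact (Submodule.span_union _ _).symm
      lattice_gen := by
        classical
        obtain ⟨s, hs⟩ := C.lattice_gen
        obtain ⟨t, ht⟩ := D.lattice_gen
        refine ⟨s ∪ t, ?_⟩
        rw [hs, ht, Finset.coe_union, Set.image_union]
        exact (AddSubgroup.closure_union _ _).symm
      span_eq := by
        have hC := C.span_eq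
        have hD := D.span_eq
        apply le_antisymm
        · rw [Submodule.span_le]
          have h : C.lattice ⊔ D.lattice ≤
              (Submodule.span ℝ ((C.cone ⊔ D.cone : PointedCone ℝ V) : Set V)).toAddSubgroup := by
            refine sup_le ?_ ?_
            · intro x hx
              have : x ∈ Submodule.span ℝ (C.cone : Set V) := hC ▸ Submodule.subset_span hx
              exact Submodule.span_mono (fun y hy => (le_sup_left : C.cone ≤ C.cone ⊔ D.cone) hy)
                this
            · intro x hx
              have : x ∈ Submodule.span ℝ (D.cone : Set V) := hD ▸ Submodule.subset_span hx
              exact Submodule.span_mono (fun y hy => (le_sup_right : D.cone ≤ C.cone ⊔ D.cone) hy)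
                this
          exact h
        · rw [Submodule.span_le]
          intro x hx
          obtain ⟨y, hy, w, hw, rfl⟩ := Submodule.mem_sup.1 hx
          refine Submodule.add_mem _ ?_ ?_
          · have : y ∈ Submodule.span ℝ (C.lattice : Set V) := hC ▸ Submodule.subset_span hy
            exact Submodule.span_mono
              (fun v hv => (le_sup_left : C.lattice ≤ C.lattice ⊔ D.lattice) hv) this
          · have : w ∈ Submodule.span ℝ (D.lattice : Set V) := hD ▸ Submodule.subset_span hw
            exact Submodule.span_mono
              (fun v hv => (le_sup_right : D.lattice ≤ C.lattice ⊔ D.lattice) hv) this }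

/-- Orthogonality of lattice cones. -/
def Orth (Q : RatInnerProduct) (C D : LatticeCone) : Prop :=
  ∀ u ∈ C.lattice, ∀ v ∈ D.lattice, Q.form u v = 0

/-- A subdivision of `C` into strongly convex lattice cones `P i`, each with the lattice induced by
that of `C`: every point of the relative interior of `C` is in the relative interior of exactly one
`P i`, and these relative interiors lie in that of `C`. (If a fan of strongly convex cones has union
`C`, its cones that are not contained in a proper face of `C` form such a family.) -/
structure IsSubdivision (C : LatticeCone) {n : ℕ} (P : Fin n → LatticeCone) : Prop where
  stronglyConvex : ∀ i, (P i).StronglyConvex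
  disjoint : ∀ i j, i ≠ j → Disjoint (P i).relInterior (P j).relInterior
  iUnion_eq : ⋃ i, (P i).relInterior = C.relInterior
  lattice_eq : ∀ i, ((P i).lattice : Set V) = (C.lattice : Set V) ∩ ((P i).linSpan : Set V)

end LatticeCone

/-! ### Exponential sums and exponential integrals -/

/-- The meromorphic germ `f` is given by the function `F` on `U` near `0`: writing
`f = H / (L₁ ⋯ Lₙ)`, one has `F z * (L₁ z ⋯ Lₙ z) = H z` for all `z` in `U` close to `0`. -/
def IsGivenBy (f : Mero ℕ) (U : Set (ℕ → ℝ)) (F : (ℕ → ℝ) → ℝ) : Prop :=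
  ∃ (H : (ℕ → ℂ) → ℂ) (hH : IsRatHolomorphic H) (s : List (ℕ →₀ ℚ)),
    (∀ L ∈ s, L ≠ 0) ∧ f * linProd s = toMero hH.germ ∧
    ∀ᶠ z in 𝓝 (0 : ℕ → ℝ), z ∈ U →
      (F z : ℂ) * (s.map fun L => linEval L fun i => (z i : ℂ)).prod = H fun i => (z i : ℂ)

/-- For strongly convex `C`: the series `∑ exp ⟨n, z⟩` over the lattice points `n` in the relative
interior of `C` converges for all `z` in the open dual cone, and its sum gives the germ `f`. -/
def IsConvergentExpSum (C : LatticeCone) (f : Mero ℕ) : Prop :=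
  (∀ z ∈ C.negDual,
    Summable fun n : ↥(C.relInterior ∩ (C.lattice : Set V)) => Real.exp (pairing n z)) ∧
  IsGivenBy f C.negDual fun z =>
    ∑' n : ↥(C.relInterior ∩ (C.lattice : Set V)), Real.exp (pairing n z)

/-- For strongly convex `C`: the integral of `exp ⟨x, z⟩` over `C` converges for all `z` in the open
dual cone, and its value gives the germ `f`. The volume form is the one for which the parallelepiped
spanned by a `ℤ`-basis `b` of the lattice has volume `1`, that is, Lebesgue measure in the
coordinates given by `b`. -/
def IsConvergentExpInt (C : LatticeCone) (f : Mero ℕ) : Prop :=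
  ∃ (d : ℕ) (b : Module.Basis (Fin d) ℤ C.lattice),
    (∀ z ∈ C.negDual, MeasureTheory.IntegrableOn
      (fun t : Fin d → ℝ => Real.exp (pairing (∑ i, t i • (b i : V)) z))
      {t | ∑ i, t i • (b i : V) ∈ C.cone}) ∧
    IsGivenBy f C.negDual fun z =>
      ∫ t in {t : Fin d → ℝ | ∑ i, t i • (b i : V) ∈ C.cone},
        Real.exp (pairing (∑ i, t i • (b i : V)) z)

/-- `f` is the exponential sum of `C`, computed through some subdivision into strongly convex
cones (the relative interior of `C` is the disjoint union of those of the pieces). -/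
def IsExpSum (C : LatticeCone) (f : Mero ℕ) : Prop :=
  ∃ (n : ℕ) (P : Fin n → LatticeCone) (g : Fin n → Mero ℕ),
    C.IsSubdivision P ∧ (∀ i, IsConvergentExpSum (P i) (g i)) ∧ f = ∑ i, g i

/-- `f` is the exponential integral of `C`, computed through some subdivision into strongly convex
cones (the pieces of smaller dimension than `C` are null sets and contribute `0`). -/
def IsExpInt (C : LatticeCone) (f : Mero ℕ) : Prop :=
  ∃ (n : ℕ) (P : Fin n → LatticeCone) (g : Fin n → Mero ℕ),
    C.IsSubdivision P ∧ (∀ i, (P i).linSpan = C.linSpan → IsConvergentExpInt (P i) (g i)) ∧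
    (∀ i, (P i).linSpan ≠ C.linSpan → g i = 0) ∧ f = ∑ i, g i

/-- The exponential sum `S`: the meromorphic germ obtained from any subdivision. -/
def expSum (C : LatticeCone) : Mero ℕ := Classical.epsilon (IsExpSum C)

/-- The exponential integral `I`: the meromorphic germ obtained from any subdivision. -/
def expInt (C : LatticeCone) : Mero ℕ := Classical.epsilon (IsExpInt C)

/-! ### Orthogonality of meromorphic germs -/

/-- The linear form `c₁ L₁ + ⋯ + c_m L_m`, which is the linear form `c` in the variables
`L₁, …, L_m`. -/
def linComp {m : ℕ} (L : Fin m → (ℕ →₀ ℚ)) (c : Fin m →₀ ℚ) : ℕ →₀ ℚ := c.sum fun i a => a • L i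

/-- `f = g (L₁, …, L_m)`: writing `g = h / (c₁ ⋯ cᵣ)` with linear forms `cⱼ` that do not become
zero under the substitution, `f` is the quotient of `h (L₁, …, L_m)` by the product of the
substituted linear forms. -/
def IsComposition {m : ℕ} (g : Mero (Fin m)) (L : Fin m → (ℕ →₀ ℚ)) (f : Mero ℕ) : Prop :=
  ∃ (h : (Fin m → ℂ) → ℂ) (H : (ℕ → ℂ) → ℂ) (hh : IsRatHolomorphic h) (hH : IsRatHolomorphic H)
    (s : List (Fin m →₀ ℚ)),
    (∀ᶠ z in 𝓝 (0 : ℕ → ℂ), H z = h fun i => linEval (L i) z) ∧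
    (∀ c ∈ s, linComp L c ≠ 0) ∧
    g * linProd s = toMero hh.germ ∧
    f * linProd (s.map (linComp L)) = toMero hH.germ

/-- `Q`-orthogonality of meromorphic germs: they are functions of two families of rational linear
forms that are orthogonal to each other. -/
def MeroOrth (Q : RatInnerProduct) (f f' : Mero ℕ) : Prop :=
  ∃ (m n : ℕ) (L : Fin m → (ℕ →₀ ℚ)) (L' : Fin n → (ℕ →₀ ℚ))
    (g : Mero (Fin m)) (g' : Mero (Fin n)),
    (∀ i j, Q.form (ratVec (L i)) (ratVec (L' j)) = 0) ∧
    IsComposition g L f ∧ IsComposition g' L' f'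

/-! ### Locality semigroups -/

/-- The polar subset `U^⊤` of `U`. -/
def polar {X : Type*} (T : X → X → Prop) (U : Set X) : Set X := {x | ∀ u ∈ U, T u x}

/-- `X` with the relation `T` and the product `mul`, used for pairs in `T` only, is a locality
semigroup. -/
structure IsLocalitySemigroup {X : Type*} (T : X → X → Prop) (mul : X → X → X) : Prop where
  symm : ∀ x y, T x y → T y x
  compat : ∀ (U : Set X) (x y : X), x ∈ polar T U → y ∈ polar T U → T x y → mul x y ∈ polar T U
  assoc : ∀ x y z, T x y → T x z → T y z → mul (mul x y) z = mul x (mul y z)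

/-- `φ` is a homomorphism between locality semigroups: it is a locality map and it is
multiplicative on the pairs in the locality relation. -/
structure IsLocalitySemigroupHom {X Y : Type*} (TX : X → X → Prop) (mulX : X → X → X)
    (TY : Y → Y → Prop) (mulY : Y → Y → Y) (φ : X → Y) : Prop where
  source : IsLocalitySemigroup TX mulX
  target : IsLocalitySemigroup TY mulY
  map_rel : ∀ x y, TX x y → TY (φ x) (φ y)
  map_mul : ∀ x y, TX x y → φ (mulX x y) = mulY (φ x) (φ y)

end LocCones

end

/-! Both maps are regularised integrals of `exp ⟨x, z⟩` over a relative interior. The measure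
depends only on the lattice `Λ`: it is the counting measure on `Λ` for `S` and the normalised
Lebesgue measure for `I`. Both measures are invariant under translation by `Λ`, so replacing a
function `τ` by `τ - τ (· - u)` with `u ∈ Λ` multiplies its exponential integral by `1 - exp u`.
Applied to the indicator of an open simplicial cone once for each generator, these operators leave
the indicator of a half-open box. The integral over the box converges for every `z` and is a
holomorphic germ with rational coefficients.

Since `(1 - exp u) * (-todd u) = u`, where `todd u` is the germ of `u / (exp u - 1)`, each factor `1
- exp u` with `u ≠ 0` is a unit among meromorphic germs. Dividing by these units defines the germ of
any function that finitely many such operators make integrable against all exponentials; this is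
`HasGerm`. The relation is additive, and it is single-valued up to a.e. equality (`HasGerm.unique`),
even where no integral converges.

For a strongly convex cone the open dual cone is nonempty and open along lines, so it determines
germs. On it the integral converges, and `HasGerm` amounts to being given by that integral
(`LatticeCone.hasGerm_relInterior_iff`). A subdivision writes one indicator as a sum of others, so
every subdivision yields the germ of the whole (`LatticeCone.isExpSum_iff`,
`LatticeCone.isExpInt_iff`). Pieces of lower dimension are Lebesgue null. Subdivisions exist by a
triangulation whose cells are the supports of lexicographically minimal nonnegative coefficients.

If the lattices of `C` and `D` are `Q`-orthogonal, positive definiteness makes the two spans meet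
only in `0`. Hence the lattice and the measure of `C * D` are products, cells of the two
triangulations pair up to cells of `C * D`, and Fubini on boxes gives multiplicativity
(`LatticeCone.hasGerm_mul`).

For locality, `S` and `I` of a cone are functions of the linear forms in the rational span of its
lattice, so orthogonal cones have orthogonal germs. The delicate point is that germs form a locality
semigroup. If `u` is orthogonal to `f` through `(W₁, W₁')` and to `f'` through `(W₂, W₂')`, then `f
f'` depends on `W₁' ⊔ W₂'`, and one needs `u` to depend on `W₁ ⊓ W₂`. This is `DependsOn.inf`: after
clearing denominators, apply a linear retraction that fixes `W₂` and carries `W₁` into the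
intersection. When the intersection is `0` the variables separate, and `u` is a rational constant.
-/

noncomputable section

namespace LocCones

section

variable {σ τ : Type*}

/-! ### Substitution of linear forms in power series -/

/-- The linear form with coefficient vector `L` as a polynomial. -/
def linPoly (L : σ →₀ ℚ) : MvPolynomial σ ℚ :=
  ∑ j ∈ L.support, MvPolynomial.C (L j) * MvPolynomial.X j

/-- The linear form with the absolute values of the coefficients of `L`. -/
def absLinPoly (L : σ →₀ ℚ) : MvPolynomial σ ℚ :=
  ∑ j ∈ L.support, MvPolynomial.C |L j| * MvPolynomial.X j

theorem aeval_linPoly (L : σ →₀ ℚ) (z : σ → ℂ) :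
    MvPolynomial.aeval z (linPoly L) = linEval L z := by
  simp [linPoly, linEval, Finsupp.sum]

theorem linPoly_isHomogeneous (L : σ →₀ ℚ) : (linPoly L).IsHomogeneous 1 :=
  MvPolynomial.IsHomogeneous.sum _ _ _ fun j _ =>
    (MvPolynomial.isHomogeneous_C σ (L j)).mul (MvPolynomial.isHomogeneous_X ℚ j)

theorem vars_linPoly (L : σ →₀ ℚ) : (linPoly L).vars ⊆ L.support := by
  classical
  refine (MvPolynomial.vars_sum_subset _ _).trans ?_
  refine Finset.biUnion_subset.2 fun j hj => ?_
  refine (MvPolynomial.vars_mul _ _).trans ?_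
  simp [MvPolynomial.vars_C, MvPolynomial.vars_X, hj]

/-- The monomial `m` evaluated at a family of polynomials. -/
def monomialPoly (P : σ → MvPolynomial τ ℚ) (m : σ →₀ ℕ) : MvPolynomial τ ℚ :=
  ∏ i ∈ m.support, P i ^ m i

theorem aeval_monomialPoly (L : σ → (τ →₀ ℚ)) (m : σ →₀ ℕ) (z : τ → ℂ) :
    MvPolynomial.aeval z (monomialPoly (fun i => linPoly (L i)) m)
      = monomialAt (fun i => linEval (L i) z) m := by
  simp [monomialPoly, monomialAt, Finsupp.prod, aeval_linPoly]

theorem hasSum_coeff_mul_monomialAt (P : MvPolynomial σ ℚ) (z : σ → ℂ) :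
    HasSum (fun n => ((MvPolynomial.coeff n P : ℚ) : ℂ) * monomialAt z n)
      (MvPolynomial.aeval z P) := by
  rw [MvPolynomial.aeval_def, MvPolynomial.eval₂_eq]
  refine hasSum_sum_of_ne_finset_zero fun n hn => ?_
  rw [MvPolynomial.notMem_support_iff.1 hn]
  simp

/-- Coefficientwise domination of polynomials. -/
def CoeffDom (P Q : MvPolynomial σ ℚ) : Prop :=
  ∀ n, |MvPolynomial.coeff n P| ≤ MvPolynomial.coeff n Q

theorem CoeffDom.mul {P Q P' Q' : MvPolynomial σ ℚ} (h : CoeffDom P Q) (h' : CoeffDom P' Q') :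
    CoeffDom (P * P') (Q * Q') := by
  classical
  intro n
  rw [MvPolynomial.coeff_mul, MvPolynomial.coeff_mul]
  refine (Finset.abs_sum_le_sum_abs _ _).trans (Finset.sum_le_sum fun x _ => ?_)
  rw [abs_mul]
  exact mul_le_mul (h _) (h' _) (abs_nonneg _) ((abs_nonneg _).trans (h _))

theorem CoeffDom.one : CoeffDom (1 : MvPolynomial σ ℚ) 1 := by
  classical
  intro n
  rw [MvPolynomial.coeff_one]
  split_ifs <;> simp

theorem coeffDom_linPoly (L : σ →₀ ℚ) : CoeffDom (linPoly L) (absLinPoly L) := by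
  classical
  intro n
  rw [linPoly, absLinPoly, MvPolynomial.coeff_sum, MvPolynomial.coeff_sum]
  refine (Finset.abs_sum_le_sum_abs _ _).trans (Finset.sum_le_sum fun x _ => ?_)
  rw [MvPolynomial.coeff_C_mul, MvPolynomial.coeff_C_mul, MvPolynomial.coeff_X, abs_mul]
  split_ifs <;> simp

theorem CoeffDom.pow {P Q : MvPolynomial σ ℚ} (h : CoeffDom P Q) (k : ℕ) :
    CoeffDom (P ^ k) (Q ^ k) := by
  induction k with
  | zero => simpa using CoeffDom.one
  | succ k ih => rw [pow_succ, pow_succ]; exact ih.mul h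

theorem coeffDom_monomialPoly (L : σ → (τ →₀ ℚ)) (m : σ →₀ ℕ) :
    CoeffDom (monomialPoly (fun i => linPoly (L i)) m)
      (monomialPoly (fun i => absLinPoly (L i)) m) := by
  classical
  rw [monomialPoly, monomialPoly]
  induction m.support using Finset.induction_on with
  | empty => simpa using CoeffDom.one
  | insert a s ha ih =>
    rw [Finset.prod_insert ha, Finset.prod_insert ha]
    exact ((coeffDom_linPoly _).pow _).mul ih

theorem isHomogeneous_monomialPoly (L : σ → (τ →₀ ℚ)) (m : σ →₀ ℕ) :
    (monomialPoly (fun i => linPoly (L i)) m).IsHomogeneous m.degree := by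
  have h := MvPolynomial.IsHomogeneous.prod m.support (fun i => linPoly (L i) ^ m i)
    (fun i => 1 * m i) fun i _ => (linPoly_isHomogeneous (L i)).pow (m i)
  simpa [monomialPoly, Finsupp.degree_apply, Finsupp.sum] using h

theorem norm_monomialAt (z : σ → ℂ) (m : σ →₀ ℕ) :
    ‖monomialAt z m‖ = ∏ i ∈ m.support, ‖z i‖ ^ m i := by
  simp [monomialAt, Finsupp.prod]

/-- Bound for the value of the linear form `L` in terms of absolute values. -/
def absLinEval (L : σ →₀ ℚ) (z : σ → ℂ) : ℂ := ∑ j ∈ L.support, ((|L j| : ℚ) : ℂ) * (‖z j‖ : ℂ)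

theorem continuous_absLinEval (L : σ →₀ ℚ) : Continuous (absLinEval L) := by
  unfold absLinEval
  fun_prop

theorem continuous_linEval (L : σ →₀ ℚ) : Continuous (linEval L) := by
  unfold linEval Finsupp.sum
  fun_prop

theorem linEval_zero_right (L : σ →₀ ℚ) : linEval L 0 = 0 := by
  simp [linEval]

theorem summable_mul_of_dominated {α β : Type*} {c : α → ℂ} {e : α → β → ℂ} {D : α → β → ℝ}
    {S : α → ℝ} (hD : ∀ m, HasSum (D m) (S m)) (he : ∀ m n, ‖e m n‖ ≤ D m n)
    (h : Summable fun m => ‖c m‖ * S m) : Summable fun x : α × β => c x.1 * e x.1 x.2 := by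
  have hnn : 0 ≤ fun x : α × β => ‖c x.1‖ * D x.1 x.2 := by
    intro x
    exact mul_nonneg (norm_nonneg (c x.1)) ((norm_nonneg _).trans (he x.1 x.2))
  refine Summable.of_norm_bounded (g := fun x : α × β => ‖c x.1‖ * D x.1 x.2) ?_ fun x => ?_
  · refine (summable_prod_of_nonneg hnn).2 ⟨fun m => ((hD m).mul_left ‖c m‖).summable, ?_⟩
    have : (fun m => ∑' n, ‖c m‖ * D m n) = fun m => ‖c m‖ * S m := by
      funext m
      exact ((hD m).mul_left _).tsum_eq
    exact this ▸ h
  · rw [norm_mul]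
    exact mul_le_mul_of_nonneg_left (he _ _) (norm_nonneg _)

/-- Taking absolute values of the coefficients of the forms and of the coordinates of `z` majorises
the double family. The majorant sums over the second index to a monomial at the point `absLinEval (L
i) z`, so absolute convergence at that single point suffices. -/
theorem summable_subst {c : (σ →₀ ℕ) → ℂ} (L : σ → (τ →₀ ℚ)) (z : τ → ℂ)
    (h : Summable fun m => c m * monomialAt (fun i => absLinEval (L i) z) m) :
    Summable fun x : (σ →₀ ℕ) × (τ →₀ ℕ) =>
      c x.1 * (((MvPolynomial.coeff x.2 (monomialPoly (fun i => linPoly (L i)) x.1) : ℚ) : ℂ)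
        * monomialAt z x.2) := by
  have key : ∀ m : σ →₀ ℕ, HasSum (fun n : τ →₀ ℕ =>
      ((MvPolynomial.coeff n (monomialPoly (fun i => absLinPoly (L i)) m) : ℚ) : ℝ)
        * ‖monomialAt z n‖) ‖monomialAt (fun i => absLinEval (L i) z) m‖ := by
    intro m
    have h1 := hasSum_coeff_mul_monomialAt (monomialPoly (fun i => absLinPoly (L i)) m)
      (fun j => (‖z j‖ : ℂ))
    have h2 : MvPolynomial.aeval (fun j => (‖z j‖ : ℂ)) (monomialPoly (fun i => absLinPoly (L i)) m)
        = (‖monomialAt (fun i => absLinEval (L i) z) m‖ : ℂ) := by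
      rw [norm_monomialAt]
      simp only [monomialPoly, map_prod, map_pow, absLinPoly, map_sum, map_mul,
        MvPolynomial.aeval_X, MvPolynomial.aeval_C, Complex.ofReal_prod, Complex.ofReal_pow]
      refine Finset.prod_congr rfl fun i _ => ?_
      have : (absLinEval (L i) z) =
        ((∑ j ∈ (L i).support, ((|(L i) j| : ℚ) : ℝ) * ‖z j‖ : ℝ) : ℂ) := by
        simp only [absLinEval, Complex.ofReal_sum, Complex.ofReal_mul, Complex.ofReal_ratCast]
      rw [this, Complex.norm_real, Real.norm_of_nonneg (Finset.sum_nonneg fun j _ => by positivity)]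
      simp only [Complex.ofReal_sum, Complex.ofReal_mul, Complex.ofReal_ratCast, eq_ratCast]
    rw [h2] at h1
    rw [← Complex.hasSum_ofReal]
    convert h1 using 1
    funext n
    rw [norm_monomialAt]
    simp [monomialAt, Finsupp.prod]
  have bound : ∀ m n, ‖((MvPolynomial.coeff n (monomialPoly (fun i => linPoly (L i)) m) : ℚ)
      : ℂ) * monomialAt z n‖ ≤
        ((MvPolynomial.coeff n (monomialPoly (fun i => absLinPoly (L i)) m) : ℚ) : ℝ)
        * ‖monomialAt z n‖ := by
    intro m n
    rw [norm_mul]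
    gcongr
    have := coeffDom_monomialPoly L m n
    rw [Complex.norm_ratCast]
    exact_mod_cast this
  have hn : Summable fun m => ‖c m‖ * ‖monomialAt (fun i => absLinEval (L i) z) m‖ := by
    have := h.norm
    simp only [norm_mul] at this
    exact this
  exact summable_mul_of_dominated (c := c)
    (e := fun (m : σ →₀ ℕ) (n : τ →₀ ℕ) =>
      ((MvPolynomial.coeff n (monomialPoly (fun i => linPoly (L i)) m) : ℚ) : ℂ) * monomialAt z n)
    (D := fun (m : σ →₀ ℕ) (n : τ →₀ ℕ) =>
      ((MvPolynomial.coeff n (monomialPoly (fun i => absLinPoly (L i)) m) : ℚ) : ℝ)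
        * ‖monomialAt z n‖) key bound hn

/-- Linear substitution preserves degree. Hence only finitely many monomials in the variables `t`
contribute to a given coefficient of the composite. -/
theorem coeff_monomialPoly_eq_zero [DecidableEq σ] {L : σ → (τ →₀ ℚ)} {t : Finset σ} {n : τ →₀ ℕ}
    {m : σ →₀ ℕ} (hm : m.support ⊆ t) (h : m ∉ t.finsuppAntidiag n.degree) :
    MvPolynomial.coeff n (monomialPoly (fun i => linPoly (L i)) m) = 0 := by
  refine (isHomogeneous_monomialPoly L m).coeff_eq_zero fun hd => h ?_
  rw [Finset.mem_finsuppAntidiag]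
  refine ⟨?_, hm⟩
  rw [hd, Finsupp.degree_apply]
  exact (Finset.sum_subset hm fun i _ hi => Finsupp.notMem_support_iff.1 hi).symm

/-- By homogeneity each coefficient of the composite is a finite sum of rationals. The double series
is absolutely summable, so summing over the old monomials first gives the value, and summing over
the new ones first gives the expansion. -/
theorem IsRatHolomorphic.comp_linear {F : (σ → ℂ) → ℂ} (hF : IsRatHolomorphic F)
    (L : σ → (τ →₀ ℚ)) : IsRatHolomorphic fun z : τ → ℂ => F fun i => linEval (L i) z := by
  classical
  obtain ⟨t, p, hp, hFp⟩ := hF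
  let q : MvPowerSeries τ ℚ := fun n => ∑ m ∈ t.finsuppAntidiag n.degree,
    MvPowerSeries.coeff m p * MvPolynomial.coeff n (monomialPoly (fun i => linPoly (L i)) m)
  have hq : ∀ n, MvPowerSeries.coeff n q = ∑ m ∈ t.finsuppAntidiag n.degree,
    MvPowerSeries.coeff m p *
      MvPolynomial.coeff n (monomialPoly (fun i => linPoly (L i)) m) := fun n => rfl
  refine ⟨t.biUnion fun i => (L i).support, q, ?_, ?_⟩
  · intro n hn
    rw [hq] at hn
    obtain ⟨m, hm, hne⟩ := Finset.exists_ne_zero_of_sum_ne_zero hn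
    have h2 := right_ne_zero_of_mul hne
    intro j hj
    have hj' : j ∈ (monomialPoly (fun i => linPoly (L i)) m).vars :=
      (MvPolynomial.mem_vars_iff_mem_support j).2 ⟨n, MvPolynomial.mem_support_iff.2 h2, hj⟩
    have h3 := MvPolynomial.vars_prod (fun i => linPoly (L i) ^ m i) (s := m.support) hj'
    obtain ⟨i, hi, hji⟩ := Finset.mem_biUnion.1 h3
    exact Finset.mem_biUnion.2 ⟨i, (Finset.mem_finsuppAntidiag.1 hm).2 hi,
      vars_linPoly _ (MvPolynomial.vars_pow _ _ hji)⟩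
  · have t1 : Tendsto (fun z : τ → ℂ => fun i => linEval (L i) z) (𝓝 0) (𝓝 (0 : σ → ℂ)) := by
      have : Continuous fun z : τ → ℂ => fun i => linEval (L i) z :=
        continuous_pi fun i => continuous_linEval (L i)
      convert! this.tendsto 0 using 2
      funext i
      simp [linEval]
    have t2 : Tendsto (fun z : τ → ℂ => fun i => absLinEval (L i) z) (𝓝 0) (𝓝 (0 : σ → ℂ)) := by
      have : Continuous fun z : τ → ℂ => fun i => absLinEval (L i) z :=
        continuous_pi fun i => continuous_absLinEval (L i)
      convert! this.tendsto 0 using 2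
      funext i
      simp [absLinEval]
    -- Convergence of the original series is needed at two points: the substituted one, for its
    -- value, and the one built from absolute values, for summability.
    filter_upwards [t1.eventually hFp, t2.eventually hFp] with z h1 h2
    have hs := summable_subst L z h2.summable
    have h3 : HasSum (fun m => ((MvPowerSeries.coeff m p : ℚ) : ℂ) *
        monomialAt (fun i => linEval (L i) z) m) _ := hs.hasSum.prod_fiberwise fun m => by
      have := (hasSum_coeff_mul_monomialAt (monomialPoly (fun i => linPoly (L i)) m) z).mul_left
        ((MvPowerSeries.coeff m p : ℚ) : ℂ)
      rwa [aeval_monomialPoly] at this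
    have h4 := hs.hasSum
    rw [h3.unique h1, ← (Equiv.prodComm _ _).hasSum_iff] at h4
    refine h4.prod_fiberwise fun n => ?_
    rw [hq]
    push_cast
    rw [Finset.sum_mul]
    have h5 := hasSum_sum_of_ne_finset_zero (s := t.finsuppAntidiag n.degree)
      (f := fun m : σ →₀ ℕ => ((MvPowerSeries.coeff m p : ℚ) : ℂ) *
        (((MvPolynomial.coeff n (monomialPoly (fun i => linPoly (L i)) m) : ℚ) : ℂ)
        * monomialAt z n)) (L := SummationFilter.unconditional _) fun m hm => by
          by_cases h0 : MvPowerSeries.coeff m p = 0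
          · simp [h0]
          · simp [coeff_monomialPoly_eq_zero (hp m h0) hm]
    simpa [Function.comp_def, mul_assoc] using h5

/-! ### The identity theorem -/

/-- The zeros `ε` accumulate at `0`, so the one-variable identity theorem applies. -/
theorem hasSum_pow_eq_zero {a : ℕ → ℂ} {δ : ℝ} (hδ : 0 < δ)
    (h : ∀ ε : ℝ, 0 < ε → ε < δ → HasSum (fun k => (ε : ℂ) ^ k * a k) 0) : a = 0 := by
  let p := FormalMultilinearSeries.ofScalars ℂ a
  have hsum : ∀ x, p.sum x = ∑' n, a n • x ^ n := fun x =>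
    FormalMultilinearSeries.ofScalars_sum_eq a x
  have hr : 0 < p.radius := by
    have h1 := (h (δ / 2) (by linarith) (by linarith)).summable.norm
    have h2 : ((Real.toNNReal (δ / 2) : NNReal) : ENNReal) ≤ p.radius := by
      refine p.le_radius_of_summable (h1.congr fun n => ?_)
      rw [FormalMultilinearSeries.ofScalars_norm]
      simp only [norm_mul, norm_pow, Complex.norm_real]
      rw [Real.coe_toNNReal _ (by linarith), Real.norm_of_nonneg (by linarith : (0 : ℝ) ≤ δ / 2), mul_comm]
    refine lt_of_lt_of_le ?_ h2
    rw [ENNReal.coe_pos, Real.toNNReal_pos]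
    linarith
  have hball := p.hasFPowerSeriesOnBall hr
  have hfreq : ∃ᶠ z in 𝓝[≠] (0 : ℂ), p.sum z = 0 := by
    have ht : Tendsto (fun ε : ℝ => (ε : ℂ)) (𝓝[>] 0) (𝓝[≠] 0) := by
      refine tendsto_nhdsWithin_of_tendsto_nhds_of_eventually_within _ ?_ ?_
      · exact (Complex.continuous_ofReal.tendsto' 0 0 (by simp)).mono_left nhdsWithin_le_nhds
      · filter_upwards [self_mem_nhdsWithin] with ε hε
        simpa using (ne_of_gt hε : ε ≠ 0)
    refine ht.frequently (Eventually.frequently ?_)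
    filter_upwards [Ioo_mem_nhdsGT hδ] with ε hε
    rw [hsum]
    have := (h ε hε.1 hε.2).tsum_eq
    simpa [mul_comm] using this
  have hev := hball.analyticAt.frequently_zero_iff_eventually_zero.1 hfreq
  have hp : p = 0 := hball.hasFPowerSeriesAt.eq_zero_of_eventually hev
  exact (FormalMultilinearSeries.ofScalars_series_eq_zero ℂ (c := a)).1 hp

/-- The real linear forms near `0` in `U` determine germs: `U` contains the multiples of an
algebraically open neighbourhood of some point. -/
def IsFat (U : Set (σ → ℝ)) : Prop :=
  ∃ z₀ : σ → ℝ, ∀ w : σ → ℝ, ∀ᶠ s in 𝓝 (0 : ℝ), ∀ ε : ℝ, 0 < ε → ε • (z₀ + s • w) ∈ U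

theorem isFat_univ : IsFat (Set.univ : Set (σ → ℝ)) :=
  ⟨0, fun _ => Eventually.of_forall fun _ _ _ => Set.mem_univ _⟩

theorem monomialAt_smul (ε : ℂ) (z : σ → ℂ) (m : σ →₀ ℕ) :
    monomialAt (ε • z) m = ε ^ m.degree * monomialAt z m := by
  simp only [monomialAt, Finsupp.prod, Pi.smul_apply, smul_eq_mul, mul_pow,
    Finset.prod_mul_distrib, Finsupp.degree_apply, Finset.prod_pow_eq_pow_sum]

/-- On a ray inside `U` the series is a power series in `ε`, so each homogeneous part vanishes on
the ray. Along a line through the base point such a part is a polynomial in `s` with infinitely many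
zeros, hence vanishes on the whole line. These lines reach every real point, and a polynomial
vanishing at all real points is zero. -/
theorem coeff_eq_zero_of_hasSum_zero {c : (σ →₀ ℕ) → ℂ} {t : Finset σ}
    (hc : ∀ m, c m ≠ 0 → m.support ⊆ t) {U : Set (σ → ℝ)} (hU : IsFat U)
    (h : ∀ᶠ z in 𝓝 (0 : σ → ℝ), z ∈ U →
      HasSum (fun m => c m * monomialAt (fun i => (z i : ℂ)) m) 0) : c = 0 := by
  classical
  obtain ⟨z₀, hz₀⟩ := hU
  let G : ℕ → MvPolynomial σ ℂ := fun k => ∑ m ∈ t.finsuppAntidiag k, MvPolynomial.monomial m (c m)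
  have hG : ∀ k (y : σ → ℂ), MvPolynomial.eval y (G k)
      = ∑ m ∈ t.finsuppAntidiag k, c m * monomialAt y m := by
    intro k y
    simp [G, MvPolynomial.eval_monomial, monomialAt]
  have hdeg : ∀ m : σ →₀ ℕ, m.support ⊆ t → m ∈ t.finsuppAntidiag m.degree := by
    intro m hm
    rw [Finset.mem_finsuppAntidiag, Finsupp.degree_apply]
    exact ⟨(Finset.sum_subset hm fun i _ hi => Finsupp.notMem_support_iff.1 hi).symm, hm⟩
  have hdeg' : ∀ (m : σ →₀ ℕ) k, m ∈ t.finsuppAntidiag k → m.degree = k := by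
    intro m k hm
    obtain ⟨h1, h2⟩ := Finset.mem_finsuppAntidiag.1 hm
    rw [← h1, Finsupp.degree_apply]
    exact Finset.sum_subset h2 fun i _ hi => Finsupp.notMem_support_iff.1 hi
  have step1 : ∀ y : σ → ℝ, (∀ ε : ℝ, 0 < ε → ε • y ∈ U) →
      ∀ k, MvPolynomial.eval (fun i => (y i : ℂ)) (G k) = 0 := by
    intro y hy k
    have ht : Tendsto (fun ε : ℝ => ε • y) (𝓝 0) (𝓝 (0 : σ → ℝ)) := by
      have : Continuous fun ε : ℝ => ε • y := by fun_prop
      exact this.tendsto' 0 0 (by simp)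
    obtain ⟨δ, hδ, hball⟩ := Metric.eventually_nhds_iff.1 (ht.eventually h)
    have := hasSum_pow_eq_zero (a := fun k => MvPolynomial.eval (fun i => (y i : ℂ)) (G k)) hδ ?_
    · exact congrFun this k
    intro ε hε hεδ
    have h1 := hball (y := ε) (by simpa [abs_of_pos hε] using hεδ) (hy ε hε)
    -- Grouping by degree turns the series at `ε • y` into a power series in `ε` whose coefficients
    -- are the values of the homogeneous parts at `y`.
    have h2 := h1.tsum_fiberwise (fun m : σ →₀ ℕ => m.degree)
    refine Eq.mp (congrArg (fun f => HasSum f 0) (funext fun k => ?_)) h2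
    symm
    rw [hG, tsum_subtype ((fun m : σ →₀ ℕ => m.degree) ⁻¹' {k}) (fun m : σ →₀ ℕ =>
      c m * monomialAt (fun i => (((ε • y) i : ℝ) : ℂ)) m), tsum_eq_sum (s := t.finsuppAntidiag k),
      Finset.mul_sum]
    · refine Finset.sum_congr rfl fun m hm => ?_
      have hk := hdeg' m k hm
      rw [Set.indicator_of_mem (by simpa using hk)]
      have : (fun i => (((ε • y) i : ℝ) : ℂ)) = (ε : ℂ) • fun i => (y i : ℂ) := by
        funext i
        simp
      rw [this, monomialAt_smul, hk]
      ring
    · intro m hm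
      by_cases hk : m.degree = k
      · rw [Set.indicator_of_mem (by simpa using hk)]
        by_cases h0 : c m = 0
        · simp [h0]
        · exact absurd (hk ▸ hdeg m (hc m h0)) hm
      · rw [Set.indicator_of_notMem (by simpa using hk)]
  have step2 : ∀ k, G k = 0 := by
    intro k
    refine MvPolynomial.funext_set (fun _ => Set.range ((↑) : ℝ → ℂ))
      (fun _ => Set.infinite_range_of_injective Complex.ofReal_injective) fun x hx => ?_
    choose x' hx' using fun i => hx i (Set.mem_univ i)
    let P : Polynomial ℂ := MvPolynomial.aeval (fun i => Polynomial.C ((z₀ i : ℝ) : ℂ) +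
      Polynomial.X * Polynomial.C (x i - z₀ i)) (G k)
    have hP : ∀ s : ℂ, P.eval s = MvPolynomial.eval (fun i => (z₀ i : ℂ) + s * (x i - z₀ i)) (G k) := by
      intro s
      have : P.eval s = (Polynomial.evalRingHom s) P := rfl
      rw [this]
      simp only [P]
      rw [MvPolynomial.aeval_def, MvPolynomial.hom_eval₂]
      rw [MvPolynomial.eval₂_eq, MvPolynomial.eval_eq]
      simp
    have hP0 : P = 0 := by
      refine Polynomial.eq_zero_of_infinite_isRoot _ ?_
      have hev := hz₀ (fun i => x' i - z₀ i)
      obtain ⟨δ, hδ, hball⟩ := Metric.eventually_nhds_iff.1 hev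
      have hinf : ((fun s : ℝ => (s : ℂ)) '' Set.Ioo 0 δ).Infinite :=
        (Set.Ioo_infinite hδ).image Complex.ofReal_injective.injOn
      refine hinf.mono ?_
      rintro _ ⟨s, hs, rfl⟩
      have := step1 _ (hball (y := s) (by simpa [abs_of_pos hs.1] using hs.2)) k
      simp only [Set.mem_ofPred_eq, Polynomial.IsRoot.def]
      rw [hP]
      convert this using 3
      funext i
      simp [← hx']
    -- The parameter `s = 1` is the point `x` itself.
    have h1 := hP 1
    rw [hP0] at h1
    simpa using h1.symm
  funext m
  by_contra h0
  have h1 := congrArg (MvPolynomial.coeff m) (step2 m.degree)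
  simp only [G, MvPolynomial.coeff_sum, MvPolynomial.coeff_monomial, MvPolynomial.coeff_zero] at h1
  rw [Finset.sum_ite_eq' , if_pos (hdeg m (hc m h0))] at h1
  exact h0 h1

/-! ### Power series in one variable, evaluated at a linear form -/

theorem isRatHolomorphic_powerSeries_linEval {a : ℕ → ℚ} {f : ℂ → ℂ}
    (h : ∀ᶠ x in 𝓝 (0 : ℂ), HasSum (fun n => (a n : ℂ) * x ^ n) (f x)) (L : τ →₀ ℚ) :
    IsRatHolomorphic fun z : τ → ℂ => f (linEval L z) := by
  have h1 : IsRatHolomorphic fun z : Unit → ℂ => f (z ()) := by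
    refine ⟨{()}, fun m => a (m ()), fun m _ => by simp [Finset.subset_iff], ?_⟩
    have ht : Tendsto (fun z : Unit → ℂ => z ()) (𝓝 0) (𝓝 0) :=
      (continuous_apply ()).tendsto' _ _ rfl
    filter_upwards [ht.eventually h] with z hz
    rw [← (Finsupp.uniqueEquiv ()).hasSum_iff] at hz
    convert hz using 1
    funext m
    have : monomialAt z m = z () ^ (m ()) := by
      rw [monomialAt, Finsupp.prod_fintype _ _ (fun _ => pow_zero _)]
      simp
    rw [this]
    rfl
  exact h1.comp_linear fun _ => L

end

section

variable {σ τ : Type*}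

/-! ### Germs are determined on fat sets of real points -/

theorem tendsto_ofReal_pi :
    Tendsto (fun (z : σ → ℝ) (i : σ) => (z i : ℂ)) (𝓝 0) (𝓝 0) := by
  have : Continuous fun (z : σ → ℝ) (i : σ) => (z i : ℂ) := by fun_prop
  exact this.tendsto' _ _ (by funext i; simp)

theorem IsRatHolomorphic.eventuallyEq_zero_of_isFat {F : (σ → ℂ) → ℂ} (hF : IsRatHolomorphic F)
    {U : Set (σ → ℝ)} (hU : IsFat U)
    (h : ∀ᶠ z in 𝓝 (0 : σ → ℝ), z ∈ U → F (fun i => (z i : ℂ)) = 0) : F =ᶠ[𝓝 0] 0 := by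
  obtain ⟨t, p, hp, hFp⟩ := hF
  have hc : (fun m => ((MvPowerSeries.coeff m p : ℚ) : ℂ)) = 0 := by
    refine coeff_eq_zero_of_hasSum_zero (t := t) (fun m hm => hp m (by simpa using hm)) hU ?_
    filter_upwards [h, tendsto_ofReal_pi.eventually hFp] with z h1 h2 hz
    rwa [h1 hz] at h2
  filter_upwards [hFp] with z hz
  refine hz.unique ?_
  have : ∀ m, ((MvPowerSeries.coeff m p : ℚ) : ℂ) = 0 := fun m => congrFun hc m
  simp only [this, zero_mul]
  exact hasSum_zero

theorem IsRatHolomorphic.eventuallyEq_of_isFat {F G : (σ → ℂ) → ℂ} (hF : IsRatHolomorphic F)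
    (hG : IsRatHolomorphic G) {U : Set (σ → ℝ)} (hU : IsFat U)
    (h : ∀ᶠ z in 𝓝 (0 : σ → ℝ), z ∈ U → F (fun i => (z i : ℂ)) = G (fun i => (z i : ℂ))) :
    F =ᶠ[𝓝 0] G := by
  have h1 := (hF.add hG.neg).eventuallyEq_zero_of_isFat hU (by
    filter_upwards [h] with z hz hzU
    simp [hz hzU])
  filter_upwards [h1] with z hz
  have : F z + -G z = 0 := hz
  linear_combination this

theorem linEval_add (L M : σ →₀ ℚ) (z : σ → ℂ) :
    linEval (L + M) z = linEval L z + linEval M z :=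
  Finsupp.sum_add_index' (fun i => by simp) (fun i a b => by push_cast; ring)

theorem linEval_smul (a : ℚ) (L : σ →₀ ℚ) (z : σ → ℂ) :
    linEval (a • L) z = a * linEval L z := by
  rw [linEval, Finsupp.sum_smul_index fun i => by simp]
  simp only [linEval, Finsupp.sum, Finset.mul_sum]
  exact Finset.sum_congr rfl fun i _ => by push_cast; ring

theorem linEval_single (i : σ) (a : ℚ) (z : σ → ℂ) :
    linEval (Finsupp.single i a) z = a * z i := by
  simp [linEval]

theorem linEval_add_right (L : σ →₀ ℚ) (z w : σ → ℂ) :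
    linEval L (z + w) = linEval L z + linEval L w := by
  simp [linEval, Finsupp.sum, mul_add, Finset.sum_add_distrib]

theorem linEval_smul_right (L : σ →₀ ℚ) (c : ℂ) (z : σ → ℂ) :
    linEval L (c • z) = c * linEval L z := by
  simp only [linEval, Finsupp.sum, Finset.mul_sum, Pi.smul_apply, smul_eq_mul]
  exact Finset.sum_congr rfl fun i _ => by ring

/-- Take as base point a coordinate vector on which `L` is nonzero. Continuity in `s` and
homogeneity in `ε` do the rest. -/
theorem isFat_linEval_ne_zero {L : σ →₀ ℚ} (hL : L ≠ 0) :
    IsFat {z : σ → ℝ | linEval L (fun i => (z i : ℂ)) ≠ 0} := by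
  classical
  obtain ⟨i, hi⟩ := Finsupp.ne_iff.1 hL
  refine ⟨Pi.single i 1, fun w => ?_⟩
  have hcont : Continuous fun s : ℝ =>
      linEval L (fun j => (((Pi.single i 1 + s • w : σ → ℝ) j : ℝ) : ℂ)) :=
    (continuous_linEval L).comp (by fun_prop)
  have h0 : linEval L (fun j => (((Pi.single i 1 + (0 : ℝ) • w : σ → ℝ) j : ℝ) : ℂ)) ≠ 0 := by
    have : linEval L (fun j => (((Pi.single i 1 + (0 : ℝ) • w : σ → ℝ) j : ℝ) : ℂ)) = L i := by
      rw [linEval, Finsupp.sum_eq_single i]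
      · simp
      · intro j _ hj
        simp [hj]
      · simp
    rw [this]
    simpa using hi
  filter_upwards [hcont.continuousAt.eventually_ne h0] with s hs ε hε
  have : (fun j => (((ε • (Pi.single i 1 + s • w) : σ → ℝ) j : ℝ) : ℂ))
      = (ε : ℂ) • fun j => (((Pi.single i 1 + s • w : σ → ℝ) j : ℝ) : ℂ) := by
    funext j
    simp
  change linEval L (fun j => (((ε • (Pi.single i 1 + s • w) : σ → ℝ) j : ℝ) : ℂ)) ≠ 0
  rw [this, linEval_smul_right]
  exact mul_ne_zero (by exact_mod_cast hε.ne') hs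

/-! ### The ring of holomorphic germs -/

theorem IsRatHolomorphic.germ_eq_iff {F G : (σ → ℂ) → ℂ} {hF : IsRatHolomorphic F}
    {hG : IsRatHolomorphic G} : hF.germ = hG.germ ↔ F =ᶠ[𝓝 0] G := by
  rw [Subtype.ext_iff]
  exact Germ.coe_eq

theorem exists_germ_eq (G : HolGerm σ) : ∃ (F : (σ → ℂ) → ℂ) (hF : IsRatHolomorphic F),
    hF.germ = G := by
  obtain ⟨_, F, hF, rfl⟩ := G
  exact ⟨F, hF, rfl⟩

theorem IsRatHolomorphic.germ_mul {F G : (σ → ℂ) → ℂ} (hF : IsRatHolomorphic F)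
    (hG : IsRatHolomorphic G) : hF.germ * hG.germ = (hF.mul hG).germ := rfl

theorem IsRatHolomorphic.germ_add {F G : (σ → ℂ) → ℂ} (hF : IsRatHolomorphic F)
    (hG : IsRatHolomorphic G) : hF.germ + hG.germ = (hF.add hG).germ := rfl

theorem isRatHolomorphic_one : IsRatHolomorphic (fun _ : σ → ℂ => (1 : ℂ)) := by
  simpa using isRatHolomorphic_const (σ := σ) 1

theorem germ_one : (isRatHolomorphic_one (σ := σ)).germ = 1 := rfl

theorem isRatHolomorphic_zero : IsRatHolomorphic (fun _ : σ → ℂ => (0 : ℂ)) := by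
  simpa using isRatHolomorphic_const (σ := σ) 0

theorem germ_zero : (isRatHolomorphic_zero (σ := σ)).germ = 0 := rfl

/-- A germ annihilated by `L` vanishes off the kernel of `L`, and that complement is fat. -/
theorem linGerm_mem_nonZeroDivisors {L : σ →₀ ℚ} (hL : L ≠ 0) :
    linGerm L ∈ nonZeroDivisors (HolGerm σ) := by
  rw [mem_nonZeroDivisors_iff_right]
  intro G hG
  obtain ⟨F, hF, rfl⟩ := exists_germ_eq G
  rw [linGerm, IsRatHolomorphic.germ_mul, ← germ_zero, IsRatHolomorphic.germ_eq_iff] at hG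
  rw [← germ_zero, IsRatHolomorphic.germ_eq_iff]
  refine hF.eventuallyEq_zero_of_isFat (isFat_linEval_ne_zero hL) ?_
  filter_upwards [tendsto_ofReal_pi.eventually hG] with z hz hne
  exact (mul_eq_zero.1 hz).resolve_right hne

theorem linProducts_le_nonZeroDivisors : linProducts σ ≤ nonZeroDivisors (HolGerm σ) := by
  refine (Submonoid.closure_le).2 ?_
  rintro _ ⟨L, hL, rfl⟩
  exact linGerm_mem_nonZeroDivisors hL

theorem toMero_injective : Function.Injective (toMero (σ := σ)) :=
  IsLocalization.injective (Mero σ) linProducts_le_nonZeroDivisors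

@[simp] theorem toMero_mul (G H : HolGerm σ) : toMero (G * H) = toMero G * toMero H :=
  map_mul (algebraMap (HolGerm σ) (Mero σ)) G H

@[simp] theorem toMero_add (G H : HolGerm σ) : toMero (G + H) = toMero G + toMero H :=
  map_add (algebraMap (HolGerm σ) (Mero σ)) G H

@[simp] theorem toMero_one : toMero (1 : HolGerm σ) = 1 :=
  map_one (algebraMap (HolGerm σ) (Mero σ))

@[simp] theorem toMero_zero : toMero (0 : HolGerm σ) = 0 :=
  map_zero (algebraMap (HolGerm σ) (Mero σ))

theorem list_prod_mem_linProducts {s : List (σ →₀ ℚ)} (hs : ∀ L ∈ s, L ≠ 0) :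
    (s.map linGerm).prod ∈ linProducts σ := by
  refine Submonoid.list_prod_mem _ fun g hg => ?_
  obtain ⟨L, hL, rfl⟩ := List.mem_map.1 hg
  exact Submonoid.subset_closure ⟨L, hs L hL, rfl⟩

theorem isUnit_linProd {s : List (σ →₀ ℚ)} (hs : ∀ L ∈ s, L ≠ 0) : IsUnit (linProd s) :=
  IsLocalization.map_units (Mero σ) (⟨_, list_prod_mem_linProducts hs⟩ : linProducts σ)

@[simp] theorem linProd_nil : linProd ([] : List (σ →₀ ℚ)) = 1 := by simp [linProd]

@[simp] theorem linProd_cons (L : σ →₀ ℚ) (s : List (σ →₀ ℚ)) :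
    linProd (L :: s) = toMero (linGerm L) * linProd s := by simp [linProd]

@[simp] theorem linProd_append (s s' : List (σ →₀ ℚ)) :
    linProd (s ++ s') = linProd s * linProd s' := by simp [linProd]

theorem list_prod_linGerm (s : List (σ →₀ ℚ)) :
    ∃ hF : IsRatHolomorphic fun z : σ → ℂ => (s.map fun L => linEval L z).prod,
      (s.map linGerm).prod = hF.germ := by
  induction s with
  | nil => exact ⟨by simpa using isRatHolomorphic_one, rfl⟩
  | cons L s ih =>
    obtain ⟨hF, h⟩ := ih
    refine ⟨by simpa [Pi.mul_def] using (isRatHolomorphic_linEval L).mul hF, ?_⟩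
    rw [List.map_cons, List.prod_cons, h, linGerm, IsRatHolomorphic.germ_mul,
      IsRatHolomorphic.germ_eq_iff]
    exact Eventually.of_forall fun z => by simp

/-! ### Exponentials of linear forms -/

/-- The entire function `(exp x - 1) / x`. -/
def expSubOneDiv (x : ℂ) : ℂ := ∑' n : ℕ, (((n + 1).factorial : ℚ)⁻¹ : ℚ) * x ^ n

theorem hasSum_exp_rat (x : ℂ) :
    HasSum (fun n : ℕ => (((n.factorial : ℚ)⁻¹ : ℚ) : ℂ) * x ^ n) (Complex.exp x) := by
  rw [Complex.exp_eq_exp_ℂ]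
  convert! NormedSpace.expSeries_div_hasSum_exp (𝔸 := ℂ) x using 1
  funext n
  push_cast
  rw [div_eq_inv_mul]

theorem summable_expSubOneDiv (x : ℂ) :
    Summable fun n : ℕ => ((((n + 1).factorial : ℚ)⁻¹ : ℚ) : ℂ) * x ^ n := by
  refine Summable.of_norm_bounded (hasSum_exp_rat x).summable.norm fun n => ?_
  rw [norm_mul, norm_mul, Complex.norm_ratCast, Complex.norm_ratCast]
  refine mul_le_mul_of_nonneg_right ?_ (norm_nonneg _)
  have h1 : ((n.factorial : ℝ)) ≤ ((n + 1).factorial : ℝ) := by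
    exact_mod_cast Nat.factorial_le (Nat.le_succ n)
  have h2 : (0 : ℝ) < n.factorial := by exact_mod_cast n.factorial_pos
  push_cast
  rw [abs_of_nonneg (by positivity), abs_of_nonneg (by positivity)]
  exact inv_anti₀ h2 h1

theorem hasSum_expSubOneDiv (x : ℂ) :
    HasSum (fun n : ℕ => ((((n + 1).factorial : ℚ)⁻¹ : ℚ) : ℂ) * x ^ n) (expSubOneDiv x) :=
  (summable_expSubOneDiv x).hasSum

theorem mul_expSubOneDiv (x : ℂ) : x * expSubOneDiv x = Complex.exp x - 1 := by
  have h1 := (hasSum_nat_add_iff' 1).2 (hasSum_exp_rat x)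
  have h2 := (hasSum_expSubOneDiv x).mul_left x
  refine h2.unique ?_
  convert! h1 using 1
  · funext n
    ring
  · simp

/-- The Taylor coefficients of `x / (exp x - 1)`. -/
def todd : PowerSeries ℚ := (PowerSeries.mk fun n => ((n + 1).factorial : ℚ)⁻¹)⁻¹

/-- The recursion expresses a coefficient by the earlier ones with weights `1 / (k + 1)! ≤ 2 ^
(-k)`, `k ≥ 1`, whose sum is at most `1`. This is what makes the series converge on the unit disc.
-/
theorem abs_coeff_todd_le (n : ℕ) : |PowerSeries.coeff n todd| ≤ 1 := by
  induction n using Nat.strong_induction_on with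
  | _ n ih =>
    rw [todd, PowerSeries.coeff_inv]
    split_ifs with h0
    · simp
    rw [← todd]
    simp only [← PowerSeries.coeff_zero_eq_constantCoeff, PowerSeries.coeff_mk]
    rw [neg_mul, abs_neg, abs_mul]
    obtain ⟨k, rfl⟩ := Nat.exists_eq_succ_of_ne_zero h0
    -- The pair with `x.1 = 0` is the coefficient being computed, which the recursion leaves out;
    -- hence the bound `0` there.
    have hb : ∀ x ∈ Finset.HasAntidiagonal.antidiagonal (k + 1), |if x.2 < k + 1 then
        ((x.1 + 1).factorial : ℚ)⁻¹ * PowerSeries.coeff x.2 todd else 0|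
        ≤ if x.1 = 0 then 0 else (1 / 2 : ℚ) ^ x.1 := by
      intro x hx
      have hx' := Finset.HasAntidiagonal.mem_antidiagonal.1 hx
      split_ifs with h1 h2 h2
      · omega
      · rw [abs_mul, abs_of_nonneg (by positivity)]
        have h3 : ((x.1 + 1).factorial : ℚ)⁻¹ ≤ (1 / 2 : ℚ) ^ x.1 := by
          rw [one_div, inv_pow]
          refine inv_anti₀ (by positivity) ?_
          have : ∀ m : ℕ, 2 ^ m ≤ (m + 1).factorial := by
            intro m
            induction m with
            | zero => simp
            | succ m ihm =>
              rw [pow_succ, Nat.factorial_succ, mul_comm]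
              exact Nat.mul_le_mul (by omega) ihm
          exact_mod_cast this x.1
        calc _ ≤ ((x.1 + 1).factorial : ℚ)⁻¹ * 1 :=
              mul_le_mul_of_nonneg_left (ih _ h1) (by positivity)
          _ ≤ _ := by simpa using h3
      · simp
      · simp
    refine (mul_le_mul_of_nonneg_left ((Finset.abs_sum_le_sum_abs _ _).trans
      (Finset.sum_le_sum hb)) (abs_nonneg _)).trans ?_
    rw [Finset.Nat.sum_antidiagonal_eq_sum_range_succ_mk, Finset.sum_range_succ']
    simp only [Nat.add_eq_zero_iff, one_ne_zero, and_false, if_false]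
    have hg : ∀ m : ℕ, ∑ i ∈ Finset.range m, (1 / 2 : ℚ) ^ (i + 1) = 1 - (1 / 2) ^ m := by
      intro m
      induction m with
      | zero => simp
      | succ m ihm => rw [Finset.sum_range_succ, ihm]; ring
    rw [hg]
    simp

theorem todd_mul : (PowerSeries.mk fun n => ((n + 1).factorial : ℚ)⁻¹) * todd = 1 := by
  refine PowerSeries.mul_inv_cancel _ ?_
  simp

theorem summable_todd {x : ℂ} (hx : ‖x‖ < 1) :
    Summable fun n : ℕ => ‖((PowerSeries.coeff n todd : ℚ) : ℂ) * x ^ n‖ := by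
  refine Summable.of_nonneg_of_le (fun _ => norm_nonneg _) (fun n => ?_)
    (summable_geometric_of_lt_one (norm_nonneg x) hx)
  rw [norm_mul, norm_pow, Complex.norm_ratCast]
  have : (|((PowerSeries.coeff n todd : ℚ) : ℝ)|) ≤ 1 := by exact_mod_cast abs_coeff_todd_le n
  exact mul_le_of_le_one_left (by positivity) this

/-- The function `x / (exp x - 1)` near `0`. -/
def toddFun (x : ℂ) : ℂ := ∑' n : ℕ, ((PowerSeries.coeff n todd : ℚ) : ℂ) * x ^ n

theorem expSubOneDiv_mul_toddFun {x : ℂ} (hx : ‖x‖ < 1) : expSubOneDiv x * toddFun x = 1 := by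
  rw [expSubOneDiv, toddFun, tsum_mul_tsum_eq_tsum_sum_antidiagonal_of_summable_norm
    (summable_expSubOneDiv x).norm (summable_todd hx), tsum_eq_single 0]
  · have := congrArg (PowerSeries.coeff 0) todd_mul
    rw [PowerSeries.coeff_mul] at this
    simp only [Finset.Nat.antidiagonal_zero, Finset.sum_singleton, PowerSeries.coeff_mk] at this ⊢
    have h := congrArg (fun q : ℚ => (q : ℂ)) this
    simpa using h
  · intro n hn
    have := congrArg (PowerSeries.coeff n) todd_mul
    rw [PowerSeries.coeff_mul, PowerSeries.coeff_one, if_neg hn] at this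
    have h2 : ∑ kl ∈ Finset.HasAntidiagonal.antidiagonal n, ((((kl.1 + 1).factorial : ℚ)⁻¹ : ℚ) : ℂ) * x ^ kl.1 *
        (((PowerSeries.coeff kl.2 todd : ℚ) : ℂ) * x ^ kl.2)
        = (∑ kl ∈ Finset.HasAntidiagonal.antidiagonal n, ((((kl.1 + 1).factorial : ℚ)⁻¹ : ℚ) : ℂ) *
          ((PowerSeries.coeff kl.2 todd : ℚ) : ℂ)) * x ^ n := by
      rw [Finset.sum_mul]
      refine Finset.sum_congr rfl fun kl hkl => ?_
      rw [← Finset.HasAntidiagonal.mem_antidiagonal.1 hkl, pow_add]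
      ring
    rw [h2]
    simp only [PowerSeries.coeff_mk] at this
    have h := congrArg (fun q : ℚ => (q : ℂ)) this
    push_cast at h ⊢
    rw [h, zero_mul]

theorem isRatHolomorphic_exp (L : σ →₀ ℚ) :
    IsRatHolomorphic fun z : σ → ℂ => Complex.exp (linEval L z) :=
  isRatHolomorphic_powerSeries_linEval (Eventually.of_forall hasSum_exp_rat) L

theorem isRatHolomorphic_expSubOneDiv (L : σ →₀ ℚ) :
    IsRatHolomorphic fun z : σ → ℂ => expSubOneDiv (linEval L z) :=
  isRatHolomorphic_powerSeries_linEval (Eventually.of_forall hasSum_expSubOneDiv) L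

theorem isRatHolomorphic_toddFun (L : σ →₀ ℚ) :
    IsRatHolomorphic fun z : σ → ℂ => toddFun (linEval L z) := by
  refine isRatHolomorphic_powerSeries_linEval (a := fun n => PowerSeries.coeff n todd) ?_ L
  filter_upwards [Metric.ball_mem_nhds (0 : ℂ) one_pos] with x hx
  exact (Summable.of_norm (summable_todd (by simpa using hx))).hasSum

/-- The germ of `exp ⟨u, z⟩`. -/
def expGerm (u : σ →₀ ℚ) : HolGerm σ := (isRatHolomorphic_exp u).germ

/-- The germ of `(exp ⟨u, z⟩ - 1) / ⟨u, z⟩`. -/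
def expDivGerm (u : σ →₀ ℚ) : HolGerm σ := (isRatHolomorphic_expSubOneDiv u).germ

/-- The germ of `⟨u, z⟩ / (exp ⟨u, z⟩ - 1)`. -/
def toddGerm (u : σ →₀ ℚ) : HolGerm σ := (isRatHolomorphic_toddFun u).germ

theorem one_sub_expGerm (u : σ →₀ ℚ) : 1 - expGerm u = -(linGerm u * expDivGerm u) := by
  rw [← sub_eq_zero, ← germ_zero]
  refine Subtype.ext ?_
  refine Germ.coe_eq.2 (Eventually.of_forall fun z => ?_)
  have := mul_expSubOneDiv (linEval u z)
  change 1 - Complex.exp (linEval u z) - -(linEval u z * expSubOneDiv (linEval u z)) = 0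
  rw [this]
  ring

theorem expDivGerm_mul_toddGerm (u : σ →₀ ℚ) : expDivGerm u * toddGerm u = 1 := by
  rw [expDivGerm, toddGerm, IsRatHolomorphic.germ_mul, ← germ_one, IsRatHolomorphic.germ_eq_iff]
  have ht : Tendsto (linEval u) (𝓝 0) (𝓝 0) :=
    (continuous_linEval u).tendsto' _ _ (linEval_zero_right u)
  filter_upwards [ht.eventually (Metric.ball_mem_nhds (0 : ℂ) one_pos)] with z hz
  exact expSubOneDiv_mul_toddFun (by simpa using hz)

/-- `1 - exp u` as a meromorphic germ. -/
def oneSubExp (u : σ →₀ ℚ) : Mero σ := toMero (1 - expGerm u)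

theorem oneSubExp_mul_toddGerm (u : σ →₀ ℚ) :
    oneSubExp u * toMero (-toddGerm u) = toMero (linGerm u) := by
  rw [oneSubExp, ← toMero_mul, one_sub_expGerm]
  congr 1
  linear_combination linGerm u * expDivGerm_mul_toddGerm u

/-- The form `u` is a unit among meromorphic germs, and `1 - exp u` divides it. -/
theorem isUnit_oneSubExp {u : σ →₀ ℚ} (hu : u ≠ 0) : IsUnit (oneSubExp u) := by
  have h : IsUnit (linProd [u]) := isUnit_linProd (by simpa using hu)
  rw [linProd_cons, linProd_nil, mul_one, ← oneSubExp_mul_toddGerm] at h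
  exact isUnit_of_mul_isUnit_left h

end

section

variable {σ τ : Type*}

/-! ### Substitution of linear forms in germs -/

/-- The map `z ↦ (L i z)ᵢ`. -/
def linMap (L : σ → (τ →₀ ℚ)) (z : τ → ℂ) : σ → ℂ := fun i => linEval (L i) z

theorem continuous_linMap (L : σ → (τ →₀ ℚ)) : Continuous (linMap L) :=
  continuous_pi fun i => continuous_linEval (L i)

theorem tendsto_linMap (L : σ → (τ →₀ ℚ)) : Tendsto (linMap L) (𝓝 0) (𝓝 0) :=
  (continuous_linMap L).tendsto' _ _ (by funext i; simp [linMap, linEval])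

/-- Substitution of linear forms, as a homomorphism of rings of germs. -/
def substGerm (L : σ → (τ →₀ ℚ)) : HolGerm σ →+* HolGerm τ where
  toFun G := ⟨Germ.compTendsto G.1 (linMap L) (tendsto_linMap L), by
    obtain ⟨_, F, hF, rfl⟩ := G
    exact ⟨_, hF.comp_linear L, rfl⟩⟩
  map_one' := rfl
  map_zero' := rfl
  map_mul' G H := by
    obtain ⟨_, F, hF, rfl⟩ := G
    obtain ⟨_, F', hF', rfl⟩ := H
    rfl
  map_add' G H := by
    obtain ⟨_, F, hF, rfl⟩ := G
    obtain ⟨_, F', hF', rfl⟩ := H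
    rfl

theorem substGerm_germ (L : σ → (τ →₀ ℚ)) {F : (σ → ℂ) → ℂ} (hF : IsRatHolomorphic F) :
    substGerm L hF.germ = (hF.comp_linear L).germ := rfl

abbrev QVec : Type := ℕ →₀ ℚ

/-- The substitution of linear forms dual to an endomorphism of `ℚ^∞`. -/
def coordImages (φ : QVec →ₗ[ℚ] QVec) (i : ℕ) : QVec := φ (Finsupp.single i 1)

theorem linEval_linMap (φ : QVec →ₗ[ℚ] QVec) (L : QVec) (z : ℕ → ℂ) :
    linEval L (linMap (coordImages φ) z) = linEval (φ L) z := by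
  induction L using Finsupp.induction_linear with
  | zero => simp [linEval]
  | add L M hL hM => rw [linEval_add, hL, hM, map_add, linEval_add]
  | single i a =>
    have : (Finsupp.single i a : QVec) = a • Finsupp.single i 1 := by simp
    rw [this, linEval_smul, linEval_single, map_smul, linEval_smul]
    simp [linMap, coordImages]

/-- The endomorphism of the ring of germs that extends an endomorphism of the space of linear
forms. -/
def pull (φ : QVec →ₗ[ℚ] QVec) : HolGerm ℕ →+* HolGerm ℕ := substGerm (coordImages φ)

theorem pull_linGerm (φ : QVec →ₗ[ℚ] QVec) (L : QVec) : pull φ (linGerm L) = linGerm (φ L) := by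
  rw [pull, linGerm, substGerm_germ, linGerm, IsRatHolomorphic.germ_eq_iff]
  exact Eventually.of_forall fun z => linEval_linMap φ L z

/-- The holomorphic germs that are functions of the linear forms in `W`. -/
def holIn (W : Submodule ℚ QVec) : Subring (HolGerm ℕ) :=
  ⨅ φ : {φ : QVec →ₗ[ℚ] QVec // ∀ w ∈ W, φ w = w},
    RingHom.eqLocus (pull φ.1) (RingHom.id (HolGerm ℕ))

/-- Depending only on `W` is expressed as invariance under every endomorphism that fixes `W`
pointwise. This is closed under ring operations for free, and a projection onto `W` is among these
endomorphisms, so an invariant germ can be rewritten in forms of `W`. -/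
theorem mem_holIn {W : Submodule ℚ QVec} {H : HolGerm ℕ} :
    H ∈ holIn W ↔ ∀ φ : QVec →ₗ[ℚ] QVec, (∀ w ∈ W, φ w = w) → pull φ H = H := by
  simp [holIn, Subring.mem_iInf, RingHom.mem_eqLocus]

theorem holIn_mono {W W' : Submodule ℚ QVec} (h : W ≤ W') : holIn W ≤ holIn W' := fun _ hH =>
  mem_holIn.2 fun φ hφ => mem_holIn.1 hH φ fun w hw => hφ w (h hw)

theorem germ_comp_linEval_mem_holIn {W : Submodule ℚ QVec} {u : QVec} (hu : u ∈ W) {f : ℂ → ℂ}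
    (hF : IsRatHolomorphic fun z : ℕ → ℂ => f (linEval u z)) : hF.germ ∈ holIn W := by
  refine mem_holIn.2 fun φ hφ => ?_
  rw [pull, substGerm_germ, IsRatHolomorphic.germ_eq_iff]
  refine Eventually.of_forall fun z => ?_
  change f (linEval u (linMap (coordImages φ) z)) = f (linEval u z)
  rw [linEval_linMap, hφ u hu]

/-- The meromorphic germ `f` is a function of the linear forms in `W`. -/
def DependsOn (W : Submodule ℚ QVec) (f : Mero ℕ) : Prop :=
  ∃ (s : List QVec) (H : HolGerm ℕ), (∀ L ∈ s, L ∈ W ∧ L ≠ 0) ∧ H ∈ holIn W ∧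
    f * linProd s = toMero H

theorem dependsOn_toMero {W : Submodule ℚ QVec} {H : HolGerm ℕ} (hH : H ∈ holIn W) :
    DependsOn W (toMero H) := ⟨[], H, by simp, hH, by simp⟩

theorem DependsOn.mono {W W' : Submodule ℚ QVec} (h : W ≤ W') {f : Mero ℕ} (hf : DependsOn W f) :
    DependsOn W' f := by
  obtain ⟨s, H, hs, hH, e⟩ := hf
  exact ⟨s, H, fun L hL => ⟨h (hs L hL).1, (hs L hL).2⟩, holIn_mono h hH, e⟩

theorem DependsOn.mul {W : Submodule ℚ QVec} {f f' : Mero ℕ} (hf : DependsOn W f)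
    (hf' : DependsOn W f') : DependsOn W (f * f') := by
  obtain ⟨s, H, hs, hH, e⟩ := hf
  obtain ⟨s', H', hs', hH', e'⟩ := hf'
  refine ⟨s ++ s', H * H', fun L hL => (List.mem_append.1 hL).elim (hs L) (hs' L),
    mul_mem hH hH', ?_⟩
  rw [linProd_append, toMero_mul, ← e, ← e']
  ring

theorem list_prod_linGerm_mem_holIn {W : Submodule ℚ QVec} {s : List QVec} (hs : ∀ L ∈ s, L ∈ W) :
    (s.map linGerm).prod ∈ holIn W := by
  refine list_prod_mem fun g hg => ?_
  obtain ⟨L, hL, rfl⟩ := List.mem_map.1 hg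
  exact germ_comp_linEval_mem_holIn (f := id) (hs L hL) (isRatHolomorphic_linEval L)

theorem DependsOn.add {W : Submodule ℚ QVec} {f f' : Mero ℕ} (hf : DependsOn W f)
    (hf' : DependsOn W f') : DependsOn W (f + f') := by
  obtain ⟨s, H, hs, hH, e⟩ := hf
  obtain ⟨s', H', hs', hH', e'⟩ := hf'
  refine ⟨s ++ s', H * (s'.map linGerm).prod + H' * (s.map linGerm).prod,
    fun L hL => (List.mem_append.1 hL).elim (hs L) (hs' L),
    add_mem (mul_mem hH (list_prod_linGerm_mem_holIn fun L hL => (hs' L hL).1))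
      (mul_mem hH' (list_prod_linGerm_mem_holIn fun L hL => (hs L hL).1)), ?_⟩
  rw [linProd_append, toMero_add, toMero_mul, toMero_mul, ← e, ← e']
  simp only [linProd]
  ring

theorem dependsOn_zero (W : Submodule ℚ QVec) : DependsOn W 0 := by
  simpa using dependsOn_toMero (zero_mem (holIn W))

theorem DependsOn.sum {W : Submodule ℚ QVec} {ι : Type*} (s : Finset ι) {f : ι → Mero ℕ}
    (h : ∀ i ∈ s, DependsOn W (f i)) : DependsOn W (∑ i ∈ s, f i) := by
  classical
  induction s using Finset.induction_on with
  | empty => simpa using dependsOn_zero W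
  | insert a s ha ih =>
    rw [Finset.sum_insert ha]
    exact (h a (Finset.mem_insert_self a s)).add (ih fun i hi => h i (Finset.mem_insert_of_mem hi))

/-- Dividing by `1 - exp u` is dividing by the form `u` after multiplying the numerator by `-todd
u`, and both lie in the variables `W`. -/
theorem DependsOn.of_mul_oneSubExp {W : Submodule ℚ QVec} {f : Mero ℕ} {u : QVec} (hu : u ∈ W)
    (hu0 : u ≠ 0) (h : DependsOn W (f * oneSubExp u)) : DependsOn W f := by
  obtain ⟨s, H, hs, hH, e⟩ := h
  refine ⟨u :: s, H * (-toddGerm u), ?_,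
    mul_mem hH (neg_mem (germ_comp_linEval_mem_holIn hu (isRatHolomorphic_toddFun u))), ?_⟩
  · intro L hL
    rcases List.mem_cons.1 hL with rfl | hL
    · exact ⟨hu, hu0⟩
    · exact hs L hL
  · rw [linProd_cons, toMero_mul, ← e, ← oneSubExp_mul_toddGerm]
    ring

theorem eq_of_mul_linProd {f f' : Mero σ} {s : List (σ →₀ ℚ)} (hs : ∀ L ∈ s, L ≠ 0)
    (h : f * linProd s = f' * linProd s) : f = f' :=
  (isUnit_linProd hs).mul_left_injective h

/-! ### Intersecting the spaces of variables -/

/-- Two spaces of linear forms: an endomorphism that is the identity on the second, maps the first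
to the intersection, and keeps a finite set of forms away from `0`. -/
theorem exists_retraction (W W' : Submodule ℚ QVec) : ∃ π : QVec →ₗ[ℚ] QVec,
    (∀ x, π x ∈ W') ∧ (∀ x ∈ W', π x = x) ∧ ∀ x ∈ W, π x ∈ W ⊓ W' := by
  -- The part `K₀ ⊓ W` complements `W ⊓ W'` inside `W` and is disjoint from `W'`. Enlarging it to a
  -- complement `K` of `W'`, the projection onto `W'` along `K` kills `K₀ ⊓ W` and so maps `W` into
  -- the intersection.
  obtain ⟨K₀, hK₀⟩ := (W ⊓ W').exists_isCompl
  have hdisj : Disjoint (K₀ ⊓ W) W' := by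
    rw [disjoint_iff, inf_assoc, inf_comm]
    exact hK₀.disjoint.eq_bot
  obtain ⟨K, hK, hc⟩ := hdisj.exists_isCompl
  refine ⟨W'.projection K hc.symm, Submodule.projection_apply_mem hc.symm,
    fun x hx => Submodule.projection_apply_of_mem_left hc.symm hx, fun x hx => ?_⟩
  have h1 : x ∈ (W ⊓ W') ⊔ K₀ ⊓ W := by
    rw [← sup_inf_assoc_of_le K₀ inf_le_left, hK₀.sup_eq_top, top_inf_eq]
    exact hx
  obtain ⟨y, hy, b, hb, rfl⟩ := Submodule.mem_sup.1 h1
  rw [map_add, Submodule.projection_apply_of_mem_left hc.symm hy.2,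
    Submodule.projection_apply_of_mem_right hc.symm (hK hb), add_zero]
  exact hy

/-- A retraction may kill some of the denominators `L`. Adding `N • ψ (x - π x) • w` with `0 ≠ w ∈ W
⊓ W'` keeps both mapping properties, and for each `L` at most one `N` is bad. -/
theorem exists_generic_retraction {W W' : Submodule ℚ QVec} (h0 : W ⊓ W' ≠ ⊥) {s : List QVec}
    (hs : ∀ L ∈ s, L ≠ 0) : ∃ φ : QVec →ₗ[ℚ] QVec,
      (∀ x ∈ W', φ x = x) ∧ (∀ x ∈ W, φ x ∈ W ⊓ W') ∧ ∀ L ∈ s, φ L ≠ 0 := by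
  classical
  obtain ⟨w, hw, hw0⟩ := Submodule.exists_mem_ne_zero_of_ne_bot h0
  obtain ⟨π, hπ1, hπ2, hπ3⟩ := exists_retraction W W'
  have : Finite {L : QVec // L ∈ s.toFinset ∧ L - π L ≠ 0} :=
    s.toFinset.finite_toSet.subset fun L h => h.1
  -- One functional that is nonzero on all the nonzero differences `L - π L`; a form with `L = π L`
  -- is not moved by the perturbation.
  obtain ⟨ψ, hψ⟩ := Module.exists_dual_forall_apply_ne_zero (K := ℚ)
    (fun L : {L : QVec // L ∈ s.toFinset ∧ L - π L ≠ 0} => L.1 - π L.1) (fun L => L.2.2)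
    (ι := {L : QVec // L ∈ s.toFinset ∧ L - π L ≠ 0})
  have hfin : (⋃ L ∈ s.toFinset, {N : ℚ | π L + (N * ψ (L - π L)) • w = 0}).Finite := by
    refine Set.Finite.biUnion s.toFinset.finite_toSet fun L hL => ?_
    refine Set.Subsingleton.finite fun a ha b hb => ?_
    have ha : π L + (a * ψ (L - π L)) • w = 0 := ha
    have hb : π L + (b * ψ (L - π L)) • w = 0 := hb
    by_cases hL0 : L - π L = 0
    · rw [hL0, map_zero, mul_zero, zero_smul, add_zero] at ha
      rw [ha, sub_zero] at hL0
      exact absurd hL0 (hs L (by simpa using hL))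
    · have h1 : ψ (L - π L) ≠ 0 := hψ ⟨L, by simpa using hL, hL0⟩
      have h2 : (a * ψ (L - π L)) • w = (b * ψ (L - π L)) • w := by
        rw [← sub_eq_zero] at *
        have := sub_eq_zero.2 (ha.trans hb.symm)
        simpa using this
      have h3 := smul_left_injective ℚ hw0 h2
      exact mul_right_cancel₀ h1 h3
  obtain ⟨N, hN⟩ := hfin.exists_notMem
  refine ⟨π + (N • ψ.comp (LinearMap.id - π)).smulRight w, ?_, ?_, ?_⟩
  · intro x hx
    simp [hπ2 x hx]
  · intro x hx
    exact add_mem (hπ3 x hx) (Submodule.smul_mem _ _ hw)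
  · intro L hL h
    refine hN (Set.mem_biUnion (x := L) (by simpa using hL) ?_)
    simpa using h

/-- Apply `φ` to `H * ∏ s' = H' * ∏ s`. It fixes `H'` and `∏ s'`, so `φ H * ∏ s' = H' * ∏ φ(s)`, and
`f` is `φ H / ∏ φ(s)`, written in forms of the intersection. -/
theorem DependsOn.inf_of_ne_bot {W W' : Submodule ℚ QVec} (h0 : W ⊓ W' ≠ ⊥) {f : Mero ℕ}
    (hf : DependsOn W f) (hf' : DependsOn W' f) : DependsOn (W ⊓ W') f := by
  obtain ⟨s, H, hs, hH, e⟩ := hf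
  obtain ⟨s', H', hs', hH', e'⟩ := hf'
  have key : H * (s'.map linGerm).prod = H' * (s.map linGerm).prod := by
    apply toMero_injective
    rw [toMero_mul, toMero_mul, ← e, ← e', linProd, linProd]
    ring
  obtain ⟨φ, hφ1, hφ2, hφ3⟩ := exists_generic_retraction h0 fun L hL => (hs L hL).2
  have key2 := congrArg (pull φ) key
  have hprod : pull φ (s.map linGerm).prod = ((s.map φ).map linGerm).prod := by
    rw [map_list_prod, List.map_map, List.map_map]
    congr 2
    funext L
    exact pull_linGerm φ L
  rw [map_mul, map_mul, mem_holIn.1 hH' φ hφ1,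
    mem_holIn.1 (list_prod_linGerm_mem_holIn fun L hL => (hs' L hL).1) φ hφ1, hprod] at key2
  refine ⟨s.map φ, pull φ H, ?_, ?_, ?_⟩
  · intro L hL
    obtain ⟨M, hM, rfl⟩ := List.mem_map.1 hL
    exact ⟨hφ2 M (hs M hM).1, hφ3 M hM⟩
  · refine mem_holIn.2 fun ψ hψ => ?_
    -- Rewriting `H` through a projection `ρ` onto `W` makes `pull φ H` a function of the forms `φ
    -- (ρ eᵢ)`. These lie in the intersection and are therefore fixed by `ψ`.
    obtain ⟨ρ, hρ1, hρ2, -⟩ := exists_retraction W W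
    have h1 : pull ρ H = H := mem_holIn.1 hH ρ hρ2
    obtain ⟨F, hF, rfl⟩ := exists_germ_eq H
    rw [← h1]
    simp only [pull, substGerm_germ]
    rw [IsRatHolomorphic.germ_eq_iff]
    refine Eventually.of_forall fun z => congrArg F ?_
    funext i
    change linEval _ (linMap (coordImages φ) (linMap (coordImages ψ) z))
      = linEval _ (linMap (coordImages φ) z)
    rw [linEval_linMap, linEval_linMap, linEval_linMap, coordImages, hψ _ (hφ2 _ (hρ1 _))]
  · refine eq_of_mul_linProd (fun L hL => (hs' L hL).2) ?_
    have h2 : toMero (pull φ H) * linProd s' = f * linProd (s.map φ) * linProd s' := by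
      rw [linProd, ← toMero_mul, key2, toMero_mul, ← e', linProd, linProd]
      ring
    exact h2.symm

/-- Comparing Taylor coefficients shows that `k` is a quotient of two rational ones. -/
theorem rational_of_eventually_eq_mul {F G : (σ → ℂ) → ℂ} (hF : IsRatHolomorphic F)
    (hG : IsRatHolomorphic G) (hG0 : hG.germ ≠ 0) {k : ℂ} (h : ∀ᶠ z in 𝓝 0, F z = k * G z) :
    ∃ q : ℚ, ∀ᶠ z in 𝓝 0, F z = q * G z := by
  classical
  have h' := h
  obtain ⟨t, p, hp, hFp⟩ := hF
  obtain ⟨u, r, hr, hGr⟩ := id hG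
  have hc : (fun m => ((MvPowerSeries.coeff m p : ℚ) : ℂ) - k * ((MvPowerSeries.coeff m r : ℚ) : ℂ))
      = 0 := by
    refine coeff_eq_zero_of_hasSum_zero (t := t ∪ u) (fun m hm => ?_) isFat_univ ?_
    · by_cases h1 : MvPowerSeries.coeff m p = 0
      · have : MvPowerSeries.coeff m r ≠ 0 := by
          intro h'
          exact hm (by simp [h1, h'])
        exact (hr m this).trans Finset.subset_union_right
      · exact (hp m h1).trans Finset.subset_union_left
    · filter_upwards [tendsto_ofReal_pi.eventually h, tendsto_ofReal_pi.eventually hFp,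
        tendsto_ofReal_pi.eventually hGr] with z h1 h2 h3 _
      have h4 := h2.sub (h3.mul_left k)
      rw [h1, sub_self] at h4
      simpa [sub_mul, mul_assoc] using h4
  have hex : ∃ m, MvPowerSeries.coeff m r ≠ 0 := by
    by_contra hcon
    push Not at hcon
    refine hG0 ?_
    rw [← germ_zero, IsRatHolomorphic.germ_eq_iff]
    filter_upwards [hGr] with z hz
    simp only [hcon, Rat.cast_zero, zero_mul] at hz
    exact hz.unique hasSum_zero
  obtain ⟨m, hm⟩ := hex
  refine ⟨MvPowerSeries.coeff m p / MvPowerSeries.coeff m r, ?_⟩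
  have h1 : ((MvPowerSeries.coeff m p : ℚ) : ℂ) - k * ((MvPowerSeries.coeff m r : ℚ) : ℂ) = 0 :=
    congrFun hc m
  have h2 : ((MvPowerSeries.coeff m r : ℚ) : ℂ) ≠ 0 := by exact_mod_cast hm
  have h3 : k = ((MvPowerSeries.coeff m p / MvPowerSeries.coeff m r : ℚ) : ℂ) := by
    push_cast
    field_simp
    linear_combination -h1
  rw [← h3]
  exact h'

/-- The two sides of `f` use independent variables, so `F(x) G'(x') = F'(x') G(x)` for all small `x`
and `x'`. Fixing `x'` with `G'(x') ≠ 0` makes `F` a multiple of `G`; hence `f` is a constant, and a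
rational one. -/
theorem DependsOn.inf_of_eq_bot {W W' : Submodule ℚ QVec} (h0 : W ⊓ W' = ⊥) {f : Mero ℕ}
    (hf : DependsOn W f) (hf' : DependsOn W' f) : DependsOn (W ⊓ W') f := by
  obtain ⟨s, H, hs, hH, e⟩ := hf
  obtain ⟨s', H', hs', hH', e'⟩ := hf'
  have key : H * (s'.map linGerm).prod = H' * (s.map linGerm).prod := by
    apply toMero_injective
    rw [toMero_mul, toMero_mul, ← e, ← e', linProd, linProd]
    ring
  obtain ⟨π, hπ1, hπ2, hπ3⟩ := exists_retraction W W'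
  have hπW : ∀ x ∈ W, π x = 0 := fun x hx => by simpa [h0] using hπ3 x hx
  have hρ : ∀ x ∈ W, (LinearMap.id - π : QVec →ₗ[ℚ] QVec) x = x := fun x hx => by simp [hπW x hx]
  have hS := mem_holIn.1 (list_prod_linGerm_mem_holIn fun L hL => (hs L hL).1) _ hρ
  have hS' := mem_holIn.1 (list_prod_linGerm_mem_holIn fun L hL => (hs' L hL).1) _ hπ2
  have hH1 := mem_holIn.1 hH _ hρ
  have hH1' := mem_holIn.1 hH' _ hπ2
  have hS0 : (s.map linGerm).prod ≠ 0 := nonZeroDivisors.ne_zero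
    (linProducts_le_nonZeroDivisors (list_prod_mem_linProducts fun L hL => (hs L hL).2))
  have hS0' : (s'.map linGerm).prod ≠ 0 := nonZeroDivisors.ne_zero
    (linProducts_le_nonZeroDivisors (list_prod_mem_linProducts fun L hL => (hs' L hL).2))
  have eS : linProd s = toMero (s.map linGerm).prod := rfl
  rw [eS] at e
  generalize (s.map linGerm).prod = S at *
  generalize (s'.map linGerm).prod = S' at *
  obtain ⟨F, hF, rfl⟩ := exists_germ_eq H
  obtain ⟨F', hF', rfl⟩ := exists_germ_eq H'
  obtain ⟨G, hG, rfl⟩ := exists_germ_eq S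
  obtain ⟨G', hG', rfl⟩ := exists_germ_eq S'
  rw [pull, substGerm_germ, IsRatHolomorphic.germ_eq_iff] at hS hS' hH1 hH1'
  rw [IsRatHolomorphic.germ_mul, IsRatHolomorphic.germ_mul, IsRatHolomorphic.germ_eq_iff] at key
  let ρ : QVec →ₗ[ℚ] QVec := LinearMap.id - π
  -- The point `y` glues two arbitrary points: forms in `W` see only the first, since `ρ` fixes `W`,
  -- and forms in `W'` only the second, since `π` fixes `W'`.
  let y : (ℕ → ℂ) × (ℕ → ℂ) → (ℕ → ℂ) := fun x =>
    linMap (coordImages ρ) x.1 + linMap (coordImages π) x.2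
  have hyt : Tendsto y (𝓝 0 ×ˢ 𝓝 0) (𝓝 0) := by
    rw [← nhds_prod_eq]
    have : Continuous y := ((continuous_linMap _).comp continuous_fst).add
      ((continuous_linMap _).comp continuous_snd)
    exact this.tendsto' _ _ (by funext i; simp [y, linMap, linEval])
  have hππ : ∀ i, π (π (Finsupp.single i 1)) = π (Finsupp.single i 1) := fun i =>
    hπ2 _ (hπ1 _)
  have hy1 : ∀ x, linMap (coordImages ρ) (y x) = linMap (coordImages ρ) x.1 := by
    intro x
    funext i
    change linEval _ (linMap (coordImages ρ) x.1 + linMap (coordImages π) x.2) = linEval _ x.1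
    rw [linEval_add_right, linEval_linMap, linEval_linMap]
    simp [coordImages, ρ, hππ, linEval]
  have hy2 : ∀ x, linMap (coordImages π) (y x) = linMap (coordImages π) x.2 := by
    intro x
    funext i
    change linEval _ (linMap (coordImages ρ) x.1 + linMap (coordImages π) x.2) = linEval _ x.2
    rw [linEval_add_right, linEval_linMap, linEval_linMap]
    simp [coordImages, ρ, hππ, linEval]
  have hev : ∀ᶠ x : (ℕ → ℂ) × (ℕ → ℂ) in 𝓝 0 ×ˢ 𝓝 0, F x.1 * G' x.2 = F' x.2 * G x.1 := by
    filter_upwards [hyt.eventually key, hyt.eventually hS, hyt.eventually hS',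
      hyt.eventually hH1, hyt.eventually hH1', tendsto_fst.eventually hS,
      tendsto_snd.eventually hS', tendsto_fst.eventually hH1, tendsto_snd.eventually hH1']
      with x h1 h2 h3 h4 h5 h6 h7 h8 h9
    have h1 : F (y x) * G' (y x) = F' (y x) * G (y x) := h1
    have h2 : G (linMap (coordImages ρ) (y x)) = G (y x) := h2
    have h3 : G' (linMap (coordImages π) (y x)) = G' (y x) := h3
    have h4 : F (linMap (coordImages ρ) (y x)) = F (y x) := h4
    have h5 : F' (linMap (coordImages π) (y x)) = F' (y x) := h5
    have h6 : G (linMap (coordImages ρ) x.1) = G x.1 := h6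
    have h7 : G' (linMap (coordImages π) x.2) = G' x.2 := h7
    have h8 : F (linMap (coordImages ρ) x.1) = F x.1 := h8
    have h9 : F' (linMap (coordImages π) x.2) = F' x.2 := h9
    rwa [← h2, ← h3, ← h4, ← h5, hy1, hy2, h6, h7, h8, h9] at h1
  have hfreq : ∃ᶠ z' in 𝓝 (0 : ℕ → ℂ), G' z' ≠ 0 := by
    intro hcon
    refine hS0' ?_
    rw [← germ_zero, IsRatHolomorphic.germ_eq_iff]
    filter_upwards [hcon] with z hz
    simpa using hz
  have hev2 : ∀ᶠ z' in 𝓝 (0 : ℕ → ℂ), ∀ᶠ z in 𝓝 (0 : ℕ → ℂ), F z * G' z' = F' z' * G z :=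
    (eventually_swap_iff.1 hev).curry
  obtain ⟨z', hz', hz'ev⟩ := (hfreq.and_eventually hev2).exists
  obtain ⟨q, hq⟩ := rational_of_eventually_eq_mul hF hG hS0 (k := F' z' / G' z') (by
    filter_upwards [hz'ev] with z hz
    field_simp
    exact hz)
  have hfq : f = toMero (isRatHolomorphic_const q).germ := by
    refine eq_of_mul_linProd (fun L hL => (hs L hL).2) (s := s) ?_
    rw [eS, e, ← toMero_mul, IsRatHolomorphic.germ_mul]
    exact congrArg toMero (IsRatHolomorphic.germ_eq_iff.2 hq)
  rw [hfq]
  refine dependsOn_toMero (mem_holIn.2 fun φ _ => ?_)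
  rw [pull, substGerm_germ, IsRatHolomorphic.germ_eq_iff]

/-- The cases are separate because the generic perturbation needs a nonzero vector in the
intersection. -/
theorem DependsOn.inf {W W' : Submodule ℚ QVec} {f : Mero ℕ}
    (hf : DependsOn W f) (hf' : DependsOn W' f) : DependsOn (W ⊓ W') f := by
  by_cases h0 : W ⊓ W' = ⊥
  · exact hf.inf_of_eq_bot h0 hf'
  · exact hf.inf_of_ne_bot h0 hf'

end

section

variable {σ τ : Type*}

/-! ### Compositions with linear forms -/

theorem IsComposition.dependsOn {m : ℕ} {g : Mero (Fin m)} {L : Fin m → QVec} {f : Mero ℕ}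
    (h : IsComposition g L f) : DependsOn (Submodule.span ℚ (Set.range L)) f := by
  obtain ⟨h, H, hh, hH, s, hHh, hs, -, e⟩ := h
  have hL : ∀ i, L i ∈ Submodule.span ℚ (Set.range L) := fun i =>
    Submodule.subset_span ⟨i, rfl⟩
  refine ⟨s.map (linComp L), hH.germ, ?_, ?_, e⟩
  · intro M hM
    obtain ⟨c, hc, rfl⟩ := List.mem_map.1 hM
    exact ⟨Submodule.sum_mem _ fun i _ => Submodule.smul_mem _ _ (hL i), hs c hc⟩
  · refine mem_holIn.2 fun φ hφ => ?_
    rw [pull, substGerm_germ, IsRatHolomorphic.germ_eq_iff]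
    filter_upwards [hHh, (tendsto_linMap (coordImages φ)).eventually hHh] with z h1 h2
    refine (h2.trans ?_).trans h1.symm
    congr 1
    funext i
    rw [linEval_linMap, hφ _ (hL i)]

/-- The other coordinates may be set to `0`, so a germ on `ℕ → ℂ` can be written as a composition
with finitely many forms. -/
theorem IsRatHolomorphic.exists_finset_indicator {F : (σ → ℂ) → ℂ} (hF : IsRatHolomorphic F) :
    ∃ t : Finset σ, ∀ᶠ z in 𝓝 (0 : σ → ℂ), F z = F ((t : Set σ).indicator z) := by
  classical
  obtain ⟨t, p, hp, hFp⟩ := hF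
  refine ⟨t, ?_⟩
  have ht : Tendsto (fun z : σ → ℂ => (t : Set σ).indicator z) (𝓝 0) (𝓝 0) := by
    have : Continuous fun z : σ → ℂ => (t : Set σ).indicator z := by
      refine continuous_pi fun i => ?_
      by_cases hi : i ∈ t
      · simpa [Set.indicator, hi] using continuous_apply i
      · simpa [Set.indicator, hi] using continuous_const
    exact this.tendsto' _ _ (by simp)
  filter_upwards [hFp, ht.eventually hFp] with z h1 h2
  refine h1.unique ?_
  convert h2 using 2 with m
  by_cases hm : MvPowerSeries.coeff m p = 0
  · simp [hm]
  · congr 1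
    refine Finset.prod_congr rfl fun i hi => ?_
    have : i ∈ t := hp m hm hi
    simp [this]

/-- The new variables are of two kinds: one for each coordinate that the numerator really uses,
replaced by its projection `ρ eᵢ` to `W`, and one for each linear factor of the denominator. -/
theorem DependsOn.exists_isComposition {W : Submodule ℚ QVec} {f : Mero ℕ} (hf : DependsOn W f) :
    ∃ (m : ℕ) (L : Fin m → QVec) (g : Mero (Fin m)), (∀ i, L i ∈ W) ∧ IsComposition g L f := by
  classical
  obtain ⟨s, H, hs, hH, e⟩ := hf
  obtain ⟨ρ, hρ1, hρ2, -⟩ := exists_retraction W W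
  have hρH := mem_holIn.1 hH ρ hρ2
  obtain ⟨F, hF, rfl⟩ := exists_germ_eq H
  obtain ⟨t, ht⟩ := hF.exists_finset_indicator
  let κ := {i // i ∈ t} ⊕ Fin s.length
  let ε : κ ≃ Fin (Fintype.card κ) := Fintype.equivFin κ
  let L : Fin (Fintype.card κ) → QVec := fun j =>
    Sum.elim (fun i : {i // i ∈ t} => coordImages ρ i) s.get (ε.symm j)
  -- Coordinates outside `t` are sent to `0`, which does not change `F` near `0`.
  let M : ℕ → (Fin (Fintype.card κ) →₀ ℚ) := fun i =>
    if hi : i ∈ t then Finsupp.single (ε (Sum.inl ⟨i, hi⟩)) 1 else 0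
  let s' : List (Fin (Fintype.card κ) →₀ ℚ) :=
    List.ofFn fun k : Fin s.length => Finsupp.single (ε (Sum.inr k)) 1
  have hs' : ∀ c ∈ s', c ≠ 0 := by
    intro c hc
    obtain ⟨k, rfl⟩ := List.mem_ofFn.1 hc
    simp
  have hmap : s'.map (linComp L) = s := by
    have : (linComp L ∘ fun k : Fin s.length => Finsupp.single (ε (Sum.inr k)) (1 : ℚ)) = s.get := by
      funext k
      simp [linComp, L]
    rw [List.map_ofFn, this, List.ofFn_get]
  have hh := hF.comp_linear M
  refine ⟨Fintype.card κ, L, toMero hh.germ * ((isUnit_linProd hs').unit⁻¹ : (Mero _)ˣ), ?_,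
    _, _, hh, hF, s', ?_, ?_, ?_, ?_⟩
  · intro j
    simp only [L]
    rcases ε.symm j with i | k
    · exact hρ1 _
    · exact (hs _ (s.get_mem k)).1
  · rw [pull, substGerm_germ, IsRatHolomorphic.germ_eq_iff] at hρH
    filter_upwards [hρH, (tendsto_linMap (coordImages ρ)).eventually ht] with z h1 h2
    refine (h1.symm.trans h2).trans (congrArg F ?_)
    funext i
    by_cases hi : i ∈ t
    · simp [M, hi, linEval_single, L, linMap]
    · simp [M, hi, linEval]
  · intro c hc h0
    have : (0 : QVec) ∈ s := by
      rw [← hmap]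
      exact List.mem_map.2 ⟨c, hc, h0⟩
    exact (hs _ this).2 rfl
  · rw [mul_assoc, IsUnit.val_inv_mul, mul_one]
  · rw [hmap, e]

/-! ### Orthogonality of germs and the two locality semigroups -/

/-- Orthogonality of spaces of rational linear forms. -/
def FormOrth (Q : RatInnerProduct) (W W' : Submodule ℚ QVec) : Prop :=
  ∀ w ∈ W, ∀ w' ∈ W', Q.form (ratVec w) (ratVec w') = 0

@[simp] theorem ratVec_zero : ratVec 0 = 0 := by simp [ratVec]

@[simp] theorem ratVec_apply (u : QVec) (i : ℕ) : ratVec u i = (u i : ℝ) := rfl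

theorem ratVec_add (u v : QVec) : ratVec (u + v) = ratVec u + ratVec v := by
  ext i
  simp

theorem ratVec_smul (a : ℚ) (u : QVec) : ratVec (a • u) = (a : ℝ) • ratVec u := by
  ext i
  simp

theorem formOrth_span (Q : RatInnerProduct) {S T : Set QVec}
    (h : ∀ w ∈ S, ∀ w' ∈ T, Q.form (ratVec w) (ratVec w') = 0) :
    FormOrth Q (Submodule.span ℚ S) (Submodule.span ℚ T) := by
  intro w hw w' hw'
  induction hw using Submodule.span_induction with
  | zero => simp
  | add x y _ _ hx hy => rw [ratVec_add, map_add, LinearMap.add_apply, hx, hy, add_zero]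
  | smul a x _ hx => rw [ratVec_smul, map_smul, LinearMap.smul_apply, hx, smul_zero]
  | mem x hx =>
    induction hw' using Submodule.span_induction with
    | zero => simp
    | add y z _ _ hy hz => rw [ratVec_add, map_add, hy, hz, add_zero]
    | smul a y _ hy => rw [ratVec_smul, map_smul, hy, smul_zero]
    | mem y hy => exact h x hx y hy

theorem FormOrth.symm {Q : RatInnerProduct} {W W' : Submodule ℚ QVec} (h : FormOrth Q W W') :
    FormOrth Q W' W := fun w hw w' hw' => by rw [Q.symm]; exact h w' hw' w hw

theorem FormOrth.inf_sup {Q : RatInnerProduct} {W₁ W₁' W₂ W₂' : Submodule ℚ QVec}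
    (h : FormOrth Q W₁ W₁') (h' : FormOrth Q W₂ W₂') : FormOrth Q (W₁ ⊓ W₂) (W₁' ⊔ W₂') := by
  intro w hw w' hw'
  obtain ⟨a, ha, b, hb, rfl⟩ := Submodule.mem_sup.1 hw'
  rw [ratVec_add, map_add, h w hw.1 a ha, h' w hw.2 b hb, add_zero]

/-- Families of forms are exchanged for subspaces, which can be intersected and added. -/
theorem meroOrth_iff {Q : RatInnerProduct} {f f' : Mero ℕ} : MeroOrth Q f f' ↔
    ∃ W W' : Submodule ℚ QVec, FormOrth Q W W' ∧ DependsOn W f ∧ DependsOn W' f' := by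
  constructor
  · rintro ⟨m, n, L, L', g, g', hL, h, h'⟩
    refine ⟨_, _, formOrth_span Q ?_, h.dependsOn, h'.dependsOn⟩
    rintro _ ⟨i, rfl⟩ _ ⟨j, rfl⟩
    exact hL i j
  · rintro ⟨W, W', hW, h, h'⟩
    obtain ⟨m, L, g, hL, hg⟩ := h.exists_isComposition
    obtain ⟨n, L', g', hL', hg'⟩ := h'.exists_isComposition
    exact ⟨m, n, L, L', g, g', fun i j => hW _ (hL i) _ (hL' j), hg, hg'⟩

theorem isLocalitySemigroup_mero (Q : RatInnerProduct) :
    IsLocalitySemigroup (MeroOrth Q) (fun f g : Mero ℕ => f * g) where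
  symm f f' h := by
    obtain ⟨W, W', hW, h, h'⟩ := meroOrth_iff.1 h
    exact meroOrth_iff.2 ⟨W', W, hW.symm, h', h⟩
  compat U f f' hf hf' _ u hu := by
    obtain ⟨W₁, W₁', hW₁, h₁, h₁'⟩ := meroOrth_iff.1 (hf u hu)
    obtain ⟨W₂, W₂', hW₂, h₂, h₂'⟩ := meroOrth_iff.1 (hf' u hu)
    -- The germ `u` depends on `W₁` and on `W₂`, hence on their intersection, which is orthogonal to
    -- both `W₁'` and `W₂'`.
    exact meroOrth_iff.2 ⟨W₁ ⊓ W₂, W₁' ⊔ W₂', hW₁.inf_sup hW₂, h₁.inf h₂,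
      (h₁'.mono le_sup_left).mul (h₂'.mono le_sup_right)⟩
  assoc f g h _ _ _ := mul_assoc f g h

theorem LatticeCone.ext' {C D : LatticeCone} (h : C.cone = D.cone) (h' : C.lattice = D.lattice) :
    C = D := by
  cases C
  cases D
  simp_all

theorem isLocalitySemigroup_latticeCone (Q : RatInnerProduct) :
    IsLocalitySemigroup (LatticeCone.Orth Q) (fun C D : LatticeCone => C * D) where
  symm C D h u hu v hv := by rw [Q.symm]; exact h v hv u hu
  compat U C D hC hD _ E hE u hu v hv := by
    obtain ⟨a, ha, b, hb, rfl⟩ := AddSubgroup.mem_sup.1 hv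
    rw [map_add, hC E hE u hu a ha, hD E hE u hu b hb, add_zero]
  assoc C D E _ _ _ := LatticeCone.ext' (sup_assoc _ _ _) (sup_assoc _ _ _)

end

section

/-! ### Rational vectors -/

/-- The real extension of a rational linear functional. -/
def extFun (φ : Module.Dual ℚ QVec) : V →ₗ[ℝ] ℝ :=
  Finsupp.linearCombination ℝ fun i => ((φ (Finsupp.single i 1) : ℚ) : ℝ)

theorem ratVec_single (i : ℕ) (a : ℚ) : ratVec (Finsupp.single i a) = Finsupp.single i (a : ℝ) := by
  simp [ratVec]

theorem extFun_ratVec (φ : Module.Dual ℚ QVec) (u : QVec) : extFun φ (ratVec u) = (φ u : ℚ) := by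
  induction u using Finsupp.induction_linear with
  | zero => simp
  | add u v hu hv => rw [ratVec_add, map_add, hu, hv, map_add]; push_cast; rfl
  | single i a =>
    have : (Finsupp.single i a : QVec) = a • Finsupp.single i 1 := by simp
    rw [ratVec_single, this, map_smul]
    simp [extFun]

theorem ratVec_injective : Function.Injective ratVec := fun u v h => by
  ext i
  have := DFunLike.congr_fun h i
  simpa using this

/-- A rational functional separating `u` from the rational span extends to a real one, which would
separate `ratVec u` from the real span. -/
theorem mem_span_of_ratVec_mem_span {S : Set QVec} {u : QVec}
    (h : ratVec u ∈ Submodule.span ℝ (ratVec '' S)) : u ∈ Submodule.span ℚ S := by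
  by_contra hu
  obtain ⟨φ, hφ, hker⟩ := Submodule.exists_le_ker_of_notMem hu
  have h1 : Submodule.span ℝ (ratVec '' S) ≤ LinearMap.ker (extFun φ) := by
    rw [Submodule.span_le]
    rintro _ ⟨w, hw, rfl⟩
    have : φ w = 0 := hker (Submodule.subset_span hw)
    simp [extFun_ratVec, this]
  have h2 : extFun φ (ratVec u) = 0 := h1 h
  rw [extFun_ratVec] at h2
  exact hφ (by exact_mod_cast h2)

theorem exists_nsmul_mem_closure {S : Set QVec} {u : QVec} (h : u ∈ Submodule.span ℚ S) :
    ∃ N : ℕ, 0 < N ∧ N • u ∈ AddSubgroup.closure S := by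
  induction h using Submodule.span_induction with
  | zero => exact ⟨1, one_pos, by simp⟩
  | mem x hx => exact ⟨1, one_pos, by simpa using AddSubgroup.subset_closure hx⟩
  | add x y _ _ hx hy =>
    obtain ⟨N, hN, hx⟩ := hx
    obtain ⟨M, hM, hy⟩ := hy
    refine ⟨N * M, Nat.mul_pos hN hM, ?_⟩
    rw [nsmul_add, mul_comm N M, mul_nsmul', mul_comm M N, mul_nsmul']
    exact add_mem (nsmul_mem hx M) (nsmul_mem hy N)
  | smul a x _ hx =>
    obtain ⟨N, hN, hx⟩ := hx
    refine ⟨N * a.den, Nat.mul_pos hN a.pos, ?_⟩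
    have : (N * a.den) • (a • x) = a.num • (N • x) := by
      rw [← Nat.cast_smul_eq_nsmul ℚ, ← Int.cast_smul_eq_zsmul ℚ, ← Nat.cast_smul_eq_nsmul ℚ,
        smul_smul, smul_smul]
      congr 1
      push_cast
      rw [mul_assoc, mul_comm (a.den : ℚ), Rat.mul_den_eq_num]
      ring
    rw [this]
    exact zsmul_mem hx _

/-- `ratVec` as a homomorphism of additive groups. -/
def ratVecHom : QVec →+ V where
  toFun := ratVec
  map_zero' := ratVec_zero
  map_add' := ratVec_add

theorem closure_ratVec (S : Set QVec) :
    AddSubgroup.closure (ratVec '' S) = (AddSubgroup.closure S).map ratVecHom :=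
  (AddMonoidHom.map_closure ratVecHom S).symm

namespace LatticeCone

theorem exists_ratVec_eq (C : LatticeCone) {x : V} (hx : x ∈ C.lattice) : ∃ u, ratVec u = x := by
  obtain ⟨s, hs⟩ := C.lattice_gen
  rw [hs, closure_ratVec] at hx
  obtain ⟨u, -, hu⟩ := hx
  exact ⟨u, hu⟩

theorem exists_nsmul_mem_lattice (C : LatticeCone) {u : QVec} (hu : ratVec u ∈ C.linSpan) :
    ∃ N : ℕ, 0 < N ∧ ratVec (N • u) ∈ C.lattice := by
  obtain ⟨s, hs⟩ := C.lattice_gen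
  have h1 : ratVec u ∈ Submodule.span ℝ (ratVec '' (s : Set QVec)) := by
    rw [linSpan, ← C.span_eq, hs] at hu
    refine Submodule.span_le.2 ?_ hu
    have : AddSubgroup.closure (ratVec '' (s : Set QVec)) ≤
        (Submodule.span ℝ (ratVec '' (s : Set QVec))).toAddSubgroup :=
      (AddSubgroup.closure_le _).2 Submodule.subset_span
    exact this
  obtain ⟨N, hN, h⟩ := exists_nsmul_mem_closure (mem_span_of_ratVec_mem_span h1)
  refine ⟨N, hN, ?_⟩
  rw [hs, closure_ratVec]
  exact ⟨_, h, rfl⟩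

end LatticeCone

theorem exists_dual_family {K E ι : Type*} [Field K] [AddCommGroup E] [Module K E]
    [DecidableEq ι] {v : ι → E} (hv : LinearIndependent K v) :
    ∃ φ : ι → (E →ₗ[K] K), ∀ i j, φ i (v j) = if i = j then 1 else 0 := by
  have h := fun i => LinearMap.exists_extend ((Finsupp.lapply i : (ι →₀ K) →ₗ[K] K) ∘ₗ hv.repr)
  choose φ hφ using h
  refine ⟨φ, fun i j => ?_⟩
  have h1 := LinearMap.congr_fun (hφ i) ⟨v j, Submodule.subset_span ⟨j, rfl⟩⟩
  have h2 : φ i (v j) = (hv.repr ⟨v j, Submodule.subset_span ⟨j, rfl⟩⟩) i := h1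
  rw [h2, hv.repr_eq_single j _ rfl, Finsupp.single_apply]
  simp [eq_comm]

/-- A dual family over `ℚ` extends to a dual family over `ℝ`. -/
theorem linearIndependent_ratVec {ι : Type*} {v : ι → QVec} (hv : LinearIndependent ℚ v) :
    LinearIndependent ℝ fun i => ratVec (v i) := by
  classical
  obtain ⟨φ, hφ⟩ := exists_dual_family hv
  rw [linearIndependent_iff']
  intro s g hg i hi
  have h := congrArg (extFun (φ i)) hg
  rw [map_sum, map_zero, Finset.sum_eq_single i] at h
  · simpa [extFun_ratVec, hφ] using h
  · intro j _ hj
    simp [extFun_ratVec, hφ, hj.symm]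
  · exact fun h => absurd hi h

/-! ### Cones generated by finite families -/

variable {ι κ : Type*} [Fintype ι] [Fintype κ]

/-- The nonnegative combinations of a finite family. -/
def closedCone (v : ι → V) : Set V := {x | ∃ t : ι → ℝ, (∀ i, 0 ≤ t i) ∧ ∑ i, t i • v i = x}

/-- The combinations of a finite family with positive coefficients. -/
def openCone (v : ι → V) : Set V := {x | ∃ t : ι → ℝ, (∀ i, 0 < t i) ∧ ∑ i, t i • v i = x}

theorem mem_hull_range_iff {v : ι → V} {x : V} :
    x ∈ PointedCone.hull ℝ (Set.range v) ↔ x ∈ closedCone v := by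
  rw [PointedCone.hull, Submodule.mem_span_range_iff_exists_fun]
  constructor
  · rintro ⟨c, hc⟩
    exact ⟨fun i => c i, fun i => (c i).2, hc⟩
  · rintro ⟨t, ht, h⟩
    exact ⟨fun i => ⟨t i, ht i⟩, h⟩

/-- Clearing denominators puts the generators into the lattice, so that translation by them
preserves the measures used later. -/
theorem LatticeCone.exists_generators (C : LatticeCone) : ∃ (k : ℕ) (v : Fin k → QVec),
    (∀ i, ratVec (v i) ∈ C.lattice) ∧ (C.cone : Set V) = closedCone fun i => ratVec (v i) := by
  obtain ⟨s, hs⟩ := C.cone_gen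
  have hmem : ∀ u ∈ s, ratVec u ∈ C.cone := by
    intro u hu
    rw [hs]
    exact Submodule.subset_span ⟨u, hu, rfl⟩
  have hN : ∀ i : Fin s.card, ∃ N : ℕ, 0 < N ∧ ratVec (N • (s.equivFin.symm i : QVec)) ∈ C.lattice :=
    fun i => C.exists_nsmul_mem_lattice
      (Submodule.subset_span (hmem _ (s.equivFin.symm i).2))
  choose N hN0 hN using hN
  refine ⟨s.card, fun i => N i • (s.equivFin.symm i : QVec), hN, ?_⟩
  ext x
  rw [← mem_hull_range_iff, SetLike.mem_coe]
  suffices h : C.cone = PointedCone.hull ℝ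
      (Set.range fun i => ratVec (N i • (s.equivFin.symm i : QVec))) by rw [h]
  have hr : ∀ (n : ℕ) (u : QVec), ratVec (n • u) = (n : ℝ) • ratVec u := fun n u => by
    ext j
    simp
  apply le_antisymm
  · rw [hs, PointedCone.hull, Submodule.span_le]
    rintro _ ⟨u, hu, rfl⟩
    rw [SetLike.mem_coe]
    let i := s.equivFin ⟨u, hu⟩
    have h1 : ratVec (N i • (s.equivFin.symm i : QVec)) ∈ PointedCone.hull ℝ
      (Set.range fun i => ratVec (N i • (s.equivFin.symm i : QVec))) :=
      Submodule.subset_span ⟨i, rfl⟩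
    have h2 : ratVec u = (⟨(N i : ℝ)⁻¹, by positivity⟩ : {c : ℝ // 0 ≤ c}) •
        ratVec (N i • (s.equivFin.symm i : QVec)) := by
      rw [hr]
      change ratVec u = (N i : ℝ)⁻¹ • ((N i : ℝ) • ratVec (s.equivFin.symm i : QVec))
      rw [smul_smul, inv_mul_cancel₀ (by exact_mod_cast (hN0 i).ne'), one_smul]
      simp [i]
    rw [h2]
    exact Submodule.smul_mem _ _ h1
  · rw [PointedCone.hull, Submodule.span_le]
    rintro _ ⟨i, rfl⟩
    simp only [SetLike.mem_coe]
    rw [hr]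
    exact C.cone.smul_mem (Nat.cast_nonneg (N i))
      (hmem _ (s.equivFin.symm i).2)

/-! ### Lexicographically minimal representations -/

/-- `t` is the lexicographically smallest tuple of nonnegative coefficients with given value. -/
def IsLexMin {k : ℕ} (v : Fin k → V) (t : Fin k → ℝ) : Prop :=
  (∀ i, 0 ≤ t i) ∧ ∀ r : Fin k → ℝ, (∀ i, 0 ≤ r i) → ∑ i, r i • v i = ∑ i, t i • v i →
    toLex t ≤ toLex r

/-- The support of a tuple of coefficients. -/
def coeffSupport {k : ℕ} (t : Fin k → ℝ) : Finset (Fin k) := Finset.univ.filter fun i => t i ≠ 0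

theorem mem_coeffSupport {k : ℕ} {t : Fin k → ℝ} {i : Fin k} : i ∈ coeffSupport t ↔ t i ≠ 0 := by
  simp [coeffSupport]

theorem toLex_lt_iff {k : ℕ} {t r : Fin k → ℝ} :
    toLex t < toLex r ↔ ∃ i, (∀ j, j < i → t j = r j) ∧ t i < r i := Iff.rfl

theorem sum_coeffSupport {k : ℕ} (v : Fin k → V) (t : Fin k → ℝ) {I : Finset (Fin k)}
    (hI : coeffSupport t ⊆ I) : ∑ i : I, t i • v i = ∑ i, t i • v i := by
  rw [Finset.sum_coe_sort I fun i => t i • v i]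
  refine Finset.sum_subset (Finset.subset_univ _) fun i _ hi => ?_
  have : t i = 0 := by
    by_contra h
    exact hi (hI (mem_coeffSupport.2 h))
  rw [this, zero_smul]

/-- Carathéodory's reduction with lexicographic control. Subtract from `t` the largest admissible
multiple of a relation supported on `t` whose first nonzero entry is positive; one coefficient
disappears and the first one to change decreases. -/
theorem exists_smaller_coeffs {k : ℕ} {v : Fin k → V} {t : Fin k → ℝ} (ht : ∀ i, 0 ≤ t i)
    (hdep : ¬ LinearIndependent ℝ fun i : coeffSupport t => v i) :
    ∃ r : Fin k → ℝ, (∀ i, 0 ≤ r i) ∧ ∑ i, r i • v i = ∑ i, t i • v i ∧ toLex r < toLex t ∧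
      (coeffSupport r).card < (coeffSupport t).card := by
  rw [Fintype.linearIndependent_iff] at hdep
  push Not at hdep
  obtain ⟨g, hg, ⟨i₀, hi₀⟩, hgi₀⟩ := hdep
  obtain ⟨a, ha0, hasupp, hasum⟩ : ∃ a : Fin k → ℝ, a ≠ 0 ∧ (∀ i, t i = 0 → a i = 0) ∧
      ∑ i, a i • v i = 0 := by
    refine ⟨fun i => if h : i ∈ coeffSupport t then g ⟨i, h⟩ else 0, ?_, ?_, ?_⟩
    · intro h
      have := congrFun h i₀
      simp only [hi₀, dif_pos, Pi.zero_apply] at this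
      exact hgi₀ this
    · intro i hi
      have : i ∉ coeffSupport t := by simp [mem_coeffSupport, hi]
      simp [this]
    · rw [← hg, ← sum_coeffSupport v _ (I := coeffSupport t)]
      · refine Finset.sum_congr rfl fun i _ => ?_
        simp
      · intro i hi
        by_contra h
        exact mem_coeffSupport.1 hi (by simp [h])
  have hlead : ∃ i, (∀ j, j < i → a j = 0) ∧ a i ≠ 0 := by
    obtain ⟨i, hi, hmin⟩ := (Finset.univ.filter fun i => a i ≠ 0).exists_min_image id (by
      obtain ⟨i, hi⟩ := Function.ne_iff.1 ha0
      exact ⟨i, by simpa using hi⟩)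
    refine ⟨i, fun j hj => ?_, by simpa using hi⟩
    by_contra h
    exact absurd (hmin j (by simpa using h)) (not_le.2 hj)
  obtain ⟨i₁, hlt, hne⟩ := hlead
  -- A relation may be replaced by its negative.
  wlog hpos : 0 < a i₁ generalizing a
  · refine this (-a) (by simpa using ha0) (fun i hi => by simp [hasupp i hi])
      (by simpa using hasum) (fun j hj => by simp [hlt j hj]) (by simpa using hne) ?_
    have : a i₁ < 0 := lt_of_le_of_ne (not_lt.1 hpos) hne
    simpa using this
  obtain ⟨m, hm, hmin⟩ := (Finset.univ.filter fun i => 0 < a i).exists_min_image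
    (fun i => t i / a i) ⟨i₁, by simpa using hpos⟩
  have hm : 0 < a m := by simpa using hm
  have htm : 0 < t m := lt_of_le_of_ne (ht m) fun h => hm.ne' (hasupp m h.symm)
  -- The least ratio `t i / a i` over `a i > 0` keeps all coefficients nonnegative and makes the
  -- `m`-th one zero.
  set ε := t m / a m with hε
  have hε0 : 0 < ε := div_pos htm hm
  refine ⟨fun i => t i - ε * a i, fun i => ?_, ?_, ?_, ?_⟩
  · by_cases hi : 0 < a i
    · have := hmin i (by simpa using hi)
      rw [le_div_iff₀ hi] at this
      linarith
    · have := mul_nonneg hε0.le (neg_nonneg.2 (not_lt.1 hi))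
      have := ht i
      linarith
  · simp only [sub_smul, Finset.sum_sub_distrib, mul_smul, ← Finset.smul_sum, hasum, smul_zero,
      sub_zero]
  · refine toLex_lt_iff.2 ⟨i₁, fun j hj => by simp [hlt j hj], ?_⟩
    have := mul_pos hε0 hpos
    linarith
  · refine Finset.card_lt_card (Finset.ssubset_iff_subset_ne.2 ⟨?_, ?_⟩)
    · intro i hi
      rw [mem_coeffSupport] at hi ⊢
      intro h
      exact hi (by simp [h, hasupp i h])
    · intro h
      have h1 : m ∈ coeffSupport fun i => t i - ε * a i := h ▸ mem_coeffSupport.2 htm.ne'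
      refine mem_coeffSupport.1 h1 ?_
      rw [hε, div_mul_cancel₀ _ hm.ne', sub_self]

theorem exists_independent_coeffs {k : ℕ} {v : Fin k → V} (t : Fin k → ℝ) (ht : ∀ i, 0 ≤ t i) :
    ∃ r : Fin k → ℝ, (∀ i, 0 ≤ r i) ∧ ∑ i, r i • v i = ∑ i, t i • v i ∧ toLex r ≤ toLex t ∧
      LinearIndependent ℝ fun i : coeffSupport r => v i := by
  induction hn : (coeffSupport t).card using Nat.strong_induction_on generalizing t with
  | _ n ih =>
    by_cases hdep : LinearIndependent ℝ fun i : coeffSupport t => v i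
    · exact ⟨t, ht, rfl, le_rfl, hdep⟩
    · obtain ⟨r, hr, hsum, hlt, hcard⟩ := exists_smaller_coeffs ht hdep
      obtain ⟨r', hr', hsum', hle, hind⟩ := ih _ (hn ▸ hcard) r hr rfl
      exact ⟨r', hr', hsum'.trans hsum, hle.trans hlt.le, hind⟩

/-- By Carathéodory reduction it suffices to minimise over tuples with independent support. There
are finitely many, since such a support determines its coefficients. -/
theorem exists_isLexMin {k : ℕ} (v : Fin k → V) (t : Fin k → ℝ) (ht : ∀ i, 0 ≤ t i) :
    ∃ r, IsLexMin v r ∧ ∑ i, r i • v i = ∑ i, t i • v i ∧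
      LinearIndependent ℝ fun i : coeffSupport r => v i := by
  let S : Set (Fin k → ℝ) := {r | (∀ i, 0 ≤ r i) ∧ ∑ i, r i • v i = ∑ i, t i • v i ∧
    LinearIndependent ℝ fun i : coeffSupport r => v i}
  have hfin : S.Finite := by
    refine Set.Finite.of_injOn (f := coeffSupport) (t := Set.univ) (fun _ _ => Set.mem_univ _) ?_
      (Set.finite_univ)
    rintro r ⟨-, hr, hri⟩ r' ⟨-, hr', -⟩ hrr'
    have h1 : ∑ i : coeffSupport r, (r i - r' i) • v i = 0 := by
      simp only [sub_smul, Finset.sum_sub_distrib]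
      rw [sum_coeffSupport v r subset_rfl, sum_coeffSupport v r' hrr'.symm.subset, hr, hr', sub_self]
    funext i
    by_cases hi : i ∈ coeffSupport r
    · have := Fintype.linearIndependent_iff.1 hri (fun i => r i - r' i) h1 ⟨i, hi⟩
      exact sub_eq_zero.1 this
    · have hi' : i ∉ coeffSupport r' := hrr' ▸ hi
      rw [mem_coeffSupport, not_not] at hi hi'
      rw [hi, hi']
  obtain ⟨r₀, hr₀, hs₀, -, hi₀⟩ := exists_independent_coeffs (v := v) t ht
  obtain ⟨r, hr, hmin⟩ := Set.exists_min_image S toLex hfin ⟨r₀, hr₀, hs₀, hi₀⟩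
  refine ⟨r, ⟨hr.1, fun q hq hsum => ?_⟩, hr.2.1, hr.2.2⟩
  obtain ⟨q', hq', hsum', hle, hind⟩ := exists_independent_coeffs (v := v) q hq
  exact (hmin q' ⟨hq', hsum'.trans (hsum.trans hr.2.1), hind⟩).trans hle

/-- If `r` represented the value of `t'` and were smaller, then `t - ε t' + ε r` would represent the
value of `t` and be smaller than `t`. Nonnegativity for small `ε` is where the inclusion of supports
enters. -/
theorem IsLexMin.of_coeffSupport_subset {k : ℕ} {v : Fin k → V} {t : Fin k → ℝ}
    (ht : IsLexMin v t) {t' : Fin k → ℝ} (ht' : ∀ i, 0 ≤ t' i)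
    (hsupp : coeffSupport t' ⊆ coeffSupport t) : IsLexMin v t' := by
  refine ⟨ht', fun r hr hsum => ?_⟩
  by_contra hlt
  obtain ⟨i₀, hj, hi₀⟩ := toLex_lt_iff.1 (not_le.1 hlt)
  have hε : ∃ ε : ℝ, 0 < ε ∧ ∀ i, ε * t' i ≤ t i := by
    have h : ∀ i, ∀ᶠ ε in 𝓝[>] (0 : ℝ), ε * t' i ≤ t i := by
      intro i
      by_cases hi : t i = 0
      · have : t' i = 0 := by
          by_contra h
          exact mem_coeffSupport.1 (hsupp (mem_coeffSupport.2 h)) hi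
        simp [this, hi]
      · have hpos : 0 < t i := lt_of_le_of_ne (ht.1 i) (Ne.symm hi)
        have hc : Tendsto (fun ε : ℝ => ε * t' i) (𝓝 0) (𝓝 0) :=
          (continuous_mul_const (t' i)).tendsto' _ _ (by simp)
        exact ((hc.eventually_lt_const hpos).filter_mono nhdsWithin_le_nhds).mono fun ε h => h.le
    obtain ⟨ε, h1, h2⟩ := ((eventually_all.2 h).and self_mem_nhdsWithin).exists
    exact ⟨ε, h2, h1⟩
  obtain ⟨ε, hε0, hε⟩ := hε
  have h1 := ht.2 (fun i => t i - ε * t' i + ε * r i) (fun i => by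
    have := hε i
    have := mul_nonneg hε0.le (hr i)
    linarith) (by
    simp only [add_smul, sub_smul, Finset.sum_add_distrib, Finset.sum_sub_distrib, mul_smul,
      ← Finset.smul_sum, hsum, sub_add_cancel])
  refine absurd h1 (not_le.2 (toLex_lt_iff.2 ⟨i₀, fun j hji => ?_, ?_⟩))
  · simp [hj j hji]
  · have := mul_lt_mul_of_pos_left hi₀ hε0
    linarith

theorem IsLexMin.eq {k : ℕ} {v : Fin k → V} {t r : Fin k → ℝ} (ht : IsLexMin v t)
    (hr : IsLexMin v r) (h : ∑ i, t i • v i = ∑ i, r i • v i) : t = r :=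
  toLex.injective (le_antisymm (ht.2 r hr.1 h.symm) (hr.2 t ht.1 h))

/-- A finitely generated cone is the disjoint union of the relative interiors of simplicial cones
spanned by generators. -/
theorem exists_triangulation {k : ℕ} (v : Fin k → V) : ∃ K : Finset (Finset (Fin k)),
    (∀ I ∈ K, LinearIndependent ℝ fun i : I => v i) ∧
    ∀ x ∈ closedCone v, ∃! I, I ∈ K ∧ x ∈ openCone fun i : I => v i := by
  classical
  -- The cells are the supports of lexicographically minimal tuples. Any positive tuple on such a
  -- support is again minimal, and minimal tuples are unique, so each point lies in exactly one open
  -- cell.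
  refine ⟨Finset.univ.filter fun I => ∃ t, IsLexMin v t ∧ coeffSupport t = I, ?_, ?_⟩
  · intro I hI
    obtain ⟨t, ht, rfl⟩ := (Finset.mem_filter.1 hI).2
    obtain ⟨r, hr, hsum, hind⟩ := exists_isLexMin v t ht.1
    rwa [hr.eq ht hsum] at hind
  · rintro x ⟨t, ht, rfl⟩
    obtain ⟨r, hr, hsum, hind⟩ := exists_isLexMin v t ht
    refine ⟨coeffSupport r, ⟨Finset.mem_filter.2 ⟨Finset.mem_univ _, r, hr, rfl⟩, fun i => r i,
      fun i => lt_of_le_of_ne (hr.1 i) (Ne.symm (mem_coeffSupport.1 i.2)), ?_⟩, ?_⟩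
    · rw [sum_coeffSupport v r subset_rfl, hsum]
    · rintro J ⟨hJ, q, hq, hqsum⟩
      obtain ⟨p, hp, rfl⟩ := (Finset.mem_filter.1 hJ).2
      let q' : Fin k → ℝ := fun i => if h : i ∈ coeffSupport p then q ⟨i, h⟩ else 0
      have hq' : coeffSupport q' = coeffSupport p := by
        ext i
        rw [mem_coeffSupport]
        by_cases h : i ∈ coeffSupport p
        · simp [q', h, (hq ⟨i, h⟩).ne']
        · simp [q', h]
      have hq'0 : ∀ i, 0 ≤ q' i := by
        intro i
        by_cases h : i ∈ coeffSupport p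
        · simpa [q', h] using (hq ⟨i, h⟩).le
        · simp [q', h]
      have hsum' : ∑ i, q' i • v i = ∑ i, t i • v i := by
        rw [← hqsum, ← sum_coeffSupport v q' hq'.subset]
        refine Finset.sum_congr rfl fun i _ => ?_
        simp [q']
      have := (hp.of_coeffSupport_subset hq'0 hq'.subset).eq hr (hsum'.trans hsum.symm)
      rw [← hq', this]

end

section

variable {ι κ : Type*} [Fintype ι] [Fintype κ]

/-! ### Relative interiors -/

theorem exists_pos_mul_le {t : ι → ℝ} (ht : ∀ i, 0 < t i) (s : ι → ℝ) :
    ∃ ε : ℝ, 0 < ε ∧ ∀ i, ε * s i ≤ t i := by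
  have h : ∀ i, ∀ᶠ ε in 𝓝[>] (0 : ℝ), ε * s i ≤ t i := by
    intro i
    have hc : Tendsto (fun ε : ℝ => ε * s i) (𝓝 0) (𝓝 0) :=
      (continuous_mul_const (s i)).tendsto' _ _ (by simp)
    exact ((hc.eventually_lt_const (ht i)).filter_mono nhdsWithin_le_nhds).mono fun ε h => h.le
  obtain ⟨ε, h1, h2⟩ := ((eventually_all.2 h).and self_mem_nhdsWithin).exists
  exact ⟨ε, h2, h1⟩

theorem mem_closedCone (v : ι → V) (i : ι) : v i ∈ closedCone v := by
  classical
  exact ⟨Pi.single i 1, fun j => by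
    by_cases h : j = i
    · subst h; simp
    · simp [h], by simp [Pi.single_apply]⟩

theorem openCone_nonempty (v : ι → V) : (openCone v).Nonempty :=
  ⟨∑ i, (1 : ℝ) • v i, fun _ => 1, fun _ => one_pos, rfl⟩

theorem closedCone_subset_span (v : ι → V) :
    closedCone v ⊆ Submodule.span ℝ (Set.range v) := by
  rintro x ⟨t, -, rfl⟩
  exact Submodule.sum_mem _ fun i _ => Submodule.smul_mem _ _ (Submodule.subset_span ⟨i, rfl⟩)

theorem span_closedCone (v : ι → V) :
    Submodule.span ℝ (closedCone v) = Submodule.span ℝ (Set.range v) :=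
  le_antisymm (Submodule.span_le.2 (closedCone_subset_span v))
    (Submodule.span_mono (by rintro _ ⟨i, rfl⟩; exact mem_closedCone v i))

theorem closedCone_sumElim (v : ι → V) (w : κ → V) : closedCone (Sum.elim v w) =
    {x | ∃ a ∈ closedCone v, ∃ b ∈ closedCone w, a + b = x} := by
  ext x
  constructor
  · rintro ⟨t, ht, rfl⟩
    exact ⟨_, ⟨fun i => t (Sum.inl i), fun i => ht _, rfl⟩, _,
      ⟨fun i => t (Sum.inr i), fun i => ht _, rfl⟩, by simp [Fintype.sum_sum_type]⟩
  · rintro ⟨_, ⟨t, ht, rfl⟩, _, ⟨s, hs, rfl⟩, rfl⟩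
    refine ⟨Sum.elim t s, ?_, by simp [Fintype.sum_sum_type]⟩
    rintro (i | i)
    · exact ht i
    · exact hs i

theorem openCone_sumElim (v : ι → V) (w : κ → V) : openCone (Sum.elim v w) =
    {x | ∃ a ∈ openCone v, ∃ b ∈ openCone w, a + b = x} := by
  ext x
  constructor
  · rintro ⟨t, ht, rfl⟩
    exact ⟨_, ⟨fun i => t (Sum.inl i), fun i => ht _, rfl⟩, _,
      ⟨fun i => t (Sum.inr i), fun i => ht _, rfl⟩, by simp [Fintype.sum_sum_type]⟩
  · rintro ⟨_, ⟨t, ht, rfl⟩, _, ⟨s, hs, rfl⟩, rfl⟩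
    refine ⟨Sum.elim t s, ?_, by simp [Fintype.sum_sum_type]⟩
    rintro (i | i)
    · exact ht i
    · exact hs i

namespace LatticeCone

theorem mem_cone_iff {C : LatticeCone} {v : ι → V} (hv : (C.cone : Set V) = closedCone v) {x : V} :
    x ∈ C.cone ↔ x ∈ closedCone v := by
  rw [← hv, SetLike.mem_coe]

theorem linSpan_eq {C : LatticeCone} {v : ι → V} (hv : (C.cone : Set V) = closedCone v) :
    C.linSpan = Submodule.span ℝ (Set.range v) := by
  rw [linSpan, hv, span_closedCone]

/-- Moving against the sum of all generators shows that every coefficient can be made positive;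
conversely, positive coefficients leave room to move against any point. -/
theorem relInterior_eq_openCone {C : LatticeCone} {v : ι → V}
    (hv : (C.cone : Set V) = closedCone v) : C.relInterior = openCone v := by
  ext x
  constructor
  · rintro ⟨-, hx⟩
    obtain ⟨ε, hε, h⟩ := hx (∑ i, (1 : ℝ) • v i)
      ((mem_cone_iff hv).2 ⟨fun _ => 1, fun _ => zero_le_one, rfl⟩)
    obtain ⟨s, hs, h⟩ := (mem_cone_iff hv).1 h
    refine ⟨fun i => s i + ε, fun i => add_pos_of_nonneg_of_pos (hs i) hε, ?_⟩
    simp only [add_smul, Finset.sum_add_distrib, h, ← Finset.smul_sum, one_smul, sub_add_cancel]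
  · rintro ⟨t, ht, rfl⟩
    refine ⟨(mem_cone_iff hv).2 ⟨t, fun i => (ht i).le, rfl⟩, fun y hy => ?_⟩
    obtain ⟨s, hs, rfl⟩ := (mem_cone_iff hv).1 hy
    obtain ⟨ε, hε, h⟩ := exists_pos_mul_le ht s
    refine ⟨ε, hε, (mem_cone_iff hv).2 ⟨fun i => t i - ε * s i, fun i => sub_nonneg.2 (h i), ?_⟩⟩
    simp only [sub_smul, Finset.sum_sub_distrib, mul_smul, Finset.smul_sum]

theorem smul_mem_cone {C : LatticeCone} {x : V} (hx : x ∈ C.cone) {a : ℝ} (ha : 0 ≤ a) :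
    a • x ∈ C.cone := C.cone.smul_mem ha hx

/-- An open cone inside a cone lies in the relative interior if it meets it. -/
theorem openCone_subset_relInterior {C : LatticeCone} {v : ι → V} (hv : ∀ i, v i ∈ C.cone)
    {x : V} (hx : x ∈ openCone v) (hxC : x ∈ C.relInterior) : openCone v ⊆ C.relInterior := by
  have hcl : closedCone v ⊆ C.cone := by
    rintro _ ⟨t, ht, rfl⟩
    exact C.cone.sum_mem fun i _ => smul_mem_cone (hv i) (ht i)
  rintro y ⟨t, ht, rfl⟩
  obtain ⟨s, hs, rfl⟩ := hx
  obtain ⟨ε, hε, h⟩ := exists_pos_mul_le ht s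
  have h1 : ∑ i, t i • v i - ε • ∑ i, s i • v i ∈ C.cone := by
    refine hcl ⟨fun i => t i - ε * s i, fun i => sub_nonneg.2 (h i), ?_⟩
    simp only [sub_smul, Finset.sum_sub_distrib, mul_smul, Finset.smul_sum]
  refine ⟨hcl ⟨t, fun i => (ht i).le, rfl⟩, fun w hw => ?_⟩
  obtain ⟨δ, hδ, h2⟩ := hxC.2 w hw
  refine ⟨ε * δ, mul_pos hε hδ, ?_⟩
  have h3 := C.cone.add_mem h1 (smul_mem_cone h2 hε.le)
  convert h3 using 1
  rw [smul_sub, smul_smul]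
  abel

/-- An open cone of full dimension inside a cone lies in its relative interior. -/
theorem openCone_subset_relInterior_of_span {C : LatticeCone} {v : ι → V} (hv : ∀ i, v i ∈ C.cone)
    (hspan : Submodule.span ℝ (Set.range v) = C.linSpan) : openCone v ⊆ C.relInterior := by
  rintro _ ⟨t, ht, rfl⟩
  refine ⟨C.cone.sum_mem fun i _ => smul_mem_cone (hv i) (ht i).le, fun y hy => ?_⟩
  have hy' : y ∈ Submodule.span ℝ (Set.range v) := hspan ▸ Submodule.subset_span hy
  obtain ⟨s, rfl⟩ := (Submodule.mem_span_range_iff_exists_fun ℝ).1 hy'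
  obtain ⟨ε, hε, h⟩ := exists_pos_mul_le ht s
  refine ⟨ε, hε, ?_⟩
  have : ∑ i, t i • v i - ε • ∑ i, s i • v i = ∑ i, (t i - ε * s i) • v i := by
    simp only [sub_smul, Finset.sum_sub_distrib, mul_smul, Finset.smul_sum]
  rw [this]
  exact C.cone.sum_mem fun i _ => smul_mem_cone (hv i) (sub_nonneg.2 (h i))

/-! ### Triangulations -/

/-- The lattice vectors `v` and the sets of indices in `K`, with those in `K'` relevant for the
relative interior, triangulate `C`. -/
structure IsTriangulation (C : LatticeCone) {k : ℕ} (v : Fin k → QVec)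
    (K K' : Finset (Finset (Fin k))) : Prop where
  mem_lattice : ∀ i, ratVec (v i) ∈ C.lattice
  mem_cone : ∀ i, ratVec (v i) ∈ C.cone
  indep : ∀ I ∈ K, LinearIndependent ℝ fun i : I => ratVec (v i)
  cover : ∀ x ∈ C.cone, ∃ I ∈ K, x ∈ openCone fun i : I => ratVec (v i)
  unique : ∀ x, ∀ I ∈ K, ∀ J ∈ K, x ∈ openCone (fun i : I => ratVec (v i)) →
    x ∈ openCone (fun i : J => ratVec (v i)) → I = J
  subset : K' ⊆ K
  subset_relInterior : ∀ I ∈ K', openCone (fun i : I => ratVec (v i)) ⊆ C.relInterior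
  mem_of_mem : ∀ I ∈ K, ∀ x ∈ openCone (fun i : I => ratVec (v i)), x ∈ C.relInterior → I ∈ K'

theorem exists_isTriangulation (C : LatticeCone) : ∃ (k : ℕ) (v : Fin k → QVec)
    (K K' : Finset (Finset (Fin k))), C.IsTriangulation v K K' := by
  classical
  obtain ⟨k, v, hv, hC⟩ := C.exists_generators
  obtain ⟨K, hK, hK'⟩ := exists_triangulation fun i => ratVec (v i)
  have hmem : ∀ i, ratVec (v i) ∈ C.cone := fun i =>
    (mem_cone_iff hC).2 (mem_closedCone (fun i => ratVec (v i)) i)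
  have hsub : ∀ I : Finset (Fin k), openCone (fun i : I => ratVec (v i)) ⊆ C.cone := by
    rintro I _ ⟨t, ht, rfl⟩
    exact C.cone.sum_mem fun i _ => smul_mem_cone (hmem i) (ht i).le
  refine ⟨k, v, K, K.filter fun I => openCone (fun i : I => ratVec (v i)) ⊆ C.relInterior,
    hv, hmem, hK, ?_, ?_, Finset.filter_subset _ _, fun I hI => (Finset.mem_filter.1 hI).2, ?_⟩
  · intro x hx
    obtain ⟨I, hI, -⟩ := hK' x ((mem_cone_iff hC).1 hx)
    exact ⟨I, hI⟩
  · intro x I hI J hJ hxI hxJ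
    exact (hK' x ((mem_cone_iff hC).1 (hsub I hxI))).unique ⟨hI, hxI⟩ ⟨hJ, hxJ⟩
  · intro I hI x hx hxC
    exact Finset.mem_filter.2 ⟨hI, openCone_subset_relInterior (fun i => hmem i) hx hxC⟩

theorem IsTriangulation.relInterior_eq {C : LatticeCone} {k : ℕ} {v : Fin k → QVec}
    {K K' : Finset (Finset (Fin k))} (h : C.IsTriangulation v K K') :
    C.relInterior = ⋃ I ∈ K', openCone fun i : I => ratVec (v i) := by
  refine Set.Subset.antisymm (fun x hx => ?_) (Set.iUnion₂_subset h.subset_relInterior)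
  obtain ⟨I, hI, hxI⟩ := h.cover x hx.1
  exact Set.mem_biUnion (h.mem_of_mem I hI x hxI hx) hxI

theorem IsTriangulation.cone_eq {C : LatticeCone} {k : ℕ} {v : Fin k → QVec}
    {K K' : Finset (Finset (Fin k))} (h : C.IsTriangulation v K K') :
    (C.cone : Set V) = ⋃ I ∈ K, openCone fun i : I => ratVec (v i) := by
  refine Set.Subset.antisymm (fun x hx => ?_) (Set.iUnion₂_subset ?_)
  · obtain ⟨I, hI, hxI⟩ := h.cover x hx
    exact Set.mem_biUnion hI hxI
  · rintro I _ _ ⟨t, ht, rfl⟩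
    exact C.cone.sum_mem fun i _ => smul_mem_cone (h.mem_cone i) (ht i).le

/-- An open cell of full dimension would lie in the relative interior. The cells making up the
boundary therefore have smaller span, and Lebesgue measure ignores them. -/
theorem IsTriangulation.span_ne {C : LatticeCone} {k : ℕ} {v : Fin k → QVec}
    {K K' : Finset (Finset (Fin k))} (h : C.IsTriangulation v K K') {I : Finset (Fin k)}
    (hI : I ∈ K) (hI' : I ∉ K') :
    Submodule.span ℝ (Set.range fun i : I => ratVec (v i)) ≠ C.linSpan := by
  intro hspan
  obtain ⟨x, hx⟩ := openCone_nonempty fun i : I => ratVec (v i)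
  exact hI' (h.mem_of_mem I hI x hx
    (openCone_subset_relInterior_of_span (v := fun i : I => ratVec (v i)) (fun i => h.mem_cone i) hspan hx))

/-! ### Simplicial cones -/

/-- Subgroups of a finitely generated abelian group are finitely generated, `ℤ` being Noetherian. -/
theorem exists_finset_closure_eq (C : LatticeCone) {A : AddSubgroup V} (hA : A ≤ C.lattice) :
    ∃ s : Finset QVec, A = AddSubgroup.closure (ratVec '' (s : Set QVec)) := by
  classical
  obtain ⟨s, hs⟩ := C.lattice_gen
  have h1 : (AddSubgroup.toIntSubmodule C.lattice).FG := by
    refine ⟨s.image ratVec, ?_⟩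
    rw [Finset.coe_image, hs, ← AddSubgroup.toIntSubmodule_closure]
  have h2 : (AddSubgroup.toIntSubmodule A).FG := h1.of_le fun x hx => hA hx
  obtain ⟨T, hT⟩ := h2
  have hT' : AddSubgroup.closure (T : Set V) = A := by
    rw [← AddSubgroup.toIntSubmodule.injective.eq_iff, AddSubgroup.toIntSubmodule_closure, hT]
  have hch : ∀ x : T, ∃ u, ratVec u = x := fun x => C.exists_ratVec_eq
    (hA (hT' ▸ AddSubgroup.subset_closure x.2))
  choose f hf using hch
  refine ⟨Finset.univ.image f, ?_⟩
  rw [← hT']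
  congr 1
  ext x
  constructor
  · intro hx
    exact ⟨f ⟨x, hx⟩, by simp, hf ⟨x, hx⟩⟩
  · rintro ⟨_, hu, rfl⟩
    obtain ⟨y, -, rfl⟩ := Finset.mem_image.1 (Finset.mem_coe.1 hu)
    rw [hf]
    exact y.2

/-- The subcone generated by lattice vectors, with the induced lattice. -/
def subcone (C : LatticeCone) (v : ι → QVec) (hv : ∀ i, ratVec (v i) ∈ C.lattice) :
    LatticeCone where
  cone := PointedCone.hull ℝ (Set.range fun i => ratVec (v i))
  lattice := C.lattice ⊓ (Submodule.span ℝ (Set.range fun i => ratVec (v i))).toAddSubgroup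
  cone_gen := by
    classical
    refine ⟨Finset.univ.image v, ?_⟩
    congr 1
    ext x
    simp
  lattice_gen := C.exists_finset_closure_eq inf_le_left
  span_eq := by
    apply le_antisymm
    · rw [Submodule.span_le]
      intro x hx
      exact Submodule.span_mono Submodule.subset_span hx.2
    · rw [Submodule.span_le]
      intro x hx
      have h1 := closedCone_subset_span _ (mem_hull_range_iff.1 hx)
      refine Submodule.span_mono ?_ h1
      rintro _ ⟨i, rfl⟩
      exact ⟨hv i, Submodule.subset_span ⟨i, rfl⟩⟩

variable {C : LatticeCone} {v : ι → QVec} {hv : ∀ i, ratVec (v i) ∈ C.lattice}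

theorem subcone_cone : ((C.subcone v hv).cone : Set V) = closedCone fun i => ratVec (v i) := by
  ext x
  exact mem_hull_range_iff

theorem subcone_linSpan :
    (C.subcone v hv).linSpan = Submodule.span ℝ (Set.range fun i => ratVec (v i)) :=
  linSpan_eq subcone_cone

theorem subcone_relInterior : (C.subcone v hv).relInterior = openCone fun i => ratVec (v i) :=
  relInterior_eq_openCone subcone_cone

theorem subcone_stronglyConvex (hi : LinearIndependent ℝ fun i => ratVec (v i)) :
    (C.subcone v hv).StronglyConvex := by
  intro x hx hx0 hnx
  obtain ⟨t, ht, hxt⟩ := (mem_cone_iff (subcone_cone (C := C) (hv := hv))).1 hx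
  obtain ⟨s, hs, hxs⟩ := (mem_cone_iff (subcone_cone (C := C) (hv := hv))).1 hnx
  have h1 : ∑ i, (t i + s i) • ratVec (v i) = 0 := by
    simp only [add_smul, Finset.sum_add_distrib, hxt, hxs, add_neg_cancel]
  have h2 := Fintype.linearIndependent_iff.1 hi _ h1
  refine hx0 ?_
  rw [← hxt]
  refine Finset.sum_eq_zero fun i _ => ?_
  have h3 := h2 i
  have : t i = 0 := le_antisymm (by linarith [hs i]) (ht i)
  rw [this, zero_smul]

theorem IsTriangulation.isSubdivision {C : LatticeCone} {k : ℕ} {v : Fin k → QVec}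
    {K K' : Finset (Finset (Fin k))} (h : C.IsTriangulation v K K') :
    C.IsSubdivision fun j : Fin K'.card =>
      C.subcone (fun i : (K'.equivFin.symm j : Finset (Fin k)) => v i) fun i => h.mem_lattice i where
  stronglyConvex j := subcone_stronglyConvex (h.indep _ (h.subset (K'.equivFin.symm j).2))
  disjoint i j hij := by
    rw [Set.disjoint_left, subcone_relInterior, subcone_relInterior]
    intro x hx hy
    have h1 := h.unique x _ (h.subset (K'.equivFin.symm i).2) _ (h.subset (K'.equivFin.symm j).2)
      hx hy
    exact hij (K'.equivFin.symm.injective (Subtype.ext h1))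
  iUnion_eq := by
    rw [h.relInterior_eq]
    ext x
    simp only [Set.mem_iUnion, subcone_relInterior]
    constructor
    · rintro ⟨j, hj⟩
      exact ⟨_, (K'.equivFin.symm j).2, hj⟩
    · rintro ⟨I, hI, hx⟩
      refine ⟨K'.equivFin ⟨I, hI⟩, ?_⟩
      rwa [Equiv.symm_apply_apply]
  lattice_eq i := by
    rw [subcone_linSpan]
    rfl

end LatticeCone

/-! ### The open dual cone -/

theorem pairing_eq (x : V) (z : ℕ → ℝ) : pairing x z = Finsupp.linearCombination ℝ z x := by
  simp [pairing, Finsupp.linearCombination_apply]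

theorem pairing_add (x y : V) (z : ℕ → ℝ) : pairing (x + y) z = pairing x z + pairing y z := by
  simp [pairing_eq]

theorem pairing_sum (t : ι → ℝ) (v : ι → V) (z : ℕ → ℝ) :
    pairing (∑ i, t i • v i) z = ∑ i, t i * pairing (v i) z := by
  simp [pairing_eq]

theorem pairing_add_right (x : V) (z w : ℕ → ℝ) : pairing x (z + w) = pairing x z + pairing x w := by
  simp [pairing, Finsupp.sum, mul_add, Finset.sum_add_distrib]

theorem pairing_smul_right (x : V) (a : ℝ) (z : ℕ → ℝ) : pairing x (a • z) = a * pairing x z := by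
  simp only [pairing, Finsupp.sum, Finset.mul_sum, Pi.smul_apply, smul_eq_mul]
  exact Finset.sum_congr rfl fun i _ => by ring

/-- Gordan's alternative: the hypothesis says that `0` is not in the convex hull of `s`. Only
finitely many coordinates matter, so the hull is compact there and Hahn–Banach separates it strictly
from `0`. -/
theorem exists_pairing_neg {s : Finset V}
    (h : ∀ w : V → ℝ, (∀ x ∈ s, 0 ≤ w x) → ∑ x ∈ s, w x = 1 → ∑ x ∈ s, w x • x ≠ 0) :
    ∃ z : ℕ → ℝ, ∀ x ∈ s, pairing x z < 0 := by
  classical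
  obtain ⟨N, hN⟩ : ∃ N : ℕ, ∀ x ∈ s, ∀ i ∈ x.support, i < N := by
    refine ⟨(s.biUnion fun x => x.support).sup id + 1, fun x hx i hi => Nat.lt_succ_of_le ?_⟩
    exact Finset.le_sup (f := id) (Finset.mem_biUnion.2 ⟨x, hx, hi⟩)
  let T : V →ₗ[ℝ] (Fin N → ℝ) := LinearMap.pi fun i => Finsupp.lapply (i : ℕ)
  have hT : ∀ x i, T x i = x (i : ℕ) := fun _ _ => rfl
  have h0 : (0 : Fin N → ℝ) ∉ convexHull ℝ (T '' (s : Set V)) := by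
    intro h0
    rw [← LinearMap.image_convexHull] at h0
    obtain ⟨y, hy, hy0⟩ := h0
    obtain ⟨w, hw, hw1, rfl⟩ := Finset.mem_convexHull'.1 hy
    refine h w hw hw1 (Finsupp.ext fun i => ?_)
    by_cases hi : i < N
    · exact congrFun hy0 ⟨i, hi⟩
    · rw [Finsupp.finsetSum_apply, Finsupp.zero_apply]
      refine Finset.sum_eq_zero fun x hx => ?_
      have : x i = 0 := by
        by_contra hne
        exact hi (hN x hx i (Finsupp.mem_support_iff.2 hne))
      simp [this]
  have hfin : (T '' (s : Set V)).Finite := s.finite_toSet.image T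
  obtain ⟨f, u, hu, hf⟩ := geometric_hahn_banach_point_closed (convex_convexHull ℝ _)
    (hfin.isCompact_convexHull ℝ).isClosed h0
  rw [map_zero] at hu
  -- The separating functional is positive on the vectors, hence the sign.
  refine ⟨fun i => if hi : i < N then -f (Pi.single ⟨i, hi⟩ 1) else 0, fun x hx => ?_⟩
  have h1 : f (T x) = ∑ i : Fin N, x (i : ℕ) * f (Pi.single i 1) := by
    conv_lhs => rw [← Finset.univ_sum_single (T x)]
    rw [map_sum]
    refine Finset.sum_congr rfl fun i _ => ?_
    have : Pi.single i (T x i) = (x (i : ℕ)) • (Pi.single i 1 : Fin N → ℝ) := by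
      rw [← Pi.single_smul, smul_eq_mul, mul_one, hT]
    rw [this, map_smul, smul_eq_mul]
  have h2 : pairing x (fun i => if hi : i < N then -f (Pi.single ⟨i, hi⟩ 1) else 0)
      = -f (T x) := by
    rw [h1, pairing, Finsupp.sum_of_support_subset (s := Finset.range N) _ (fun i hi =>
      Finset.mem_range.2 (hN x hx i hi)) _ (by simp), Finset.sum_range, ← Finset.sum_neg_distrib]
    exact Finset.sum_congr rfl fun i _ => by simp
  rw [h2]
  have := hf (T x) (subset_convexHull ℝ _ ⟨x, hx, rfl⟩)
  linarith

/-- A nontrivial nonnegative relation among nonzero generators would put a line in the cone, so some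
form is negative on all of them. These are finitely many strict inequalities, which survive small
perturbations and positive scaling. -/
theorem LatticeCone.StronglyConvex.isFat_negDual {C : LatticeCone} (hC : C.StronglyConvex) :
    IsFat C.negDual := by
  classical
  obtain ⟨k, v, -, hv⟩ := C.exists_generators
  let s : Finset V := (Finset.univ.image fun i => ratVec (v i)).filter fun x => x ≠ 0
  have hs : ∀ x ∈ s, x ∈ C.cone ∧ x ≠ 0 := by
    intro x hx
    obtain ⟨h1, h2⟩ := Finset.mem_filter.1 hx
    obtain ⟨i, -, rfl⟩ := Finset.mem_image.1 h1
    exact ⟨(mem_cone_iff hv).2 (mem_closedCone (fun i => ratVec (v i)) i), h2⟩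
  obtain ⟨z₀, hz₀⟩ := exists_pairing_neg (s := s) (by
    intro w hw hw1 hsum
    obtain ⟨x, hx, hwx⟩ := Finset.exists_ne_zero_of_sum_ne_zero (hw1.trans_ne one_ne_zero)
    have h1 : w x • x ∈ C.cone := smul_mem_cone (hs x hx).1 (hw x hx)
    have h2 : -(w x • x) ∈ C.cone := by
      rw [← Finset.add_sum_erase _ _ hx] at hsum
      rw [neg_eq_of_add_eq_zero_right hsum]
      exact C.cone.sum_mem fun y hy => smul_mem_cone (hs y (Finset.mem_of_mem_erase hy)).1
        (hw y (Finset.mem_of_mem_erase hy))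
    exact hC _ h1 (smul_ne_zero hwx (hs x hx).2) h2)
  have hneg : ∀ z : ℕ → ℝ, (∀ x ∈ s, pairing x z < 0) → z ∈ C.negDual := by
    intro z hz x hx hx0
    obtain ⟨t, ht, rfl⟩ := (mem_cone_iff hv).1 hx
    rw [pairing_sum]
    obtain ⟨i, -, hi⟩ := Finset.exists_ne_zero_of_sum_ne_zero hx0
    have hmem : ratVec (v i) ∈ s :=
      Finset.mem_filter.2 ⟨Finset.mem_image.2 ⟨i, Finset.mem_univ _, rfl⟩, right_ne_zero_of_smul hi⟩
    refine Finset.sum_neg' (fun j _ => ?_) ⟨i, Finset.mem_univ _, ?_⟩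
    · by_cases hj : ratVec (v j) = 0
      · simp [hj, pairing]
      · exact mul_nonpos_of_nonneg_of_nonpos (ht j) (hz _ (Finset.mem_filter.2
          ⟨Finset.mem_image.2 ⟨j, Finset.mem_univ _, rfl⟩, hj⟩)).le
    · exact mul_neg_of_pos_of_neg (lt_of_le_of_ne (ht i) (left_ne_zero_of_smul hi).symm)
        (hz _ hmem)
  refine ⟨z₀, fun w => ?_⟩
  have hev : ∀ᶠ r in 𝓝 (0 : ℝ), ∀ x ∈ s, pairing x (z₀ + r • w) < 0 := by
    rw [Finset.eventually_all]
    intro x hx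
    have hc : Tendsto (fun r : ℝ => pairing x (z₀ + r • w)) (𝓝 0) (𝓝 (pairing x z₀)) := by
      simp only [pairing_add_right, pairing_smul_right]
      have : Continuous fun r : ℝ => pairing x z₀ + r * pairing x w := by fun_prop
      exact this.tendsto' _ _ (by simp)
    exact hc.eventually_lt_const (hz₀ x hx)
  filter_upwards [hev] with r hr ε hε
  refine hneg _ fun x hx => ?_
  rw [pairing_smul_right]
  exact mul_neg_of_pos_of_neg hε (hr x hx)

end

section

open MeasureTheory

variable {ι : Type*} [Fintype ι]

/-! ### Measurability on `ℝ^∞` -/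

/-- The `σ`-algebra on `ℝ^∞` generated by the coordinates. -/
instance measurableSpaceV : MeasurableSpace V :=
  MeasurableSpace.comap (fun (x : V) (i : ℕ) => x i) inferInstance

theorem measurable_coord (i : ℕ) : Measurable fun x : V => x i :=
  (measurable_pi_apply i).comp (comap_measurable _)

theorem measurable_of_coord {α : Type*} [MeasurableSpace α] {f : α → V}
    (h : ∀ i, Measurable fun a => f a i) : Measurable f :=
  measurable_comap_iff.2 (measurable_pi_lambda _ h)

theorem measurable_linearCombination (z : ℕ → ℝ) :
    Measurable fun x : V => Finsupp.linearCombination ℝ z x := by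
  refine measurable_of_tendsto_metrizable (f := fun n (x : V) => ∑ i ∈ Finset.range n, x i * z i)
    (fun n => Finset.measurable_sum _ fun i _ => (measurable_coord i).mul_const _) ?_
  rw [tendsto_pi_nhds]
  intro x
  refine tendsto_const_nhds.congr' ?_
  filter_upwards [eventually_ge_atTop (x.support.sup id + 1)] with n hn
  rw [Finsupp.linearCombination_apply, Finsupp.sum_of_support_subset (s := Finset.range n)]
  · simp
  · intro i hi
    exact Finset.mem_range.2 (lt_of_lt_of_le (Nat.lt_succ_of_le (Finset.le_sup (f := id) hi)) hn)
  · simp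

theorem measurable_linearMap (φ : V →ₗ[ℝ] ℝ) : Measurable φ := by
  have : (φ : V → ℝ) = fun x => Finsupp.linearCombination ℝ (fun i => φ (Finsupp.single i 1)) x := by
    funext x
    have h : φ = Finsupp.linearCombination ℝ (fun i => φ (Finsupp.single i 1)) := by
      refine Finsupp.lhom_ext fun i a => ?_
      have : (Finsupp.single i a : V) = a • Finsupp.single i 1 := by simp
      rw [Finsupp.linearCombination_single, this, map_smul]
    exact LinearMap.congr_fun h x
  rw [this]
  exact measurable_linearCombination _

theorem measurable_pairing (z : ℕ → ℝ) : Measurable fun x : V => pairing x z := by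
  simp only [pairing_eq]
  exact measurable_linearCombination z

theorem measurable_exp_pairing (z : ℕ → ℝ) : Measurable fun x : V => Real.exp (pairing x z) :=
  Real.measurable_exp.comp (measurable_pairing z)

theorem measurable_sum_smul (v : ι → V) : Measurable fun t : ι → ℝ => ∑ i, t i • v i := by
  refine measurable_of_coord fun n => ?_
  simp only [Finsupp.finsetSum_apply, Finsupp.smul_apply, smul_eq_mul]
  fun_prop

theorem measurable_addV : Measurable fun x : V × V => x.1 + x.2 :=
  measurable_of_coord fun n =>
    ((measurable_coord n).comp measurable_fst).add ((measurable_coord n).comp measurable_snd)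

theorem measurable_add_constV (u : V) : Measurable fun x : V => x + u :=
  measurable_of_coord fun n => (measurable_coord n).add_const _

/-- Translation by a vector. -/
def transEquiv (u : V) : V ≃ᵐ V where
  toFun x := x + u
  invFun x := x - u
  left_inv x := add_sub_cancel_right x u
  right_inv x := sub_add_cancel x u
  measurable_toFun := measurable_add_constV u
  measurable_invFun := by simpa [sub_eq_add_neg] using measurable_add_constV (-u)

theorem measurableSet_eqV {f g : V → V} (hf : Measurable f) (hg : Measurable g) :
    MeasurableSet {x | f x = g x} := by
  have : {x | f x = g x} = ⋂ n : ℕ, {x | f x n = g x n} := by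
    ext x
    simp [Finsupp.ext_iff]
  rw [this]
  exact MeasurableSet.iInter fun n => measurableSet_eq_fun ((measurable_coord n).comp hf)
    ((measurable_coord n).comp hg)

/-! ### Meromorphic germs of functions on `ℝ^∞` -/

/-- The measure `μ` is invariant under translation by `u`. -/
def InvariantUnder (μ : Measure V) (u : V) : Prop := MeasurePreserving (transEquiv u) μ μ

theorem linEval_ofReal (u : QVec) (z : ℕ → ℝ) :
    linEval u (fun i => (z i : ℂ)) = (pairing (ratVec u) z : ℂ) := by
  rw [linEval, pairing, ratVec, Finsupp.sum_mapRange_index fun i => by simp]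
  simp [Finsupp.sum]

/-- The difference operator `τ ↦ τ - τ (· - u)`. -/
def diffOp (u : V) (τ : V → ℝ) (x : V) : ℝ := τ x - τ (x - u)

theorem diffOp_comm (u w : V) (τ : V → ℝ) : diffOp u (diffOp w τ) = diffOp w (diffOp u τ) := by
  funext x
  simp only [diffOp]
  rw [sub_right_comm x u w]
  ring

theorem diffOp_add (u : V) (τ τ' : V → ℝ) : diffOp u (τ + τ') = diffOp u τ + diffOp u τ' := by
  funext x
  simp only [diffOp, Pi.add_apply]
  ring

theorem diffOp_neg (u : V) (τ : V → ℝ) : diffOp u (-τ) = -diffOp u τ := by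
  funext x
  simp only [diffOp, Pi.neg_apply]
  ring

variable {μ : Measure V}

theorem InvariantUnder.integrable_shift {u : V} (hu : InvariantUnder μ u) {τ : V → ℝ} {z : ℕ → ℝ}
    (h : Integrable (fun x => τ x * Real.exp (pairing x z)) μ) :
    Integrable (fun x => τ (x - u) * Real.exp (pairing x z)) μ := by
  rw [← hu.integrable_comp_emb (transEquiv u).measurableEmbedding]
  refine (h.mul_const (Real.exp (pairing u z))).congr (Eventually.of_forall fun x => ?_)
  simp only [Function.comp_apply, transEquiv, MeasurableEquiv.coe_mk, Equiv.coe_fn_mk,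
    add_sub_cancel_right, pairing_add, Real.exp_add]
  ring

theorem InvariantUnder.integral_shift {u : V} (hu : InvariantUnder μ u) (τ : V → ℝ) (z : ℕ → ℝ) :
    ∫ x, τ (x - u) * Real.exp (pairing x z) ∂μ
      = Real.exp (pairing u z) * ∫ x, τ x * Real.exp (pairing x z) ∂μ := by
  rw [← hu.integral_comp (transEquiv u).measurableEmbedding, ← integral_const_mul]
  refine integral_congr_ae (Eventually.of_forall fun x => ?_)
  simp only [transEquiv, MeasurableEquiv.coe_mk, Equiv.coe_fn_mk,
    add_sub_cancel_right, pairing_add, Real.exp_add]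
  ring

theorem InvariantUnder.integrable_diffOp {u : V} (hu : InvariantUnder μ u) {τ : V → ℝ} {z : ℕ → ℝ}
    (h : Integrable (fun x => τ x * Real.exp (pairing x z)) μ) :
    Integrable (fun x => diffOp u τ x * Real.exp (pairing x z)) μ := by
  simp only [diffOp, sub_mul]
  exact h.sub (hu.integrable_shift h)

theorem InvariantUnder.integral_diffOp {u : V} (hu : InvariantUnder μ u) {τ : V → ℝ} {z : ℕ → ℝ}
    (h : Integrable (fun x => τ x * Real.exp (pairing x z)) μ) :
    ∫ x, diffOp u τ x * Real.exp (pairing x z) ∂μ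
      = (1 - Real.exp (pairing u z)) * ∫ x, τ x * Real.exp (pairing x z) ∂μ := by
  simp only [diffOp, sub_mul]
  rw [integral_sub h (hu.integrable_shift h), hu.integral_shift, one_mul]

theorem InvariantUnder.diffOp_ae_eq_zero {u : V} (hu : InvariantUnder μ u) {τ : V → ℝ}
    (h : τ =ᵐ[μ] 0) : diffOp u τ =ᵐ[μ] 0 := by
  have h1 : ∀ᵐ x ∂μ, τ ((transEquiv u).symm x) = 0 :=
    hu.symm.quasiMeasurePreserving.ae h
  filter_upwards [h, h1] with x hx hx'
  have hx' : τ (x - u) = 0 := hx'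
  simp [diffOp, hx, hx']

/-- The function `τ` is integrable against all exponentials and its exponential integral is the
holomorphic germ `f`. -/
structure IsBaseGerm (μ : Measure V) (τ : V → ℝ) (f : Mero ℕ) : Prop where
  integrable : ∀ z, Integrable (fun x => τ x * Real.exp (pairing x z)) μ
  germ : ∃ (H : (ℕ → ℂ) → ℂ) (hH : IsRatHolomorphic H), f = toMero hH.germ ∧
    ∀ᶠ z in 𝓝 (0 : ℕ → ℝ), H (fun i => (z i : ℂ)) =
      ((∫ x, τ x * Real.exp (pairing x z) ∂μ : ℝ) : ℂ)

theorem IsBaseGerm.add {τ τ' : V → ℝ} {f f' : Mero ℕ} (h : IsBaseGerm μ τ f)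
    (h' : IsBaseGerm μ τ' f') : IsBaseGerm μ (τ + τ') (f + f') := by
  obtain ⟨hi, H, hH, rfl, e⟩ := h
  obtain ⟨hi', H', hH', rfl, e'⟩ := h'
  refine ⟨fun z => ?_, H + H', hH.add hH', ?_, ?_⟩
  · simp only [Pi.add_apply, add_mul]
    exact (hi z).add (hi' z)
  · rw [← toMero_add, IsRatHolomorphic.germ_add]
  · filter_upwards [e, e'] with z h1 h2
    simp only [Pi.add_apply, add_mul, h1, h2]
    rw [integral_add (hi z) (hi' z), Complex.ofReal_add]

theorem IsBaseGerm.neg {τ : V → ℝ} {f : Mero ℕ} (h : IsBaseGerm μ τ f) :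
    IsBaseGerm μ (-τ) (-f) := by
  obtain ⟨hi, H, hH, rfl, e⟩ := h
  refine ⟨fun z => ?_, -H, hH.neg, ?_, ?_⟩
  · simp only [Pi.neg_apply, neg_mul]
    exact (hi z).neg
  · rw [← sub_eq_zero, neg_sub_left, neg_eq_zero, ← toMero_add]
    have : hH.neg.germ + hH.germ = 0 := by
      rw [IsRatHolomorphic.germ_add, ← germ_zero, IsRatHolomorphic.germ_eq_iff]
      exact Eventually.of_forall fun z => by simp
    rw [this, toMero_zero]
  · filter_upwards [e] with z h1
    simp only [Pi.neg_apply, neg_mul, h1]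
    rw [integral_neg, Complex.ofReal_neg]

theorem IsBaseGerm.diffOp {τ : V → ℝ} {f : Mero ℕ} (h : IsBaseGerm μ τ f) {u : QVec}
    (hu : InvariantUnder μ (ratVec u)) :
    IsBaseGerm μ (diffOp (ratVec u) τ) (f * oneSubExp u) := by
  obtain ⟨hi, H, hH, rfl, e⟩ := h
  refine ⟨fun z => hu.integrable_diffOp (hi z), _,
    hH.mul (isRatHolomorphic_one.add (isRatHolomorphic_exp u).neg), ?_, ?_⟩
  · rw [oneSubExp, ← toMero_mul]
    congr 1
  · filter_upwards [e] with z h1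
    rw [hu.integral_diffOp (hi z)]
    simp only [Pi.mul_apply, Pi.add_apply, Pi.neg_apply, h1, linEval_ofReal]
    push_cast
    ring

theorem IsBaseGerm.eq_zero {τ : V → ℝ} {f : Mero ℕ} (h : IsBaseGerm μ τ f) (h0 : τ =ᵐ[μ] 0) :
    f = 0 := by
  obtain ⟨hi, H, hH, rfl, e⟩ := h
  have : H =ᶠ[𝓝 0] 0 := by
    refine hH.eventuallyEq_zero_of_isFat isFat_univ ?_
    filter_upwards [e] with z hz _
    rw [hz, integral_eq_zero_of_ae, Complex.ofReal_zero]
    filter_upwards [h0] with x hx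
    simp [hx]
  rw [show hH.germ = 0 from germ_zero ▸ IsRatHolomorphic.germ_eq_iff.2 this, toMero_zero]

/-- The meromorphic germ `f` is the regularised exponential integral of `τ`: after finitely many
difference operators `1 - T_u` the function is integrable against all exponentials, and its
exponential integral is `f ∏ (1 - exp u)`. -/
inductive HasGerm (μ : Measure V) : (V → ℝ) → Mero ℕ → Prop
  | base {τ : V → ℝ} {f : Mero ℕ} (h : IsBaseGerm μ τ f) : HasGerm μ τ f
  | step {τ : V → ℝ} {f : Mero ℕ} (u : QVec) (hu0 : u ≠ 0) (hu : InvariantUnder μ (ratVec u))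
      (h : HasGerm μ (diffOp (ratVec u) τ) (f * oneSubExp u)) : HasGerm μ τ f

/-- Difference operators commute, so a further one can be carried through the whole regularisation.
-/
theorem HasGerm.diffOp {τ : V → ℝ} {f : Mero ℕ} (h : HasGerm μ τ f) {u : QVec}
    (hu : InvariantUnder μ (ratVec u)) : HasGerm μ (diffOp (ratVec u) τ) (f * oneSubExp u) := by
  induction h with
  | base h => exact .base (h.diffOp hu)
  | step w hw0 hw h ih =>
    refine .step w hw0 hw ?_
    rwa [diffOp_comm, mul_right_comm]

/-- The two functions may be regularised by different vectors; applying both lists of operators to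
both functions gives a common regularisation. -/
theorem HasGerm.add {τ τ' : V → ℝ} {f f' : Mero ℕ} (h : HasGerm μ τ f) (h' : HasGerm μ τ' f') :
    HasGerm μ (τ + τ') (f + f') := by
  induction h generalizing τ' f' with
  | @base τ f h =>
    induction h' generalizing τ f with
    | base h' => exact .base (h.add h')
    | step u hu0 hu h' ih =>
      refine .step u hu0 hu ?_
      rw [diffOp_add, add_mul]
      exact ih (h.diffOp hu)
  | step u hu0 hu h ih =>
    refine .step u hu0 hu ?_
    rw [diffOp_add, add_mul]
    exact ih (h'.diffOp hu)

theorem HasGerm.neg {τ : V → ℝ} {f : Mero ℕ} (h : HasGerm μ τ f) : HasGerm μ (-τ) (-f) := by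
  induction h with
  | base h => exact .base h.neg
  | step u hu0 hu h ih =>
    refine .step u hu0 hu ?_
    rw [diffOp_neg]
    convert! ih using 1
    ring

/-- Difference operators preserve vanishing a.e., and the factors `1 - exp u` can be cancelled
because they are units. Independence of the subdivision rests on this. -/
theorem HasGerm.eq_zero {τ : V → ℝ} {f : Mero ℕ} (h : HasGerm μ τ f) (h0 : τ =ᵐ[μ] 0) :
    f = 0 := by
  induction h with
  | base h => exact h.eq_zero h0
  | step u hu0 hu h ih =>
    have := ih (hu.diffOp_ae_eq_zero h0)
    exact (isUnit_oneSubExp hu0).mul_left_eq_zero.1 this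

theorem HasGerm.unique {τ τ' : V → ℝ} {f f' : Mero ℕ} (h : HasGerm μ τ f) (h' : HasGerm μ τ' f')
    (e : τ =ᵐ[μ] τ') : f = f' := by
  have h1 := (h.add h'.neg).eq_zero (by
    filter_upwards [e] with x hx
    simp [hx])
  rwa [← sub_eq_add_neg, sub_eq_zero] at h1

theorem hasGerm_zero : HasGerm μ 0 0 :=
  .base ⟨fun z => by simp, _, isRatHolomorphic_zero, by rw [germ_zero, toMero_zero],
    Eventually.of_forall fun z => by simp⟩

theorem HasGerm.sum {α : Type*} (s : Finset α) {τ : α → V → ℝ} {f : α → Mero ℕ}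
    (h : ∀ a ∈ s, HasGerm μ (τ a) (f a)) : HasGerm μ (∑ a ∈ s, τ a) (∑ a ∈ s, f a) := by
  classical
  induction s using Finset.induction_on with
  | empty => simpa using hasGerm_zero
  | insert a s ha ih =>
    rw [Finset.sum_insert ha, Finset.sum_insert ha]
    exact (h a (Finset.mem_insert_self a s)).add (ih fun b hb => h b (Finset.mem_insert_of_mem hb))

/-- The numerator is multiplied by `-todd u` and the denominator by `u`. The identity of values
holds where `|⟨u, z⟩| < 1`, so that the series for `todd u` converges. -/
theorem isGivenBy_of_mul_oneSubExp {f : Mero ℕ} {U : Set (ℕ → ℝ)} {F : (ℕ → ℝ) → ℝ} {u : QVec}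
    (hu0 : u ≠ 0) (h : IsGivenBy (f * oneSubExp u) U
      fun z => (1 - Real.exp (pairing (ratVec u) z)) * F z) : IsGivenBy f U F := by
  obtain ⟨H, hH, s, hs, e, hev⟩ := h
  refine ⟨_, hH.mul (isRatHolomorphic_toddFun u).neg, u :: s, ?_, ?_, ?_⟩
  · simpa [hu0] using hs
  · have : (hH.mul (isRatHolomorphic_toddFun u).neg).germ = hH.germ * -toddGerm u := rfl
    rw [linProd_cons, ← oneSubExp_mul_toddGerm, this, toMero_mul, ← e]
    ring
  · have ht : Tendsto (linEval u) (𝓝 0) (𝓝 0) :=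
      (continuous_linEval u).tendsto' _ _ (linEval_zero_right u)
    filter_upwards [hev, (ht.comp tendsto_ofReal_pi).eventually
      (Metric.ball_mem_nhds (0 : ℂ) one_pos)] with z hz hball hzU
    have h1 := hz hzU
    have h2 := expSubOneDiv_mul_toddFun (x := linEval u fun i => (z i : ℂ)) (by simpa using hball)
    have h3 := mul_expSubOneDiv (linEval u fun i => (z i : ℂ))
    simp only [Pi.mul_apply, Pi.neg_apply, List.map_cons, List.prod_cons]
    rw [← h1]
    push_cast
    rw [linEval_ofReal] at *
    set P := (List.map (fun L => linEval L fun i => (z i : ℂ)) s).prod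
    set a := ((pairing (ratVec u) z : ℝ) : ℂ)
    linear_combination (F z : ℂ) * P * toddFun a * h3 - (F z : ℂ) * P * a * h2

/-- Where the integral converges, it satisfies the same relation with the factors `1 - exp u` as the
germ. -/
theorem HasGerm.isGivenBy {τ : V → ℝ} {f : Mero ℕ} (h : HasGerm μ τ f) {U : Set (ℕ → ℝ)}
    (hi : ∀ z ∈ U, Integrable (fun x => τ x * Real.exp (pairing x z)) μ) {F : (ℕ → ℝ) → ℝ}
    (hF : ∀ z ∈ U, F z = ∫ x, τ x * Real.exp (pairing x z) ∂μ) : IsGivenBy f U F := by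
  induction h generalizing F with
  | base h =>
    obtain ⟨-, H, hH, rfl, e⟩ := h
    refine ⟨H, hH, [], by simp, by simp, ?_⟩
    filter_upwards [e] with z hz hzU
    simp [hz, hF z hzU]
  | step u hu0 hu h ih =>
    refine isGivenBy_of_mul_oneSubExp hu0 (ih (fun z hz => hu.integrable_diffOp (hi z hz)) ?_)
    intro z hz
    rw [hu.integral_diffOp (hi z hz), hF z hz]

theorem IsGivenBy.unique {f f' : Mero ℕ} {U : Set (ℕ → ℝ)} (hU : IsFat U) {F F' : (ℕ → ℝ) → ℝ}
    (h : IsGivenBy f U F) (h' : IsGivenBy f' U F') (e : ∀ z ∈ U, F z = F' z) : f = f' := by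
  obtain ⟨H, hH, s, hs, hf, hev⟩ := h
  obtain ⟨H', hH', s', hs', hf', hev'⟩ := h'
  obtain ⟨hS, eS⟩ := list_prod_linGerm s
  obtain ⟨hS', eS'⟩ := list_prod_linGerm s'
  have key : H * (fun z => (s'.map fun L => linEval L z).prod) =ᶠ[𝓝 0]
      H' * (fun z => (s.map fun L => linEval L z).prod) := by
    refine (hH.mul hS').eventuallyEq_of_isFat (hH'.mul hS) hU ?_
    filter_upwards [hev, hev'] with z h1 h2 hz
    simp only [Pi.mul_apply]
    rw [← h1 hz, ← h2 hz, e z hz]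
    ring
  have key2 : hH.germ * (s'.map linGerm).prod = hH'.germ * (s.map linGerm).prod := by
    rw [eS, eS', IsRatHolomorphic.germ_mul, IsRatHolomorphic.germ_mul]
    exact IsRatHolomorphic.germ_eq_iff.2 key
  have hss : ∀ L ∈ s ++ s', L ≠ 0 := fun L hL => (List.mem_append.1 hL).elim (hs L) (hs' L)
  refine eq_of_mul_linProd hss ?_
  have key3 := congrArg toMero key2
  rw [toMero_mul, toMero_mul, ← hf, ← hf'] at key3
  rw [linProd_append]
  simp only [linProd] at key3 ⊢
  linear_combination key3

/-! ### Simplicial cones -/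

/-- Combinations of `v` with positive coefficients, those outside `J` being at most `1`. -/
def mixedCone (v : ι → V) (J : Finset ι) : Set V :=
  {x | ∃ t : ι → ℝ, (∀ i, 0 < t i ∧ (i ∉ J → t i ≤ 1)) ∧ ∑ i, t i • v i = x}

/-- The half-open parallelepiped spanned by `v`. -/
def box (v : ι → V) : Set V := {x | ∃ t : ι → ℝ, (∀ i, 0 < t i ∧ t i ≤ 1) ∧ ∑ i, t i • v i = x}

theorem mixedCone_empty (v : ι → V) : mixedCone v ∅ = box v := by
  simp [mixedCone, box]

theorem mixedCone_univ (v : ι → V) : mixedCone v Finset.univ = openCone v := by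
  simp [mixedCone, openCone]

theorem mem_mixedCone_iff [DecidableEq ι] {v : ι → V} {φ : ι → (V →ₗ[ℝ] ℝ)}
    (hφ : ∀ i j, φ i (v j) = if i = j then 1 else 0) {J : Finset ι} {x : V} :
    x ∈ mixedCone v J ↔ ∑ i, φ i x • v i = x ∧ ∀ i, 0 < φ i x ∧ (i ∉ J → φ i x ≤ 1) := by
  constructor
  · rintro ⟨t, ht, rfl⟩
    have : ∀ j, φ j (∑ i, t i • v i) = t j := fun j => by simp [hφ]
    simp only [this]
    exact ⟨trivial, ht⟩
  · rintro ⟨h1, h2⟩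
    exact ⟨_, h2, h1⟩

theorem measurableSet_mixedCone {v : ι → V} (hv : LinearIndependent ℝ v) (J : Finset ι) :
    MeasurableSet (mixedCone v J) := by
  classical
  obtain ⟨φ, hφ⟩ := exists_dual_family hv
  have : mixedCone v J = {x | ∑ i, φ i x • v i = x} ∩ ⋂ i, {x | 0 < φ i x ∧ (i ∉ J → φ i x ≤ 1)} := by
    ext x
    rw [mem_mixedCone_iff hφ]
    simp
  rw [this]
  refine (measurableSet_eqV ?_ measurable_id).inter (MeasurableSet.iInter fun i => ?_)
  · exact (measurable_sum_smul v).comp (measurable_pi_lambda _ fun i => measurable_linearMap (φ i))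
  · have hm := measurable_linearMap (φ i)
    by_cases hi : i ∈ J
    · simpa [hi] using measurableSet_lt measurable_const hm
    · simp only [hi, not_false_eq_true, true_imp_iff]
      exact (measurableSet_lt measurable_const hm).inter (measurableSet_le hm measurable_const)

theorem measurableSet_openCone {v : ι → V} (hv : LinearIndependent ℝ v) :
    MeasurableSet (openCone v) := mixedCone_univ v ▸ measurableSet_mixedCone hv _

/-- Translation by `v j` moves the condition `t j > 0` to `t j > 1`; the difference of the two
indicators is the slab `0 < t j ≤ 1`. -/
theorem diffOp_indicator_mixedCone [DecidableEq ι] {v : ι → V} (hv : LinearIndependent ℝ v)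
    {J : Finset ι} {j : ι} (hj : j ∉ J) :
    diffOp (v j) ((mixedCone v (insert j J)).indicator 1) = (mixedCone v J).indicator 1 := by
  obtain ⟨φ, hφ⟩ := exists_dual_family hv
  have hsub : mixedCone v J ⊆ mixedCone v (insert j J) := by
    rintro x ⟨t, ht, rfl⟩
    exact ⟨t, fun i => ⟨(ht i).1, fun hi => (ht i).2 fun h => hi (Finset.mem_insert_of_mem h)⟩, rfl⟩
  have hiff : ∀ x, x - v j ∈ mixedCone v (insert j J) ↔
      x ∈ mixedCone v (insert j J) ∧ x ∉ mixedCone v J := by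
    intro x
    have hs : (∑ i, φ i (x - v j) • v i = x - v j) ↔ ∑ i, φ i x • v i = x := by
      simp only [map_sub, hφ, sub_smul, Finset.sum_sub_distrib, ite_smul, one_smul, zero_smul,
        Finset.sum_ite_eq', Finset.mem_univ, if_true, sub_left_inj]
    rw [mem_mixedCone_iff hφ, mem_mixedCone_iff hφ, mem_mixedCone_iff hφ, hs]
    constructor
    · rintro ⟨h1, h2⟩
      have h2' : ∀ i, φ i (x - v j) = φ i x - if i = j then 1 else 0 := fun i => by
        rw [map_sub, hφ]
      simp only [h2'] at h2
      refine ⟨⟨h1, fun i => ?_⟩, fun h => ?_⟩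
      · by_cases hij : i = j
        · subst hij
          have := (h2 i).1
          simp only [if_true] at this
          exact ⟨by linarith, fun h => absurd (Finset.mem_insert_self i J) h⟩
        · simpa [hij] using h2 i
      · have h3 := (h2 j).1
        have h4 := (h.2 j).2 hj
        simp only [if_true] at h3
        linarith
    · rintro ⟨⟨h1, h2⟩, h3⟩
      refine ⟨h1, fun i => ?_⟩
      rw [map_sub, hφ]
      by_cases hij : i = j
      · subst hij
        simp only [if_true, Finset.mem_insert, true_or, not_true, false_imp_iff, and_true]
        by_contra hle
        refine h3 ⟨h1, fun k => ⟨(h2 k).1, fun hk => ?_⟩⟩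
        by_cases hki : k = i
        · subst hki; linarith
        · exact (h2 k).2 (by simp [hki, hk])
      · simpa [hij] using h2 i
  funext x
  have hx := hiff x
  by_cases h1 : x ∈ mixedCone v J
  · have h3 : x - v j ∉ mixedCone v (insert j J) := by simp [hx, h1]
    simp [diffOp, h1, hsub h1, h3]
  · by_cases h2 : x ∈ mixedCone v (insert j J)
    · have h3 : x - v j ∈ mixedCone v (insert j J) := by simp [hx, h1, h2]
      simp [diffOp, h1, h2, h3]
    · have h3 : x - v j ∉ mixedCone v (insert j J) := by simp [hx, h2]
      simp [diffOp, h1, h2, h3]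

/-- Starting from the box, the generators are released one at a time, each at the cost of one factor
`1 - exp (v j)`. -/
theorem hasGerm_openCone {v : ι → QVec} (hv : LinearIndependent ℝ fun i => ratVec (v i))
    (hinv : ∀ i, InvariantUnder μ (ratVec (v i))) {g f : Mero ℕ}
    (hbox : IsBaseGerm μ ((box fun i => ratVec (v i)).indicator 1) g)
    (hf : f * ∏ i, oneSubExp (v i) = g) :
    HasGerm μ ((openCone fun i => ratVec (v i)).indicator 1) f := by
  classical
  rw [← mixedCone_univ]
  suffices h : ∀ (J : Finset ι) (f : Mero ℕ), f * ∏ i ∈ J, oneSubExp (v i) = g →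
      HasGerm μ ((mixedCone (fun i => ratVec (v i)) J).indicator 1) f from h _ f hf
  intro J
  induction J using Finset.induction_on with
  | empty =>
    intro f hf
    rw [Finset.prod_empty, mul_one] at hf
    rw [mixedCone_empty, hf]
    exact .base hbox
  | insert j J hj ih =>
    intro f hf
    have h0 : v j ≠ 0 := fun h => hv.ne_zero j (by simp [h])
    refine .step (v j) h0 (hinv j) ?_
    rw [diffOp_indicator_mixedCone hv hj]
    refine ih _ ?_
    rw [← hf, Finset.prod_insert hj]
    ring

/-! ### Convergence over open simplicial cones -/

theorem InvariantUnder.setLIntegral_preimage {u : V} (hu : InvariantUnder μ u) (A : Set V)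
    (z : ℕ → ℝ) :
    ∫⁻ x in (fun x => x - u) ⁻¹' A, ENNReal.ofReal (Real.exp (pairing x z)) ∂μ
      = ENNReal.ofReal (Real.exp (pairing u z)) *
        ∫⁻ x in A, ENNReal.ofReal (Real.exp (pairing x z)) ∂μ := by
  have h1 := hu.setLIntegral_comp_preimage_emb (transEquiv u).measurableEmbedding
    (fun x => ENNReal.ofReal (Real.exp (pairing x z))) ((fun x => x - u) ⁻¹' A)
  rw [← h1, ← lintegral_const_mul']
  · have : (transEquiv u) ⁻¹' ((fun x => x - u) ⁻¹' A) = A := by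
      ext x
      simp [transEquiv]
    rw [this]
    refine lintegral_congr fun x => ?_
    rw [← ENNReal.ofReal_mul (Real.exp_pos _).le, ← Real.exp_add, ← pairing_add, add_comm u x]
    rfl
  · exact ENNReal.ofReal_ne_top

theorem mixedCone_insert_subset [DecidableEq ι] (v : ι → V) (J : Finset ι) (j : ι) :
    mixedCone v (insert j J) ⊆ ⋃ n : ℕ, (fun x => x - v j)^[n] ⁻¹' mixedCone v J := by
  have hit : ∀ (n : ℕ) (x : V), (fun x => x - v j)^[n] x = x - (n : ℝ) • v j := by
    intro n
    induction n with
    | zero => simp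
    | succ n ih =>
      intro x
      rw [Function.iterate_succ_apply', ih]
      push_cast
      rw [add_smul, one_smul, sub_sub]
  rintro x ⟨t, ht, rfl⟩
  obtain ⟨n, hn⟩ : ∃ n : ℕ, 0 < t j - n ∧ t j - n ≤ 1 := by
    -- The ceiling minus one, not the floor, because the target interval `(0, 1]` is open on the
    -- left.
    refine ⟨⌈t j⌉₊ - 1, ?_⟩
    have h1 : 0 < ⌈t j⌉₊ := Nat.ceil_pos.2 (ht j).1
    rw [Nat.cast_sub h1, Nat.cast_one]
    have h2 := Nat.ceil_lt_add_one (ht j).1.le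
    have h3 := Nat.le_ceil (t j)
    constructor <;> linarith
  refine Set.mem_iUnion.2 ⟨n, ?_⟩
  rw [Set.mem_preimage, hit]
  refine ⟨fun i => t i - if i = j then (n : ℝ) else 0, fun i => ?_, ?_⟩
  · by_cases hij : i = j
    · subst hij
      simp only [if_true]
      exact ⟨hn.1, fun _ => hn.2⟩
    · have := ht i
      simpa [hij] using this
  · simp [sub_smul, Finset.sum_sub_distrib]

/-- The cone is covered by translates of the box, and each direction contributes a geometric series
of ratio `exp ⟨v j, z⟩ < 1`. -/
theorem integrableOn_openCone {v : ι → V}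
    (hinv : ∀ i, InvariantUnder μ (v i)) {z : ℕ → ℝ}
    (hbox : IntegrableOn (fun x => Real.exp (pairing x z)) (box v) μ)
    (hz : ∀ i, pairing (v i) z < 0) :
    IntegrableOn (fun x => Real.exp (pairing x z)) (openCone v) μ := by
  classical
  have key : ∀ J : Finset ι,
      ∫⁻ x in mixedCone v J, ENNReal.ofReal (Real.exp (pairing x z)) ∂μ < ⊤ := by
    intro J
    induction J using Finset.induction_on with
    | empty =>
      rw [mixedCone_empty]
      have := hbox.lintegral_lt_top
      exact this
    | insert j J hj ih =>
      set q := ENNReal.ofReal (Real.exp (pairing (v j) z)) with hq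
      have hstep : ∀ n : ℕ, ∫⁻ x in (fun x => x - v j)^[n] ⁻¹' mixedCone v J,
          ENNReal.ofReal (Real.exp (pairing x z)) ∂μ = q ^ n *
          ∫⁻ x in mixedCone v J, ENNReal.ofReal (Real.exp (pairing x z)) ∂μ := by
        intro n
        induction n with
        | zero => simp
        | succ n ihn =>
          rw [Function.iterate_succ, Set.preimage_comp, (hinv j).setLIntegral_preimage, ihn,
            pow_succ']
          ring
      refine (lintegral_mono_set (mixedCone_insert_subset v J j)).trans_lt ?_
      refine (lintegral_iUnion_le _ _).trans_lt ?_
      simp only [hstep]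
      rw [ENNReal.tsum_mul_right, ENNReal.tsum_geometric]
      refine ENNReal.mul_lt_top ?_ ih
      have hq1 : q < 1 := by
        rw [hq, ENNReal.ofReal_lt_one, Real.exp_lt_one_iff]
        exact hz j
      exact ENNReal.inv_lt_top.2 (tsub_pos_of_lt hq1)
  refine ⟨(measurable_exp_pairing z).aestronglyMeasurable, ?_⟩
  rw [hasFiniteIntegral_iff_ofReal (Eventually.of_forall fun x => (Real.exp_pos _).le),
    ← mixedCone_univ]
  exact key _

end

section

open MeasureTheory

/-! ### Measures with rational exponential integrals over parallelepipeds -/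

/-- The rational span of a group of rational vectors. -/
def ratSpan (Λ : AddSubgroup V) : Submodule ℚ QVec := Submodule.span ℚ {u | ratVec u ∈ Λ}

theorem mem_ratSpan {Λ : AddSubgroup V} {u : QVec} (hu : ratVec u ∈ Λ) : u ∈ ratSpan Λ :=
  Submodule.subset_span hu

/-- A measure that is invariant under `Λ` and for which the exponential integrals over half-open
parallelepipeds spanned by vectors of `Λ` are holomorphic germs in the variables `Λ`. -/
structure IsExpMeasure (Λ : AddSubgroup V) (μ : Measure V) : Prop where
  invariant : ∀ u ∈ Λ, InvariantUnder μ u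
  box : ∀ {ι : Type} [Fintype ι] (v : ι → QVec), (∀ i, ratVec (v i) ∈ Λ) →
    LinearIndependent ℝ (fun i => ratVec (v i)) → ∃ G ∈ holIn (ratSpan Λ),
      IsBaseGerm μ ((box fun i => ratVec (v i)).indicator 1) (toMero G)

theorem indicator_one_mul (A : Set V) (g : V → ℝ) :
    (fun x => A.indicator (1 : V → ℝ) x * g x) = A.indicator g := by
  funext x
  by_cases hx : x ∈ A <;> simp [hx]

theorem isUnit_prod_oneSubExp {ι : Type*} (s : Finset ι) {v : ι → QVec} (hv : ∀ i ∈ s, v i ≠ 0) :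
    IsUnit (∏ i ∈ s, oneSubExp (v i)) := by
  classical
  induction s using Finset.induction_on with
  | empty => simp
  | insert a s ha ih =>
    rw [Finset.prod_insert ha]
    exact (isUnit_oneSubExp (hv a (Finset.mem_insert_self a s))).mul
      (ih fun i hi => hv i (Finset.mem_insert_of_mem hi))

theorem DependsOn.of_mul_prod_oneSubExp {ι : Type*} (s : Finset ι) {W : Submodule ℚ QVec}
    {v : ι → QVec} (hv : ∀ i ∈ s, v i ∈ W ∧ v i ≠ 0) {f : Mero ℕ}
    (h : DependsOn W (f * ∏ i ∈ s, oneSubExp (v i))) : DependsOn W f := by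
  classical
  induction s using Finset.induction_on generalizing f with
  | empty => simpa using h
  | insert a s ha ih =>
    rw [Finset.prod_insert ha, ← mul_assoc] at h
    have h1 := ih (fun i hi => hv i (Finset.mem_insert_of_mem hi)) h
    exact h1.of_mul_oneSubExp (hv a (Finset.mem_insert_self a s)).1
      (hv a (Finset.mem_insert_self a s)).2

variable {ι κ : Type} [Fintype ι] [Fintype κ]

theorem ne_zero_of_independent {ι : Type} {v : ι → QVec} (hv : LinearIndependent ℝ fun i => ratVec (v i))
    (i : ι) : v i ≠ 0 := fun h => hv.ne_zero i (by simp [h])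

/-- The germ is that of the box divided by `∏ (1 - exp (v i))`. The box germ is recorded too, since
products are computed on boxes. -/
theorem IsExpMeasure.exists_hasGerm_openCone {Λ : AddSubgroup V} {μ : Measure V}
    (hμ : IsExpMeasure Λ μ) {v : ι → QVec} (hΛ : ∀ i, ratVec (v i) ∈ Λ)
    (hv : LinearIndependent ℝ fun i => ratVec (v i)) : ∃ f g : Mero ℕ, DependsOn (ratSpan Λ) f ∧
      IsBaseGerm μ ((LocCones.box fun i => ratVec (v i)).indicator 1) g ∧
      f * ∏ i, oneSubExp (v i) = g ∧
      HasGerm μ ((openCone fun i => ratVec (v i)).indicator 1) f := by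
  obtain ⟨G, hG, hbox⟩ := hμ.box v hΛ hv
  have hu : IsUnit (∏ i, oneSubExp (v i)) :=
    isUnit_prod_oneSubExp _ fun i _ => ne_zero_of_independent hv i
  have hf : toMero G * ((hu.unit⁻¹ : (Mero ℕ)ˣ) : Mero ℕ) * ∏ i, oneSubExp (v i) = toMero G := by
    rw [mul_assoc, IsUnit.val_inv_mul, mul_one]
  refine ⟨_, _, ?_, hbox, hf, hasGerm_openCone hv (fun i => hμ.invariant _ (hΛ i)) hbox hf⟩
  refine DependsOn.of_mul_prod_oneSubExp Finset.univ
    (fun i _ => ⟨mem_ratSpan (hΛ i), ne_zero_of_independent hv i⟩) ?_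
  rw [hf]
  exact dependsOn_toMero hG

theorem indicator_eq_sum_of_partition {α β : Type*} (s : Finset α) {A : α → Set β} {B : Set β}
    (hB : B = ⋃ a ∈ s, A a) (hd : ∀ a ∈ s, ∀ b ∈ s, ∀ x, x ∈ A a → x ∈ A b → a = b) :
    B.indicator (1 : β → ℝ) = ∑ a ∈ s, (A a).indicator 1 := by
  classical
  funext x
  rw [Finset.sum_apply]
  by_cases hx : x ∈ B
  · rw [hB] at hx
    obtain ⟨a, ha, hxa⟩ := Set.mem_iUnion₂.1 hx
    rw [Finset.sum_eq_single a, Set.indicator_of_mem hxa, Set.indicator_of_mem (hB ▸ hx)]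
    · intro b hb hba
      exact Set.indicator_of_notMem (fun hxb => hba (hd b hb a ha x hxb hxa)) _
    · exact fun h => absurd ha h
  · rw [Set.indicator_of_notMem hx, Finset.sum_eq_zero]
    intro a ha
    refine Set.indicator_of_notMem (fun hxa => hx ?_) _
    rw [hB]
    exact Set.mem_biUnion ha hxa

namespace LatticeCone

variable {C D P : LatticeCone}

theorem IsTriangulation.indicator_relInterior {k : ℕ} {v : Fin k → QVec}
    {K K' : Finset (Finset (Fin k))} (h : P.IsTriangulation v K K') :
    P.relInterior.indicator (1 : V → ℝ) =
      ∑ I ∈ K', (openCone fun i : I => ratVec (v i)).indicator 1 :=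
  indicator_eq_sum_of_partition K' h.relInterior_eq fun I hI J hJ x hx hy =>
    h.unique x I (h.subset hI) J (h.subset hJ) hx hy

theorem IsTriangulation.measurableSet_cell {k : ℕ} {v : Fin k → QVec}
    {K K' : Finset (Finset (Fin k))} (h : P.IsTriangulation v K K') {I : Finset (Fin k)}
    (hI : I ∈ K) : MeasurableSet (openCone fun i : I => ratVec (v i)) :=
  measurableSet_openCone (h.indep I hI)

theorem measurableSet_relInterior (P : LatticeCone) : MeasurableSet P.relInterior := by
  obtain ⟨k, v, K, K', h⟩ := P.exists_isTriangulation
  rw [h.relInterior_eq]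
  exact Finset.measurableSet_biUnion K' fun I hI => h.measurableSet_cell (h.subset hI)

theorem measurableSet_cone (P : LatticeCone) : MeasurableSet (P.cone : Set V) := by
  obtain ⟨k, v, K, K', h⟩ := P.exists_isTriangulation
  rw [h.cone_eq]
  exact Finset.measurableSet_biUnion K fun I hI => h.measurableSet_cell hI

/-- Triangulation reduces to simplicial cones, so no convexity assumption is needed. The lattice `Λ`
may exceed that of `P`, which lets a piece of a subdivision be measured with the lattice of the
whole cone. -/
theorem exists_hasGerm {Λ : AddSubgroup V} {μ : Measure V} (hμ : IsExpMeasure Λ μ)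
    (hP : P.lattice ≤ Λ) :
    ∃ f, DependsOn (ratSpan Λ) f ∧ HasGerm μ (P.relInterior.indicator 1) f := by
  classical
  obtain ⟨k, v, K, K', h⟩ := P.exists_isTriangulation
  have hex : ∀ I : Finset (Fin k), ∃ f : Mero ℕ, I ∈ K' → DependsOn (ratSpan Λ) f ∧
      HasGerm μ ((openCone fun i : I => ratVec (v i)).indicator 1) f := by
    intro I
    by_cases hI : I ∈ K'
    · obtain ⟨f, -, h1, -, -, h2⟩ := hμ.exists_hasGerm_openCone
        (v := fun i : I => v i) (fun i => hP (h.mem_lattice i)) (h.indep I (h.subset hI))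
      exact ⟨f, fun _ => ⟨h1, h2⟩⟩
    · exact ⟨0, fun h => absurd h hI⟩
  choose f hf using hex
  refine ⟨∑ I ∈ K', f I, DependsOn.sum K' fun I hI => (hf I hI).1, ?_⟩
  rw [h.indicator_relInterior]
  exact HasGerm.sum K' fun I hI => (hf I hI).2

theorem indicator_subdivision {n : ℕ} {P : Fin n → LatticeCone} (h : C.IsSubdivision P) :
    C.relInterior.indicator (1 : V → ℝ) = ∑ i, (P i).relInterior.indicator 1 := by
  refine indicator_eq_sum_of_partition Finset.univ (by simp [← h.iUnion_eq]) ?_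
  intro i _ j _ x hi hj
  by_contra hij
  exact Set.disjoint_left.1 (h.disjoint i j hij) hi hj

theorem relInterior_subset_linSpan (C : LatticeCone) : C.relInterior ⊆ C.linSpan :=
  fun _ hx => Submodule.subset_span hx.1

theorem lattice_subset_linSpan (C : LatticeCone) : (C.lattice : Set V) ⊆ C.linSpan := by
  intro x hx
  rw [linSpan, ← C.span_eq]
  exact Submodule.subset_span hx

theorem IsSubdivision.lattice_le {n : ℕ} {P : Fin n → LatticeCone} (h : C.IsSubdivision P)
    (i : Fin n) : (P i).lattice ≤ C.lattice := fun x hx => by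
  have : x ∈ (C.lattice : Set V) ∩ ((P i).linSpan : Set V) := h.lattice_eq i ▸ hx
  exact this.1

theorem IsSubdivision.relInterior_inter {n : ℕ} {P : Fin n → LatticeCone} (h : C.IsSubdivision P)
    (i : Fin n) : (P i).relInterior ∩ ((P i).lattice : Set V)
      = (P i).relInterior ∩ (C.lattice : Set V) := by
  rw [h.lattice_eq]
  ext x
  constructor
  · exact fun hx => ⟨hx.1, hx.2.1⟩
  · exact fun hx => ⟨hx.1, hx.2, (P i).relInterior_subset_linSpan hx.1⟩

/-! ### Products of orthogonal cones -/

theorem form_eq_zero {Q : RatInnerProduct} (h : Orth Q C D) {x y : V} (hx : x ∈ C.linSpan)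
    (hy : y ∈ D.linSpan) : Q.form x y = 0 := by
  rw [linSpan, ← span_eq] at hx hy
  induction hx using Submodule.span_induction with
  | zero => simp
  | add x₁ x₂ _ _ h1 h2 => rw [map_add, LinearMap.add_apply, h1, h2, add_zero]
  | smul a x _ h1 => rw [map_smul, LinearMap.smul_apply, h1, smul_zero]
  | mem x hx =>
    induction hy using Submodule.span_induction with
    | zero => simp
    | add y₁ y₂ _ _ h1 h2 => rw [map_add, h1, h2, add_zero]
    | smul a y _ h1 => rw [map_smul, h1, smul_zero]
    | mem y hy => exact h x hx y hy

/-- A common vector would be orthogonal to itself. -/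
theorem Orth.disjoint_linSpan {Q : RatInnerProduct} (h : Orth Q C D) :
    Disjoint C.linSpan D.linSpan := by
  rw [Submodule.disjoint_def]
  intro x hx hy
  by_contra h0
  exact (Q.pos x h0).ne' (form_eq_zero h hx hy)

theorem Orth.formOrth {Q : RatInnerProduct} (h : Orth Q C D) :
    FormOrth Q (ratSpan C.lattice) (ratSpan D.lattice) :=
  formOrth_span Q fun _ hu _ hv => h _ hu _ hv

theorem mul_cone (C D : LatticeCone) : (C * D).cone = C.cone ⊔ D.cone := rfl

theorem mul_lattice (C D : LatticeCone) : (C * D).lattice = C.lattice ⊔ D.lattice := rfl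

theorem relInterior_mul (C D : LatticeCone) :
    (C * D).relInterior = {x | ∃ a ∈ C.relInterior, ∃ b ∈ D.relInterior, a + b = x} := by
  obtain ⟨k, v, -, hv⟩ := C.exists_generators
  obtain ⟨l, w, -, hw⟩ := D.exists_generators
  have h : ((C * D).cone : Set V) = closedCone (Sum.elim (fun i => ratVec (v i))
      fun i => ratVec (w i)) := by
    rw [closedCone_sumElim, ← hv, ← hw, mul_cone]
    ext x
    simp [Submodule.mem_sup]
  rw [relInterior_eq_openCone h, openCone_sumElim, relInterior_eq_openCone hv,
    relInterior_eq_openCone hw]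

end LatticeCone

theorem add_eq_add_of_disjoint {W W' : Submodule ℝ V} (h : Disjoint W W') {a a' b b' : V}
    (ha : a ∈ W) (ha' : a' ∈ W) (hb : b ∈ W') (hb' : b' ∈ W') (e : a + b = a' + b') :
    a = a' ∧ b = b' := by
  have h1 : a - a' = b' - b := by
    rw [sub_eq_sub_iff_add_eq_add, e, add_comm]
  have h2 : a - a' = 0 := Submodule.disjoint_def.1 h _ (W.sub_mem ha ha')
    (h1 ▸ W'.sub_mem hb' hb)
  refine ⟨sub_eq_zero.1 h2, ?_⟩
  rw [h2, eq_comm, sub_eq_zero] at h1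
  exact h1.symm

theorem box_subset_span (v : ι → V) : box v ⊆ Submodule.span ℝ (Set.range v) := by
  rintro x ⟨t, -, rfl⟩
  exact Submodule.sum_mem _ fun i _ => Submodule.smul_mem _ _ (Submodule.subset_span ⟨i, rfl⟩)

theorem box_sumElim (v : ι → V) (w : κ → V) : box (Sum.elim v w) =
    {x | ∃ a ∈ box v, ∃ b ∈ box w, a + b = x} := by
  ext x
  constructor
  · rintro ⟨t, ht, rfl⟩
    exact ⟨_, ⟨fun i => t (Sum.inl i), fun i => ht _, rfl⟩, _,
      ⟨fun i => t (Sum.inr i), fun i => ht _, rfl⟩, by simp [Fintype.sum_sum_type]⟩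
  · rintro ⟨_, ⟨t, ht, rfl⟩, _, ⟨s, hs, rfl⟩, rfl⟩
    refine ⟨Sum.elim t s, ?_, by simp [Fintype.sum_sum_type]⟩
    rintro (i | i)
    · exact ht i
    · exact hs i

theorem linearIndependent_sumElim {ι κ : Type} {v : ι → V} {w : κ → V} (hv : LinearIndependent ℝ v)
    (hw : LinearIndependent ℝ w) (h : Disjoint (Submodule.span ℝ (Set.range v))
      (Submodule.span ℝ (Set.range w))) : LinearIndependent ℝ (Sum.elim v w) :=
  linearIndependent_sum.2 ⟨hv, hw, h⟩

/-- The measures on the spans of the three lattices `Λ₁`, `Λ₂`, `Λ₁ + Λ₂` are compatible with the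
decomposition of the last one as a direct product. -/
def IsProductMeasure (W₁ W₂ : Submodule ℝ V) (μ₁ μ₂ μ : Measure V) : Prop :=
  ∃ (X Y : Type) (_ : MeasurableSpace X) (_ : MeasurableSpace Y) (ν₁ : Measure X) (ν₂ : Measure Y)
    (f : X → V) (g : Y → V), SFinite ν₁ ∧ SFinite ν₂ ∧ Measurable f ∧ Measurable g ∧
    (∀ x, f x ∈ W₁) ∧ (∀ y, g y ∈ W₂) ∧ μ₁ = ν₁.map f ∧ μ₂ = ν₂.map g ∧
    μ = (ν₁.prod ν₂).map fun p => f p.1 + g p.2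

/-- Disjointness makes the decomposition of a point of `A + B` unique, so the integrand is a product
and Fubini applies. -/
theorem IsProductMeasure.isBaseGerm {W₁ W₂ : Submodule ℝ V} {μ₁ μ₂ μ : Measure V}
    (h : IsProductMeasure W₁ W₂ μ₁ μ₂ μ) (hd : Disjoint W₁ W₂) {A B E : Set V}
    (hA : A ⊆ W₁) (hB : B ⊆ W₂) (hAm : MeasurableSet A) (hBm : MeasurableSet B)
    (hEm : MeasurableSet E) (hE : E = {x | ∃ a ∈ A, ∃ b ∈ B, a + b = x}) {g₁ g₂ : Mero ℕ}
    (h₁ : IsBaseGerm μ₁ (A.indicator 1) g₁) (h₂ : IsBaseGerm μ₂ (B.indicator 1) g₂) :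
    IsBaseGerm μ (E.indicator 1) (g₁ * g₂) := by
  obtain ⟨X, Y, _, _, ν₁, ν₂, f, g, _, _, hf, hg, hfW, hgW, rfl, rfl, rfl⟩ := h
  obtain ⟨hi₁, H₁, hH₁, rfl, e₁⟩ := h₁
  obtain ⟨hi₂, H₂, hH₂, rfl, e₂⟩ := h₂
  have hsum : Measurable fun p : X × Y => f p.1 + g p.2 :=
    measurable_addV.comp ((hf.comp measurable_fst).prodMk (hg.comp measurable_snd))
  have hm : ∀ {A : Set V} (_ : MeasurableSet A) (z : ℕ → ℝ),
      Measurable fun x => A.indicator (1 : V → ℝ) x * Real.exp (pairing x z) := by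
    intro A hA z
    exact (measurable_one.indicator hA).mul (measurable_exp_pairing z)
  have hsplit : ∀ (z : ℕ → ℝ) (p : X × Y),
      E.indicator (1 : V → ℝ) (f p.1 + g p.2) * Real.exp (pairing (f p.1 + g p.2) z) =
      (A.indicator (1 : V → ℝ) (f p.1) * Real.exp (pairing (f p.1) z)) *
      (B.indicator (1 : V → ℝ) (g p.2) * Real.exp (pairing (g p.2) z)) := by
    intro z p
    have hiff : f p.1 + g p.2 ∈ E ↔ f p.1 ∈ A ∧ g p.2 ∈ B := by
      rw [hE]
      constructor
      · rintro ⟨a, ha, b, hb, hab⟩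
        obtain ⟨rfl, rfl⟩ := add_eq_add_of_disjoint hd (hA ha) (hfW _) (hB hb) (hgW _) hab
        exact ⟨ha, hb⟩
      · rintro ⟨h1, h2⟩
        exact ⟨_, h1, _, h2, rfl⟩
    rw [pairing_add, Real.exp_add]
    by_cases h1 : f p.1 ∈ A
    · by_cases h2 : g p.2 ∈ B
      · simp [hiff.2 ⟨h1, h2⟩, h1, h2]
      · have h3 : f p.1 + g p.2 ∉ E := fun h => h2 (hiff.1 h).2
        simp [h2, h3]
    · have h3 : f p.1 + g p.2 ∉ E := fun h => h1 (hiff.1 h).1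
      simp [h1, h3]
  refine ⟨fun z => ?_, H₁ * H₂, hH₁.mul hH₂, by rw [← toMero_mul, IsRatHolomorphic.germ_mul], ?_⟩
  · rw [integrable_map_measure (hm hEm z).aestronglyMeasurable hsum.aemeasurable]
    have i1 := hi₁ z
    have i2 := hi₂ z
    rw [integrable_map_measure (hm hAm z).aestronglyMeasurable hf.aemeasurable] at i1
    rw [integrable_map_measure (hm hBm z).aestronglyMeasurable hg.aemeasurable] at i2
    exact (i1.mul_prod i2).congr (Eventually.of_forall fun p => (hsplit z p).symm)
  · filter_upwards [e₁, e₂] with z h1 h2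
    rw [Pi.mul_apply, h1, h2, integral_map hsum.aemeasurable (hm hEm z).aestronglyMeasurable,
      integral_map hf.aemeasurable (hm hAm z).aestronglyMeasurable,
      integral_map hg.aemeasurable (hm hBm z).aestronglyMeasurable]
    simp only [hsplit]
    rw [integral_prod_mul (fun x => A.indicator (1 : V → ℝ) (f x) * Real.exp (pairing (f x) z))
      fun y => B.indicator (1 : V → ℝ) (g y) * Real.exp (pairing (g y) z), Complex.ofReal_mul]

theorem measurableSet_box {v : ι → V} (hv : LinearIndependent ℝ v) : MeasurableSet (box v) :=
  mixedCone_empty v ▸ measurableSet_mixedCone hv ∅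

/-- The integrals over the cones may diverge, so Fubini is used only on boxes. Independence of the
spans makes pairs of cells partition the relative interior of `C * D`, and both the box germs and
the factors `1 - exp u` multiply. -/
theorem LatticeCone.hasGerm_mul {C D : LatticeCone} {μ₁ μ₂ μ : Measure V}
    (hd : Disjoint C.linSpan D.linSpan) (h₁ : IsExpMeasure C.lattice μ₁)
    (h₂ : IsExpMeasure D.lattice μ₂) (h : IsExpMeasure (C * D).lattice μ)
    (hprod : IsProductMeasure C.linSpan D.linSpan μ₁ μ₂ μ) {f₁ f₂ : Mero ℕ}
    (hf₁ : HasGerm μ₁ (C.relInterior.indicator 1) f₁)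
    (hf₂ : HasGerm μ₂ (D.relInterior.indicator 1) f₂) :
    HasGerm μ ((C * D).relInterior.indicator 1) (f₁ * f₂) := by
  classical
  obtain ⟨k, v, K, K', hC⟩ := C.exists_isTriangulation
  obtain ⟨l, w, L, L', hD⟩ := D.exists_isTriangulation
  have hex₁ : ∀ I : Finset (Fin k), ∃ f g : Mero ℕ, I ∈ K' →
      IsBaseGerm μ₁ ((LocCones.box fun i : I => ratVec (v i)).indicator 1) g ∧
      f * ∏ i : I, oneSubExp (v i) = g ∧
      HasGerm μ₁ ((openCone fun i : I => ratVec (v i)).indicator 1) f := by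
    intro I
    by_cases hI : I ∈ K'
    · obtain ⟨f, g, -, h1⟩ := h₁.exists_hasGerm_openCone
        (v := fun i : I => v i) (fun i => hC.mem_lattice i) (hC.indep I (hC.subset hI))
      exact ⟨f, g, fun _ => h1⟩
    · exact ⟨0, 0, fun h => absurd h hI⟩
  have hex₂ : ∀ I : Finset (Fin l), ∃ f g : Mero ℕ, I ∈ L' →
      IsBaseGerm μ₂ ((LocCones.box fun i : I => ratVec (w i)).indicator 1) g ∧
      f * ∏ i : I, oneSubExp (w i) = g ∧
      HasGerm μ₂ ((openCone fun i : I => ratVec (w i)).indicator 1) f := by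
    intro I
    by_cases hI : I ∈ L'
    · obtain ⟨f, g, -, h1⟩ := h₂.exists_hasGerm_openCone
        (v := fun i : I => w i) (fun i => hD.mem_lattice i) (hD.indep I (hD.subset hI))
      exact ⟨f, g, fun _ => h1⟩
    · exact ⟨0, 0, fun h => absurd h hI⟩
  choose F₁ G₁ hF₁ using hex₁
  choose F₂ G₂ hF₂ using hex₂
  -- By uniqueness the given germs may be replaced by the sums over the chosen triangulations.
  have e₁ : f₁ = ∑ I ∈ K', F₁ I := by
    refine hf₁.unique (HasGerm.sum K' fun I hI => (hF₁ I hI).2.2) ?_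
    rw [hC.indicator_relInterior]
  have e₂ : f₂ = ∑ I ∈ L', F₂ I := by
    refine hf₂.unique (HasGerm.sum L' fun I hI => (hF₂ I hI).2.2) ?_
    rw [hD.indicator_relInterior]
  have hCsub : ∀ I : Finset (Fin k),
      Submodule.span ℝ (Set.range fun i : I => ratVec (v i)) ≤ C.linSpan := by
    intro I
    rw [Submodule.span_le]
    rintro _ ⟨i, rfl⟩
    exact C.lattice_subset_linSpan (hC.mem_lattice i)
  have hDsub : ∀ I : Finset (Fin l),
      Submodule.span ℝ (Set.range fun i : I => ratVec (w i)) ≤ D.linSpan := by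
    intro I
    rw [Submodule.span_le]
    rintro _ ⟨i, rfl⟩
    exact D.lattice_subset_linSpan (hD.mem_lattice i)
  let A : Finset (Fin k) × Finset (Fin l) → Set V := fun p =>
    openCone (Sum.elim (fun i : p.1 => ratVec (v i)) fun i : p.2 => ratVec (w i))
  have hpart : (C * D).relInterior.indicator (1 : V → ℝ) = ∑ p ∈ K' ×ˢ L', (A p).indicator 1 := by
    refine indicator_eq_sum_of_partition _ ?_ ?_
    · rw [relInterior_mul]
      ext x
      simp only [A, openCone_sumElim, Set.mem_iUnion, Finset.mem_product]
      constructor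
      · rintro ⟨a, ha, b, hb, rfl⟩
        rw [hC.relInterior_eq] at ha
        rw [hD.relInterior_eq] at hb
        obtain ⟨I, hI, ha⟩ := Set.mem_iUnion₂.1 ha
        obtain ⟨J, hJ, hb⟩ := Set.mem_iUnion₂.1 hb
        exact ⟨(I, J), ⟨hI, hJ⟩, a, ha, b, hb, rfl⟩
      · rintro ⟨⟨I, J⟩, ⟨hI, hJ⟩, a, ha, b, hb, rfl⟩
        exact ⟨a, hC.subset_relInterior I hI ha, b, hD.subset_relInterior J hJ hb, rfl⟩
    · rintro ⟨I, J⟩ hIJ ⟨I', J'⟩ hIJ' x hx hx'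
      simp only [A, openCone_sumElim] at hx hx'
      obtain ⟨hI, hJ⟩ := Finset.mem_product.1 hIJ
      obtain ⟨hI', hJ'⟩ := Finset.mem_product.1 hIJ'
      obtain ⟨a, ha, b, hb, rfl⟩ := hx
      obtain ⟨a', ha', b', hb', e⟩ := hx'
      have m : ∀ {a : V} {I : Finset (Fin k)}, I ∈ K' →
          a ∈ openCone (fun i : I => ratVec (v i)) → a ∈ C.linSpan := fun hI ha =>
        C.relInterior_subset_linSpan (hC.subset_relInterior _ hI ha)
      have m' : ∀ {a : V} {I : Finset (Fin l)}, I ∈ L' →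
          a ∈ openCone (fun i : I => ratVec (w i)) → a ∈ D.linSpan := fun hI ha =>
        D.relInterior_subset_linSpan (hD.subset_relInterior _ hI ha)
      obtain ⟨rfl, rfl⟩ := add_eq_add_of_disjoint hd (m hI' ha') (m hI ha) (m' hJ' hb')
        (m' hJ hb) e
      rw [Prod.mk.injEq]
      exact ⟨hC.unique _ I (hC.subset hI) I' (hC.subset hI') ha ha',
        hD.unique _ J (hD.subset hJ) J' (hD.subset hJ') hb hb'⟩
  rw [e₁, e₂, Finset.sum_mul_sum, ← Finset.sum_product', hpart]
  refine HasGerm.sum _ ?_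
  rintro ⟨I, J⟩ hIJ
  obtain ⟨hI, hJ⟩ := Finset.mem_product.1 hIJ
  obtain ⟨b₁, p₁, -⟩ := hF₁ I hI
  obtain ⟨b₂, p₂, -⟩ := hF₂ J hJ
  have i₁ := hC.indep I (hC.subset hI)
  have i₂ := hD.indep J (hD.subset hJ)
  have ee : (Sum.elim (fun i : I => ratVec (v i)) fun i : J => ratVec (w i)) =
      fun i => ratVec (Sum.elim (fun i : I => v i) (fun i : J => w i) i) := by
    funext i
    rcases i with i | i <;> rfl
  have ind := linearIndependent_sumElim i₁ i₂ (hd.mono (hCsub I) (hDsub J))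
  have hbox : IsBaseGerm μ ((LocCones.box (Sum.elim (fun i : I => ratVec (v i))
      fun i : J => ratVec (w i))).indicator 1) (G₁ I * G₂ J) :=
    hprod.isBaseGerm hd ((box_subset_span _).trans (hCsub I)) ((box_subset_span _).trans (hDsub J))
      (measurableSet_box i₁) (measurableSet_box i₂) (measurableSet_box ind) (box_sumElim _ _) b₁ b₂
  simp only [A]
  rw [ee] at ind hbox ⊢
  refine hasGerm_openCone ind ?_ hbox ?_
  · rintro (i | i)
    · exact h.invariant _ (AddSubgroup.mem_sup_left (hC.mem_lattice i))
    · exact h.invariant _ (AddSubgroup.mem_sup_right (hD.mem_lattice i))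
  · rw [Fintype.prod_sum_type, ← p₁, ← p₂]
    simp only [Sum.elim_inl, Sum.elim_inr]
    ring

end

section

open MeasureTheory

/-! ### The measure of a strongly convex cone -/

theorem IsGivenBy.congr {f : Mero ℕ} {U : Set (ℕ → ℝ)} {F F' : (ℕ → ℝ) → ℝ}
    (h : IsGivenBy f U F) (e : ∀ z ∈ U, F' z = F z) : IsGivenBy f U F' := by
  obtain ⟨H, hH, s, hs, hf, hev⟩ := h
  refine ⟨H, hH, s, hs, hf, ?_⟩
  filter_upwards [hev] with z hz hzU
  rw [e z hzU, hz hzU]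

namespace LatticeCone

variable {C D P : LatticeCone}

theorem integrableOn_relInterior {Λ : AddSubgroup V} {μ : Measure V} (hμ : IsExpMeasure Λ μ)
    (hP : P.lattice ≤ Λ) {z : ℕ → ℝ} (hz : z ∈ P.negDual) :
    IntegrableOn (fun x => Real.exp (pairing x z)) P.relInterior μ := by
  obtain ⟨k, v, K, K', h⟩ := P.exists_isTriangulation
  rw [h.relInterior_eq, integrableOn_finset_iUnion]
  intro I hI
  have hi := h.indep I (h.subset hI)
  have h0 : ∀ i : I, ratVec (v i) ≠ 0 := hi.ne_zero
  refine integrableOn_openCone (v := fun i : I => ratVec (v i)) (fun i =>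
    hμ.invariant _ (hP (h.mem_lattice i))) ?_
    fun i => hz _ (h.mem_cone i) (h0 i)
  obtain ⟨G, -, hG⟩ := hμ.box (fun i : I => v i) (fun i => hP (h.mem_lattice i)) hi
  have := hG.integrable z
  rwa [indicator_one_mul, integrable_indicator_iff (measurableSet_box hi)] at this

/-- The converse needs no new regularisation: some germ exists, it has the same values on the fat
open dual cone, and so it is the given one. -/
theorem hasGerm_relInterior_iff {Λ : AddSubgroup V} {μ : Measure V} (hμ : IsExpMeasure Λ μ)
    (hP : P.lattice ≤ Λ) (hs : P.StronglyConvex) {f : Mero ℕ} :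
    HasGerm μ (P.relInterior.indicator 1) f ↔
      IsGivenBy f P.negDual fun z => ∫ x in P.relInterior, Real.exp (pairing x z) ∂μ := by
  have key : ∀ {f : Mero ℕ}, HasGerm μ (P.relInterior.indicator 1) f →
      IsGivenBy f P.negDual fun z => ∫ x in P.relInterior, Real.exp (pairing x z) ∂μ := by
    intro f hf
    refine hf.isGivenBy (fun z hz => ?_) fun z _ => ?_
    · rw [indicator_one_mul, integrable_indicator_iff P.measurableSet_relInterior]
      exact integrableOn_relInterior hμ hP hz
    · rw [indicator_one_mul, integral_indicator P.measurableSet_relInterior]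
  refine ⟨key, fun hf => ?_⟩
  obtain ⟨f', -, hf'⟩ := exists_hasGerm hμ hP
  rwa [hf.unique hs.isFat_negDual (key hf') fun _ _ => rfl]

end LatticeCone

/-! ### The counting measure of a lattice -/

instance : MeasurableSingletonClass V :=
  ⟨fun x => by simpa using measurableSet_eqV measurable_id (measurable_const (a := x))⟩

/-- The counting measure on the points of `Λ`. -/
def sumMeasure (Λ : AddSubgroup V) : Measure V := (Measure.count : Measure Λ).map Subtype.val

theorem map_count_equiv {α β : Type*} [MeasurableSpace α] [MeasurableSpace β] [Countable α]
    [Countable β] [MeasurableSingletonClass α] [MeasurableSingletonClass β] (e : α ≃ β) :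
    (Measure.count : Measure α).map e = Measure.count := by
  refine Measure.ext_of_singleton fun b => ?_
  rw [Measure.map_apply (measurable_of_countable _) (measurableSet_singleton b)]
  have : e ⁻¹' {b} = {e.symm b} := by
    ext a
    simp [Equiv.eq_symm_apply]
  rw [this, Measure.count_singleton, Measure.count_singleton]

theorem count_prod_count {α β : Type*} [MeasurableSpace α] [MeasurableSpace β] [Countable α]
    [Countable β] [MeasurableSingletonClass α] [MeasurableSingletonClass β] :
    (Measure.count : Measure α).prod (Measure.count : Measure β) = Measure.count := by
  refine Measure.ext_of_singleton fun p => ?_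
  obtain ⟨a, b⟩ := p
  rw [← Set.singleton_prod_singleton, Measure.prod_prod, Set.singleton_prod_singleton,
    Measure.count_singleton, Measure.count_singleton, Measure.count_singleton, one_mul]

theorem sumMeasure_invariant {Λ : AddSubgroup V} [Countable Λ] {u : V} (hu : u ∈ Λ) :
    InvariantUnder (sumMeasure Λ) u := by
  refine ⟨(transEquiv u).measurable, ?_⟩
  rw [sumMeasure, Measure.map_map (transEquiv u).measurable measurable_subtype_coe]
  conv_rhs => rw [← map_count_equiv (Equiv.addRight (⟨u, hu⟩ : Λ)),
    Measure.map_map measurable_subtype_coe (measurable_of_countable _)]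
  rfl

theorem integrableOn_sumMeasure_iff {Λ : AddSubgroup V} [Countable Λ] {A : Set V}
    (hA : MeasurableSet A) {f : V → ℝ} (hf : Measurable f) (h0 : ∀ x, 0 ≤ f x) :
    IntegrableOn f A (sumMeasure Λ) ↔ Summable fun n : ↥(A ∩ (Λ : Set V)) => f n := by
  rw [← integrable_indicator_iff hA, sumMeasure,
    integrable_map_measure (hf.indicator hA).aestronglyMeasurable
      measurable_subtype_coe.aemeasurable, integrable_count_iff]
  have h1 : (fun n : Λ => ‖(A.indicator f ∘ Subtype.val) n‖) =
      fun n : (Λ : Set V) => A.indicator f n := by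
    funext n
    exact Real.norm_of_nonneg (Set.indicator_nonneg (fun x _ => h0 x) _)
  rw [h1]
  refine (summable_subtype_iff_indicator (f := A.indicator f) (s := (Λ : Set V))).trans ?_
  rw [Set.indicator_indicator, Set.inter_comm]
  exact (summable_subtype_iff_indicator (f := f) (s := A ∩ (Λ : Set V))).symm

theorem setIntegral_sumMeasure {Λ : AddSubgroup V} [Countable Λ] {A : Set V}
    (hA : MeasurableSet A) {f : V → ℝ} (hf : Measurable f) (hi : IntegrableOn f A (sumMeasure Λ)) :
    ∫ x in A, f x ∂(sumMeasure Λ) = ∑' n : ↥(A ∩ (Λ : Set V)), f n := by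
  rw [← integrable_indicator_iff hA, sumMeasure,
    integrable_map_measure (hf.indicator hA).aestronglyMeasurable
      measurable_subtype_coe.aemeasurable] at hi
  rw [← integral_indicator hA, sumMeasure, integral_map measurable_subtype_coe.aemeasurable
    (hf.indicator hA).aestronglyMeasurable]
  refine (integral_countable hi).trans ?_
  simp only [count_real_singleton, one_smul]
  refine (tsum_subtype (Λ : Set V) (A.indicator f)).trans ?_
  rw [Set.indicator_indicator, Set.inter_comm]
  exact (tsum_subtype (A ∩ (Λ : Set V)) f).symm

namespace LatticeCone

variable {C D P : LatticeCone}

instance countable_lattice (C : LatticeCone) : Countable C.lattice := by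
  have : (C.lattice : Set V).Countable := (Set.countable_range ratVec).mono fun x hx => by
    obtain ⟨u, rfl⟩ := C.exists_ratVec_eq hx
    exact ⟨u, rfl⟩
  exact this.to_subtype

variable {ι : Type} [Fintype ι]

/-- The lattice vectors in the span form a finitely generated group, so they have a common
denominator with respect to `v`. -/
theorem exists_multiple_eq_sum (C : LatticeCone) (v : ι → QVec) :
    ∃ N : ℕ, 0 < N ∧ ∀ x ∈ C.lattice, x ∈ Submodule.span ℝ (Set.range fun i => ratVec (v i)) →
      ∃ k : ι → ℤ, (N : ℝ) • x = ∑ i, (k i : ℝ) • ratVec (v i) := by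
  classical
  obtain ⟨s, hs⟩ := C.exists_finset_closure_eq (A := C.lattice ⊓
    (Submodule.span ℝ (Set.range fun i => ratVec (v i))).toAddSubgroup) inf_le_left
  have hN : ∀ u : s, ∃ N : ℕ, 0 < N ∧ N • (u : QVec) ∈ AddSubgroup.closure (Set.range v) := by
    intro u
    refine exists_nsmul_mem_closure (mem_span_of_ratVec_mem_span ?_)
    have h1 : ratVec u ∈ C.lattice ⊓
        (Submodule.span ℝ (Set.range fun i => ratVec (v i))).toAddSubgroup := by
      rw [hs]
      exact AddSubgroup.subset_closure ⟨u, u.2, rfl⟩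
    have h2 : ratVec '' Set.range v = Set.range fun i => ratVec (v i) := (Set.range_comp _ _).symm
    rw [h2]
    exact h1.2
  choose N hN0 hN using hN
  let T : (ι → ℤ) →+ V :=
    { toFun := fun k => ∑ i, (k i : ℝ) • ratVec (v i)
      map_zero' := by simp
      map_add' := fun k l => by simp [add_smul, Finset.sum_add_distrib] }
  have hT : AddSubgroup.closure (Set.range v) ≤ T.range.comap ratVecHom := by
    rw [AddSubgroup.closure_le]
    rintro _ ⟨i, rfl⟩
    refine ⟨Pi.single i 1, ?_⟩
    change ∑ j, ((Pi.single i 1 : ι → ℤ) j : ℝ) • ratVec (v j) = ratVec (v i)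
    rw [Finset.sum_eq_single i]
    · simp
    · intro j _ hj
      simp [hj]
    · simp
  -- The product of the denominators of the finitely many generators serves as common denominator.
  refine ⟨∏ u, N u, Finset.prod_pos fun u _ => hN0 u, fun x hx hx' => ?_⟩
  have hle : C.lattice ⊓ (Submodule.span ℝ (Set.range fun i => ratVec (v i))).toAddSubgroup ≤
      T.range.comap (nsmulAddMonoidHom (∏ u, N u)) := by
    rw [hs, AddSubgroup.closure_le]
    rintro _ ⟨u, hu, rfl⟩
    have h1 : (∏ u, N u) • u ∈ AddSubgroup.closure (Set.range v) := by
      rw [← Finset.prod_erase_mul _ _ (Finset.mem_univ (⟨u, hu⟩ : s)), mul_smul]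
      exact AddSubgroup.nsmul_mem _ (hN ⟨u, hu⟩) _
    have h2 := hT h1
    rw [AddSubgroup.mem_comap, map_nsmul] at h2
    exact h2
  obtain ⟨k, hk⟩ := hle (x := x) ⟨hx, hx'⟩
  refine ⟨k, ?_⟩
  rw [Nat.cast_smul_eq_nsmul]
  exact hk.symm

/-- With a common denominator `N`, the coefficients of a lattice point of the box are integers
between `0` and `N`, divided by `N`. -/
theorem finite_box_inter (C : LatticeCone) {v : ι → QVec}
    (hv : LinearIndependent ℝ fun i => ratVec (v i)) :
    (LocCones.box (fun i => ratVec (v i)) ∩ (C.lattice : Set V)).Finite := by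
  classical
  obtain ⟨N, hN0, hN⟩ := C.exists_multiple_eq_sum v
  have hN' : (0 : ℝ) < N := by exact_mod_cast hN0
  refine ((Set.finite_Icc (0 : ι → ℤ) fun _ => (N : ℤ)).image fun k : ι → ℤ =>
    ∑ i, ((k i : ℝ) / N) • ratVec (v i)).subset ?_
  rintro x ⟨hx, hxC⟩
  obtain ⟨k, hk⟩ := hN x hxC (box_subset_span _ hx)
  obtain ⟨t, ht, rfl⟩ := hx
  have h1 : ∀ i, (N : ℝ) * t i = k i := by
    have h2 : ∑ i, ((N : ℝ) * t i - k i) • ratVec (v i) = 0 := by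
      simp only [sub_smul, mul_smul, Finset.sum_sub_distrib, ← Finset.smul_sum, hk, sub_self]
    intro i
    exact sub_eq_zero.1 (Fintype.linearIndependent_iff.1 hv _ h2 i)
  refine ⟨k, ⟨fun i => ?_, fun i => ?_⟩, ?_⟩
  · have h3 : (0 : ℝ) ≤ k i := by
      rw [← h1]
      exact mul_nonneg hN'.le (ht i).1.le
    exact_mod_cast h3
  · have h3 : (k i : ℝ) ≤ N := by
      rw [← h1]
      exact mul_le_of_le_one_right hN'.le (ht i).2
    exact_mod_cast h3
  · refine Finset.sum_congr rfl fun i _ => ?_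
    rw [← h1, mul_div_cancel_left₀ _ hN'.ne']

theorem exists_sum_exp_germ {W : Submodule ℚ QVec} (s : Finset QVec) (hs : ∀ u ∈ s, u ∈ W) :
    ∃ (H : (ℕ → ℂ) → ℂ) (hH : IsRatHolomorphic H), hH.germ ∈ holIn W ∧
      ∀ z, H z = ∑ u ∈ s, Complex.exp (linEval u z) := by
  classical
  induction s using Finset.induction_on with
  | empty =>
    refine ⟨_, isRatHolomorphic_zero, ?_, by simp⟩
    rw [germ_zero]
    exact Subring.zero_mem _
  | insert u s hu ih =>
    obtain ⟨H, hH, h1, h2⟩ := ih fun w hw => hs w (Finset.mem_insert_of_mem hw)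
    refine ⟨_, (isRatHolomorphic_exp u).add hH, ?_, fun z => ?_⟩
    · rw [← (isRatHolomorphic_exp u).germ_add hH]
      exact Subring.add_mem _ (germ_comp_linEval_mem_holIn (hs u (Finset.mem_insert_self u s)) _) h1
    · rw [Finset.sum_insert hu, Pi.add_apply, h2]

/-- A box contains finitely many lattice points, so its integral is a finite sum of exponentials of
vectors of the lattice. -/
theorem isExpMeasure_sumMeasure (C : LatticeCone) :
    IsExpMeasure C.lattice (sumMeasure C.lattice) := by
  classical
  refine ⟨fun u hu => sumMeasure_invariant hu, ?_⟩
  intro ι _ v hv hi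
  have hfin := C.finite_box_inter hi
  have hm := measurableSet_box hi
  have hinj : Set.InjOn ratVec (ratVec ⁻¹' (hfin.toFinset : Set V)) := ratVec_injective.injOn
  obtain ⟨H, hH, hW, hHe⟩ := exists_sum_exp_germ (W := ratSpan C.lattice)
    (hfin.toFinset.preimage ratVec hinj) fun u hu => by
      rw [Finset.mem_preimage, Set.Finite.mem_toFinset] at hu
      exact mem_ratSpan hu.2
  have hint : ∀ z : ℕ → ℝ, IntegrableOn (fun x => Real.exp (pairing x z))
      (LocCones.box fun i => ratVec (v i)) (sumMeasure C.lattice) := fun z => by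
    rw [integrableOn_sumMeasure_iff hm (measurable_exp_pairing z) fun x => (Real.exp_pos _).le]
    have := hfin.to_subtype
    have := Fintype.ofFinite ↥((LocCones.box fun i => ratVec (v i)) ∩ (C.lattice : Set V))
    exact (hasSum_fintype _).summable
  refine ⟨_, hW, fun z => ?_, H, hH, rfl, Eventually.of_forall fun z => ?_⟩
  · rw [indicator_one_mul, integrable_indicator_iff hm]
    exact hint z
  · rw [indicator_one_mul, integral_indicator hm,
      setIntegral_sumMeasure hm (measurable_exp_pairing z) (hint z), hHe]
    have e1 : ∑' n : ↥((LocCones.box fun i => ratVec (v i)) ∩ (C.lattice : Set V)),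
        Real.exp (pairing n z) = ∑ x ∈ hfin.toFinset, Real.exp (pairing x z) := by
      rw [← Finset.tsum_subtype' hfin.toFinset fun x => Real.exp (pairing x z),
        Set.Finite.coe_toFinset]
    rw [e1, ← Finset.sum_preimage ratVec hfin.toFinset hinj fun x => Real.exp (pairing x z)]
    · push_cast
      refine Finset.sum_congr rfl fun u _ => ?_
      rw [linEval_ofReal]
    · intro x hx hx'
      rw [Set.Finite.mem_toFinset] at hx
      exact absurd (C.exists_ratVec_eq hx.2) hx'

/-- Since the spans are independent, addition is a bijection from the product of the lattices to
their sum. -/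
theorem isProductMeasure_sumMeasure (hd : Disjoint C.linSpan D.linSpan) :
    IsProductMeasure C.linSpan D.linSpan (sumMeasure C.lattice) (sumMeasure D.lattice)
      (sumMeasure (C * D).lattice) := by
  refine ⟨C.lattice, D.lattice, inferInstance, inferInstance, Measure.count, Measure.count,
    Subtype.val, Subtype.val, inferInstance, inferInstance, measurable_subtype_coe,
    measurable_subtype_coe, fun x => C.lattice_subset_linSpan x.2,
    fun y => D.lattice_subset_linSpan y.2, rfl, rfl, ?_⟩
  let e : C.lattice × D.lattice ≃ (C * D).lattice := Equiv.ofBijective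
    (fun p => ⟨p.1 + p.2, add_mem (AddSubgroup.mem_sup_left p.1.2)
      (AddSubgroup.mem_sup_right p.2.2)⟩) (by
    constructor
    · rintro ⟨a, b⟩ ⟨a', b'⟩ h
      obtain ⟨h1, h2⟩ := add_eq_add_of_disjoint hd (C.lattice_subset_linSpan a.2)
        (C.lattice_subset_linSpan a'.2) (D.lattice_subset_linSpan b.2)
        (D.lattice_subset_linSpan b'.2) (Subtype.ext_iff.1 h)
      exact Prod.ext (Subtype.ext h1) (Subtype.ext h2)
    · rintro ⟨x, hx⟩
      rw [mul_lattice, AddSubgroup.mem_sup] at hx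
      obtain ⟨a, ha, b, hb, rfl⟩ := hx
      exact ⟨(⟨a, ha⟩, ⟨b, hb⟩), rfl⟩)
  rw [count_prod_count, sumMeasure, ← map_count_equiv e,
    Measure.map_map measurable_subtype_coe (measurable_of_countable _)]
  rfl

/-- Points of the larger lattice in the relative interior of a piece already belong to the lattice
of the piece, so one measure serves all pieces. -/
theorem isConvergentExpSum_iff (hC : P.lattice ≤ C.lattice)
    (hP : P.relInterior ∩ (P.lattice : Set V) = P.relInterior ∩ (C.lattice : Set V))
    (hs : P.StronglyConvex) {f : Mero ℕ} : IsConvergentExpSum P f ↔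
      HasGerm (sumMeasure C.lattice) (P.relInterior.indicator 1) f := by
  have hμ := C.isExpMeasure_sumMeasure
  have hm := P.measurableSet_relInterior
  rw [hasGerm_relInterior_iff hμ hC hs, IsConvergentExpSum, hP]
  have hint := fun z hz => integrableOn_relInterior hμ hC (z := z) hz
  have e : ∀ z ∈ P.negDual, ∫ x in P.relInterior, Real.exp (pairing x z) ∂(sumMeasure C.lattice) =
      ∑' n : ↥(P.relInterior ∩ (C.lattice : Set V)), Real.exp (pairing n z) := fun z hz =>
    setIntegral_sumMeasure hm (measurable_exp_pairing z) (hint z hz)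
  have hsum : ∀ z ∈ P.negDual,
      Summable fun n : ↥(P.relInterior ∩ (C.lattice : Set V)) => Real.exp (pairing n z) :=
    fun z hz => (integrableOn_sumMeasure_iff hm (measurable_exp_pairing z)
      fun x => (Real.exp_pos _).le).1 (hint z hz)
  exact ⟨fun h => h.2.congr e, fun h => ⟨hsum, h.congr fun z hz => (e z hz).symm⟩⟩

theorem exists_isSubdivision (C : LatticeCone) :
    ∃ (n : ℕ) (P : Fin n → LatticeCone), C.IsSubdivision P := by
  obtain ⟨k, v, K, K', h⟩ := C.exists_isTriangulation
  exact ⟨_, _, h.isSubdivision⟩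

/-- The right-hand side mentions no subdivision, so independence of the choice becomes uniqueness of
the germ. -/
theorem isExpSum_iff {f : Mero ℕ} :
    IsExpSum C f ↔ HasGerm (sumMeasure C.lattice) (C.relInterior.indicator 1) f := by
  have hμ := C.isExpMeasure_sumMeasure
  have key : ∀ {n : ℕ} {P : Fin n → LatticeCone}, C.IsSubdivision P → ∀ g : Fin n → Mero ℕ,
      (∀ i, HasGerm (sumMeasure C.lattice) ((P i).relInterior.indicator 1) (g i)) →
      HasGerm (sumMeasure C.lattice) (C.relInterior.indicator 1) (∑ i, g i) := by
    intro n P hP g hg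
    rw [indicator_subdivision hP]
    exact HasGerm.sum _ fun i _ => hg i
  constructor
  · rintro ⟨n, P, g, hP, hg, rfl⟩
    exact key hP g fun i => (isConvergentExpSum_iff (hP.lattice_le i) (hP.relInterior_inter i)
      (hP.stronglyConvex i)).1 (hg i)
  · intro hf
    obtain ⟨n, P, hP⟩ := C.exists_isSubdivision
    choose g _ hg using fun i => exists_hasGerm hμ (hP.lattice_le i)
    exact ⟨n, P, g, hP, fun i => (isConvergentExpSum_iff (hP.lattice_le i) (hP.relInterior_inter i)
      (hP.stronglyConvex i)).2 (hg i), hf.unique (key hP g hg) (ae_eq_refl _)⟩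

end LatticeCone

end

section

open MeasureTheory

variable {ι κ : Type} [Fintype ι] [Fintype κ]

/-! ### Lattice bases -/

/-- The family `b` is a `ℤ`-basis of `Λ` and linearly independent over `ℝ`. -/
structure IsLatticeBasis (Λ : AddSubgroup V) (b : ι → V) : Prop where
  indep : LinearIndependent ℝ b
  closure_eq : AddSubgroup.closure (Set.range b) = Λ

namespace IsLatticeBasis

variable {Λ : AddSubgroup V} {b : ι → V}

theorem mem {ι : Type} {b : ι → V} (h : IsLatticeBasis Λ b) (i : ι) : b i ∈ Λ := by
  rw [← h.closure_eq]
  exact AddSubgroup.subset_closure ⟨i, rfl⟩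

theorem exists_int (h : IsLatticeBasis Λ b) {x : V} (hx : x ∈ Λ) :
    ∃ k : ι → ℤ, x = ∑ i, (k i : ℝ) • b i := by
  classical
  rw [← h.closure_eq, ← Submodule.span_int_eq_addSubgroupClosure] at hx
  obtain ⟨k, hk⟩ := (Submodule.mem_span_range_iff_exists_fun ℤ).1 hx
  refine ⟨k, ?_⟩
  rw [← hk]
  exact Finset.sum_congr rfl fun i _ => (Int.cast_smul_eq_zsmul ℝ _ _).symm

theorem span_eq (h : IsLatticeBasis Λ b) :
    Submodule.span ℝ (Set.range b) = Submodule.span ℝ (Λ : Set V) := by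
  apply le_antisymm
  · refine Submodule.span_mono ?_
    rintro _ ⟨i, rfl⟩
    exact h.mem i
  · rw [Submodule.span_le]
    intro x hx
    obtain ⟨k, rfl⟩ := h.exists_int hx
    exact Submodule.sum_mem _ fun i _ => Submodule.smul_mem _ _ (Submodule.subset_span ⟨i, rfl⟩)

theorem reindex {ι κ : Type} {b : ι → V} (h : IsLatticeBasis Λ b) (e : κ ≃ ι) : IsLatticeBasis Λ (b ∘ e) := by
  refine ⟨h.indep.comp _ e.injective, ?_⟩
  rw [Set.range_comp, e.range_eq_univ, Set.image_univ, h.closure_eq]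

theorem sumElim {ι κ : Type} {Λ' : AddSubgroup V} {b : ι → V} {b' : κ → V} (h : IsLatticeBasis Λ b)
    (h' : IsLatticeBasis Λ' b') (hd : Disjoint (Submodule.span ℝ (Set.range b))
      (Submodule.span ℝ (Set.range b'))) : IsLatticeBasis (Λ ⊔ Λ') (Sum.elim b b') := by
  refine ⟨linearIndependent_sumElim h.indep h'.indep hd, ?_⟩
  rw [Set.Sum.elim_range, AddSubgroup.closure_union, h.closure_eq, h'.closure_eq]

end IsLatticeBasis

namespace LatticeCone

theorem exists_basis (C : LatticeCone) : ∃ d : ℕ, Nonempty (Module.Basis (Fin d) ℤ C.lattice) := by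
  have hfg : C.lattice.FG := by
    classical
    obtain ⟨s, hs⟩ := C.lattice_gen
    exact ⟨s.image ratVec, by rw [Finset.coe_image, hs]⟩
  have : Module.Finite ℤ C.lattice :=
    Module.Finite.iff_addGroup_fg.2 ((AddGroup.fg_iff_addSubgroup_fg _).2 hfg)
  exact ⟨_, ⟨(Module.basisOfFiniteTypeTorsionFree' (R := ℤ) (M := C.lattice)).2⟩⟩

/-- Independence passes from `ℤ` to `ℚ` by clearing denominators, and from `ℚ` to `ℝ` because the
vectors are rational. -/
theorem isLatticeBasis (C : LatticeCone) (b : Module.Basis ι ℤ C.lattice) :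
    IsLatticeBasis C.lattice fun i => (b i : V) := by
  constructor
  · choose u hu using fun i => C.exists_ratVec_eq (b i).2
    have h1 : LinearIndependent ℤ fun i => (b i : V) :=
      b.linearIndependent.map' C.lattice.subtype.toIntLinearMap
        (LinearMap.ker_eq_bot.2 Subtype.val_injective)
    have h2 : LinearIndependent ℤ u := by
      refine LinearIndependent.of_comp ratVecHom.toIntLinearMap ?_
      have h2 : (⇑ratVecHom.toIntLinearMap ∘ u) = fun i => (b i : V) := funext hu
      rw [h2]
      exact h1
    have h3 := linearIndependent_ratVec ((LinearIndependent.iff_fractionRing ℤ ℚ).1 h2)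
    simpa only [hu] using h3
  · apply le_antisymm
    · rw [AddSubgroup.closure_le]
      rintro _ ⟨i, rfl⟩
      exact (b i).2
    · intro x hx
      have h1 : ((∑ i, b.repr ⟨x, hx⟩ i • b i : C.lattice) : V) = x :=
        congrArg Subtype.val (b.sum_repr ⟨x, hx⟩)
      rw [AddSubgroup.val_finsetSum] at h1
      rw [← h1]
      exact sum_mem fun i _ => AddSubgroup.zsmul_mem _
        (AddSubgroup.subset_closure (Set.mem_range_self i)) _

end LatticeCone

/-! ### Lebesgue measure in the coordinates of a basis -/

/-- Lebesgue measure on the span of `b` in the coordinates given by `b`. -/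
def volMeasure (b : ι → V) : Measure V :=
  (volume : Measure (ι → ℝ)).map fun t => ∑ i, t i • b i

theorem volMeasure_comp_equiv (e : κ ≃ ι) (b : ι → V) : volMeasure (b ∘ e) = volMeasure b := by
  have h := volume_measurePreserving_piCongrLeft (fun _ : ι => ℝ) e
  rw [volMeasure, volMeasure, ← h.map_eq, Measure.map_map (measurable_sum_smul b) h.measurable]
  congr 1
  funext t
  simp only [Function.comp_apply]
  rw [← e.sum_comp]
  exact Finset.sum_congr rfl fun i _ => by rw [MeasurableEquiv.piCongrLeft_apply_apply]

theorem volMeasure_eq_smul [DecidableEq ι] {b v : ι → V} {M : Matrix ι ι ℝ} (hM : M.det ≠ 0)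
    (h : ∀ j, v j = ∑ i, M i j • b i) :
    volMeasure b = ENNReal.ofReal |M.det| • volMeasure v := by
  have h1 : volMeasure v = ENNReal.ofReal |M.det⁻¹| • volMeasure b := by
    rw [volMeasure, volMeasure, ← Measure.map_smul,
      ← Real.map_matrix_volume_pi_eq_smul_volume_pi hM,
      Measure.map_map (measurable_sum_smul b) (by
        exact (LinearMap.continuous_of_finiteDimensional _).measurable)]
    congr 1
    funext t
    simp only [Function.comp_apply, Matrix.toLin'_apply, Matrix.mulVec, dotProduct, h,
      Finset.smul_sum, Finset.sum_smul, smul_smul]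
    rw [Finset.sum_comm]
    simp only [mul_comm]
  rw [h1, smul_smul, ← ENNReal.ofReal_mul (abs_nonneg _), ← abs_mul, mul_inv_cancel₀ hM, abs_one,
    ENNReal.ofReal_one, one_smul]

theorem matrix_mul_eq_one [DecidableEq ι] {b v : ι → V} (hb : LinearIndependent ℝ b)
    {M M' : Matrix ι ι ℝ} (h : ∀ j, v j = ∑ i, M i j • b i) (h' : ∀ j, b j = ∑ i, M' i j • v i) :
    M * M' = 1 := by
  ext k j
  have h1 : ∑ k, ((M * M') k j - (1 : Matrix ι ι ℝ) k j) • b k = 0 := by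
    simp only [sub_smul, Finset.sum_sub_distrib]
    have h2 : ∑ k, (1 : Matrix ι ι ℝ) k j • b k = b j := by
      simp [Matrix.one_apply]
    rw [h2, sub_eq_zero]
    conv_rhs => rw [h' j]
    simp only [Matrix.mul_apply, h, Finset.smul_sum, Finset.sum_smul, smul_smul]
    rw [Finset.sum_comm]
    simp only [mul_comm]
  exact sub_eq_zero.1 (Fintype.linearIndependent_iff.1 hb _ h1 k)

theorem card_eq_of_span_eq {b : ι → V} {v : κ → V} (hb : LinearIndependent ℝ b)
    (hv : LinearIndependent ℝ v)
    (h : Submodule.span ℝ (Set.range b) = Submodule.span ℝ (Set.range v)) :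
    Fintype.card ι = Fintype.card κ := by
  rw [← finrank_span_eq_card hb, ← finrank_span_eq_card hv, h]

/-- The change of basis is an integer matrix with integer inverse, so its determinant is `±1` and
the normalisation does not depend on the basis. -/
theorem IsLatticeBasis.volMeasure_eq {Λ : AddSubgroup V} {b : ι → V} {v : κ → V}
    (hb : IsLatticeBasis Λ b) (hv : IsLatticeBasis Λ v) : volMeasure b = volMeasure v := by
  classical
  suffices key : ∀ v : ι → V, IsLatticeBasis Λ v → volMeasure b = volMeasure v by
    let e := Fintype.equivOfCardEq
      (card_eq_of_span_eq hb.indep hv.indep (hb.span_eq.trans hv.span_eq.symm))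
    rw [key (v ∘ e) (hv.reindex e), volMeasure_comp_equiv]
  intro v hv
  choose M hM using fun j => hb.exists_int (hv.mem j)
  choose M' hM' using fun j => hv.exists_int (hb.mem j)
  let N : Matrix ι ι ℤ := Matrix.of fun i j => M j i
  let N' : Matrix ι ι ℤ := Matrix.of fun i j => M' j i
  have e1 : N.map (Int.castRingHom ℝ) * N'.map (Int.castRingHom ℝ) = 1 :=
    matrix_mul_eq_one hb.indep hM hM'
  have e2 : N * N' = 1 := by
    rw [← Matrix.map_mul] at e1
    refine Matrix.map_injective (f := Int.castRingHom ℝ) Int.cast_injective ?_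
    exact e1.trans (Matrix.map_one _ (map_zero _) (map_one _)).symm
  have e3 : IsUnit N.det := IsUnit.of_mul_eq_one N'.det (by
    rw [← Matrix.det_mul, e2, Matrix.det_one])
  have e4 : (N.map (Int.castRingHom ℝ)).det = ((N.det : ℤ) : ℝ) :=
    (RingHom.map_det (Int.castRingHom ℝ) N).symm
  have e5 : |((N.det : ℤ) : ℝ)| = 1 := by
    rw [← Int.cast_abs, Int.isUnit_iff_abs_eq.1 e3, Int.cast_one]
  have e6 : (N.map (Int.castRingHom ℝ)).det ≠ 0 := by
    rw [e4]
    intro h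
    rw [h, abs_zero] at e5
    exact zero_ne_one e5
  rw [volMeasure_eq_smul (b := b) (v := v) e6 hM, e4, e5, ENNReal.ofReal_one, one_smul]

theorem volMeasure_invariant (b : ι → V) (s : ι → ℝ) :
    InvariantUnder (volMeasure b) (∑ i, s i • b i) := by
  refine ⟨(transEquiv _).measurable, ?_⟩
  have h := measurePreserving_add_right (volume : Measure (ι → ℝ)) s
  rw [volMeasure, Measure.map_map (transEquiv _).measurable (measurable_sum_smul b)]
  conv_rhs => rw [← h.map_eq, Measure.map_map (measurable_sum_smul b) h.measurable]
  congr 1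
  funext t
  change _ + _ = ∑ i, (t i + s i) • b i
  simp only [add_smul, Finset.sum_add_distrib]

/-- In the coordinates of `b` the set lies in a proper subspace, which is Lebesgue null. -/
theorem volMeasure_eq_zero {b : ι → V} {W : Submodule ℝ V}
    (hW : ¬ Submodule.span ℝ (Set.range b) ≤ W) {A : Set V} (hA : MeasurableSet A)
    (hAW : A ⊆ W) : volMeasure b A = 0 := by
  rw [volMeasure, Measure.map_apply (measurable_sum_smul b) hA]
  have h : (fun t : ι → ℝ => ∑ i, t i • b i) ⁻¹' A ⊆
      (W.comap (Fintype.linearCombination ℝ b) : Submodule ℝ (ι → ℝ)) := by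
    intro t ht
    exact hAW ht
  refine measure_mono_null h (Measure.addHaar_submodule _ _ fun htop => hW ?_)
  rw [Submodule.span_le]
  rintro _ ⟨i, rfl⟩
  classical
  have h1 : (Pi.single i 1 : ι → ℝ) ∈ W.comap (Fintype.linearCombination ℝ b) := htop ▸ trivial
  simpa [Fintype.linearCombination_apply, Pi.single_apply] using h1

theorem integrable_exp_indicator (a : ℝ) :
    Integrable ((Set.Ioc (0 : ℝ) 1).indicator fun s => Real.exp (s * a)) := by
  rw [integrable_indicator_iff measurableSet_Ioc]
  exact (Continuous.integrableOn_Icc (by fun_prop)).mono_set Set.Ioc_subset_Icc_self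

theorem integral_exp_indicator (a : ℝ) :
    ((∫ s, (Set.Ioc (0 : ℝ) 1).indicator (fun s => Real.exp (s * a)) s : ℝ) : ℂ) =
      expSubOneDiv a := by
  rw [integral_indicator measurableSet_Ioc, ← intervalIntegral.integral_of_le zero_le_one]
  rcases eq_or_ne a 0 with rfl | ha
  · have h := (hasSum_expSubOneDiv 0).unique (hasSum_single 0 fun n hn => by simp [hn])
    simp [h]
  · have h1 : (a : ℂ) ≠ 0 := by exact_mod_cast ha
    refine mul_left_cancel₀ h1 ?_
    rw [mul_expSubOneDiv, intervalIntegral.integral_comp_mul_right _ ha, integral_exp]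
    simp only [zero_mul, one_mul, Real.exp_zero, smul_eq_mul]
    rw [← Complex.ofReal_mul, mul_inv_cancel_left₀ ha]
    simp

theorem box_exp_eq_prod {v : ι → V} (hv : LinearIndependent ℝ v) (z : ℕ → ℝ) (t : ι → ℝ) :
    (box v).indicator (fun x => Real.exp (pairing x z)) (∑ i, t i • v i) =
      ∏ i, (Set.Ioc (0 : ℝ) 1).indicator (fun s => Real.exp (s * pairing (v i) z)) (t i) := by
  by_cases ht : ∀ i, t i ∈ Set.Ioc (0 : ℝ) 1
  · have hmem : ∑ i, t i • v i ∈ box v := ⟨t, ht, rfl⟩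
    rw [Set.indicator_of_mem hmem, Finset.prod_congr rfl fun i _ =>
      Set.indicator_of_mem (ht i) _, ← Real.exp_sum, pairing_sum]
  · rw [Set.indicator_of_notMem]
    · obtain ⟨i, hi⟩ := not_forall.1 ht
      exact (Finset.prod_eq_zero (Finset.mem_univ i) (Set.indicator_of_notMem hi _)).symm
    · rintro ⟨s, hs, e⟩
      have : s = t := by
        have h1 : ∑ i, (s i - t i) • v i = 0 := by
          simp only [sub_smul, Finset.sum_sub_distrib, e, sub_self]
        funext i
        exact sub_eq_zero.1 (Fintype.linearIndependent_iff.1 hv _ h1 i)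
      exact ht (this ▸ hs)

theorem integrableOn_box_volMeasure {v : ι → V} (hv : LinearIndependent ℝ v) (z : ℕ → ℝ) :
    Integrable ((box v).indicator fun x => Real.exp (pairing x z)) (volMeasure v) := by
  rw [volMeasure, integrable_map_measure
    ((measurable_exp_pairing z).indicator (measurableSet_box hv)).aestronglyMeasurable
    (measurable_sum_smul v).aemeasurable]
  refine Integrable.congr (Integrable.fintype_prod fun i =>
    integrable_exp_indicator (pairing (v i) z)) (Eventually.of_forall fun t => ?_)
  exact (box_exp_eq_prod hv z t).symm

/-- In the coordinates of `v` the box is a cube and the integral splits into the factors `∫₀¹ exp (s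
a) ds = (exp a - 1) / a`. -/
theorem integral_box_volMeasure {v : ι → V} (hv : LinearIndependent ℝ v) (z : ℕ → ℝ) :
    ((∫ x, (box v).indicator (fun x => Real.exp (pairing x z)) x ∂(volMeasure v) : ℝ) : ℂ) =
      ∏ i, expSubOneDiv (pairing (v i) z : ℝ) := by
  rw [volMeasure, integral_map (measurable_sum_smul v).aemeasurable
    ((measurable_exp_pairing z).indicator (measurableSet_box hv)).aestronglyMeasurable]
  simp only [box_exp_eq_prod hv z]
  rw [integral_fintype_prod_volume_eq_prod]
  push_cast
  exact Finset.prod_congr rfl fun i _ => integral_exp_indicator _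

theorem exists_prod_expSubOneDiv_germ {ι : Type} {W : Submodule ℚ QVec} (n : ℕ) (v : ι → QVec)
    (hv : ∀ i, v i ∈ W) (s : Finset ι) :
    ∃ (H : (ℕ → ℂ) → ℂ) (hH : IsRatHolomorphic H), hH.germ ∈ holIn W ∧
      ∀ z, H z = n * ∏ i ∈ s, expSubOneDiv (linEval (v i) z) := by
  classical
  induction s using Finset.induction_on with
  | empty =>
    refine ⟨_, isRatHolomorphic_const n, ?_, fun z => by simp⟩
    exact germ_comp_linEval_mem_holIn (f := fun _ => ((n : ℚ) : ℂ)) W.zero_mem _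
  | insert i s hi ih =>
    obtain ⟨H, hH, h1, h2⟩ := ih
    refine ⟨_, (isRatHolomorphic_expSubOneDiv (v i)).mul hH, ?_, fun z => ?_⟩
    · rw [← (isRatHolomorphic_expSubOneDiv (v i)).germ_mul hH]
      exact Subring.mul_mem _ (germ_comp_linEval_mem_holIn (hv i) _) h1
    · rw [Finset.prod_insert hi, Pi.mul_apply, h2]
      ring

theorem IsLatticeBasis.isExpMeasure {Λ : AddSubgroup V} {b : ι → V} (hb : IsLatticeBasis Λ b) :
    IsExpMeasure Λ (volMeasure b) := by
  classical
  refine ⟨fun u hu => ?_, ?_⟩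
  · obtain ⟨k, rfl⟩ := hb.exists_int hu
    exact volMeasure_invariant b _
  intro κ _ v hv hi
  have hm := measurableSet_box hi
  -- Either the box has full dimension, and its integral is an integer determinant times a product
  -- of `(exp v - 1) / v`, or it is a null set and the germ is `0`.
  by_cases hspan : Submodule.span ℝ (Set.range b) ≤
      Submodule.span ℝ (Set.range fun i => ratVec (v i))
  · have hspan' : Submodule.span ℝ (Set.range fun i => ratVec (v i)) ≤
        Submodule.span ℝ (Set.range b) := by
      rw [hb.span_eq]
      refine Submodule.span_mono ?_
      rintro _ ⟨i, rfl⟩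
      exact hv i
    let e : κ ≃ ι := Fintype.equivOfCardEq
      (card_eq_of_span_eq hi hb.indep (le_antisymm hspan' hspan))
    rw [← volMeasure_comp_equiv e b]
    have hbe := hb.reindex e
    choose M hM using fun j => hbe.exists_int (hv j)
    have hex : ∀ j : κ, ∃ c : κ → ℝ, (b ∘ e) j = ∑ i, c i • ratVec (v i) := fun j => by
      obtain ⟨c, hc⟩ := (Submodule.mem_span_range_iff_exists_fun ℝ).1
        (hspan (Submodule.subset_span ⟨e j, rfl⟩))
      exact ⟨c, hc.symm⟩
    choose M' hM' using hex
    -- The vectors lie in the lattice, so the matrix is integral; its determinant is thus a rational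
    -- constant, as the coefficients of the germ require.
    let N : Matrix κ κ ℤ := Matrix.of fun i j => M j i
    have e1 : N.map (Int.castRingHom ℝ) * Matrix.of (fun i j => M' j i) = 1 :=
      matrix_mul_eq_one hbe.indep hM hM'
    have e2 : (N.map (Int.castRingHom ℝ)).det ≠ 0 := by
      intro h
      have := congrArg Matrix.det e1
      rw [Matrix.det_mul, h, zero_mul, Matrix.det_one] at this
      exact zero_ne_one this
    have e4 : |(N.map (Int.castRingHom ℝ)).det| = (N.det.natAbs : ℝ) := by
      rw [Nat.cast_natAbs, Int.cast_abs]
      exact congrArg _ (RingHom.map_det (Int.castRingHom ℝ) N).symm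
    rw [volMeasure_eq_smul (b := b ∘ e) (v := fun i => ratVec (v i)) e2 hM, e4,
      ENNReal.ofReal_natCast]
    obtain ⟨H, hH, hW, hHe⟩ := exists_prod_expSubOneDiv_germ (W := ratSpan Λ) N.det.natAbs v
      (fun i => mem_ratSpan (hv i)) Finset.univ
    refine ⟨_, hW, fun z => ?_, H, hH, rfl, Eventually.of_forall fun z => ?_⟩
    · rw [indicator_one_mul]
      exact (integrableOn_box_volMeasure hi z).smul_measure (ENNReal.natCast_ne_top _)
    · rw [indicator_one_mul, integral_smul_measure, hHe, ENNReal.toReal_natCast, smul_eq_mul,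
        Complex.ofReal_mul, integral_box_volMeasure hi]
      simp only [linEval_ofReal, Complex.ofReal_natCast]
  · have h0 : volMeasure b (LocCones.box fun i => ratVec (v i)) = 0 :=
      volMeasure_eq_zero hspan hm (box_subset_span _)
    have h1 : ∀ z, (fun x => (LocCones.box fun i => ratVec (v i)).indicator (1 : V → ℝ) x *
        Real.exp (pairing x z)) =ᵐ[volMeasure b] 0 := fun z => by
      rw [indicator_one_mul]
      exact indicator_meas_zero h0
    refine ⟨0, Subring.zero_mem _, fun z => (integrable_zero _ _ _).congr (h1 z).symm, _,
      isRatHolomorphic_zero, by rw [germ_zero], Eventually.of_forall fun z => ?_⟩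
    rw [integral_congr_ae (h1 z)]
    simp

/-! ### The normalised Lebesgue measure of a lattice -/

open Classical in
/-- Lebesgue measure on the span of `Λ`, normalised by `Λ`. -/
def intMeasure (Λ : AddSubgroup V) : Measure V :=
  -- The default value `0` does not occur for the lattice of a lattice cone, which has a basis.
  if h : ∃ (d : ℕ) (b : Fin d → V), IsLatticeBasis Λ b then volMeasure h.choose_spec.choose else 0

theorem IsLatticeBasis.intMeasure_eq {Λ : AddSubgroup V} {b : ι → V} (hb : IsLatticeBasis Λ b) :
    intMeasure Λ = volMeasure b := by
  have h : ∃ (d : ℕ) (b : Fin d → V), IsLatticeBasis Λ b :=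
    ⟨_, _, hb.reindex (Fintype.equivFin ι).symm⟩
  rw [intMeasure, dif_pos h]
  exact h.choose_spec.choose_spec.volMeasure_eq hb

namespace LatticeCone

variable {C D P : LatticeCone}

theorem isExpMeasure_intMeasure (C : LatticeCone) :
    IsExpMeasure C.lattice (intMeasure C.lattice) := by
  obtain ⟨d, ⟨b⟩⟩ := C.exists_basis
  rw [(C.isLatticeBasis b).intMeasure_eq]
  exact (C.isLatticeBasis b).isExpMeasure

theorem span_basis_eq {b : ι → V} (hb : IsLatticeBasis C.lattice b) :
    Submodule.span ℝ (Set.range b) = C.linSpan := by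
  rw [hb.span_eq, C.span_eq, linSpan]

theorem intMeasure_eq_zero {W : Submodule ℝ V} (hW : ¬ C.linSpan ≤ W) {A : Set V}
    (hA : MeasurableSet A) (hAW : A ⊆ W) : intMeasure C.lattice A = 0 := by
  obtain ⟨d, ⟨b⟩⟩ := C.exists_basis
  have hb := C.isLatticeBasis b
  rw [hb.intMeasure_eq]
  exact volMeasure_eq_zero (by rwa [span_basis_eq hb]) hA hAW

theorem isProductMeasure_intMeasure (hd : Disjoint C.linSpan D.linSpan) :
    IsProductMeasure C.linSpan D.linSpan (intMeasure C.lattice) (intMeasure D.lattice)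
      (intMeasure (C * D).lattice) := by
  obtain ⟨d, ⟨b⟩⟩ := C.exists_basis
  obtain ⟨d', ⟨b'⟩⟩ := D.exists_basis
  have hb := C.isLatticeBasis b
  have hb' := D.isLatticeBasis b'
  have hbb := hb.sumElim hb' (by rwa [span_basis_eq hb, span_basis_eq hb'])
  have hmem : ∀ {k : ℕ} {E : LatticeCone} {w : Fin k → V}, IsLatticeBasis E.lattice w →
      ∀ t : Fin k → ℝ, ∑ i, t i • w i ∈ E.linSpan := fun hw t =>
    Submodule.sum_mem _ fun i _ => Submodule.smul_mem _ _ (lattice_subset_linSpan _ (hw.mem i))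
  refine ⟨Fin d → ℝ, Fin d' → ℝ, inferInstance, inferInstance, volume, volume, _, _,
    inferInstance, inferInstance, measurable_sum_smul _, measurable_sum_smul _, hmem hb, hmem hb',
    hb.intMeasure_eq, hb'.intMeasure_eq, ?_⟩
  have h := volume_measurePreserving_sumPiEquivProdPi (fun _ : Fin d ⊕ Fin d' => ℝ)
  rw [mul_lattice, hbb.intMeasure_eq, ← Measure.volume_eq_prod, ← h.map_eq,
    Measure.map_map ?_ h.measurable]
  · rw [volMeasure]
    congr 1
    funext t
    rw [Fintype.sum_sum_type]
    rfl
  · exact measurable_addV.comp (((measurable_sum_smul _).comp measurable_fst).prodMk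
      ((measurable_sum_smul _).comp measurable_snd))

/-- The boundary is a finite union of cells of smaller span. This reconciles integration over the
closed cone with the indicator of its relative interior. -/
theorem cone_ae_eq_relInterior (C : LatticeCone) :
    (C.cone : Set V) =ᵐ[intMeasure C.lattice] C.relInterior := by
  obtain ⟨k, v, K, K', h⟩ := C.exists_isTriangulation
  have hsub : C.relInterior ⊆ (C.cone : Set V) := fun x hx => hx.1
  suffices h0 : intMeasure C.lattice ((C.cone : Set V) \ C.relInterior) = 0 from
    (LE.le.eventuallyLE hsub).antisymm (ae_le_set.2 h0) |>.symm
  have h1 : (C.cone : Set V) \ C.relInterior ⊆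
      ⋃ I ∈ K \ K', openCone fun i : I => ratVec (v i) := by
    rintro x ⟨hx, hx'⟩
    rw [h.cone_eq] at hx
    obtain ⟨I, hI, hxI⟩ := Set.mem_iUnion₂.1 hx
    refine Set.mem_biUnion (Finset.mem_coe.2 (Finset.mem_sdiff.2 ⟨hI, fun hI' => hx' ?_⟩)) hxI
    exact h.subset_relInterior I hI' hxI
  refine measure_mono_null h1 ((measure_biUnion_null_iff (K \ K').countable_toSet).2 fun I hI => ?_)
  obtain ⟨hI, hI'⟩ := Finset.mem_sdiff.1 hI
  refine intMeasure_eq_zero (W := Submodule.span ℝ (Set.range fun i : I => ratVec (v i)))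
    (fun hle => h.span_ne hI hI' (le_antisymm ?_ hle)) (h.measurableSet_cell hI) ?_
  · rw [Submodule.span_le]
    rintro _ ⟨i, rfl⟩
    exact C.lattice_subset_linSpan (h.mem_lattice i)
  · rintro x ⟨t, -, rfl⟩
    exact Submodule.sum_mem _ fun i _ => Submodule.smul_mem _ _ (Submodule.subset_span ⟨i, rfl⟩)

theorem isConvergentExpInt_iff (hs : P.StronglyConvex) {f : Mero ℕ} : IsConvergentExpInt P f ↔
    HasGerm (intMeasure P.lattice) (P.relInterior.indicator 1) f := by
  have hμ := P.isExpMeasure_intMeasure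
  have hm := P.measurableSet_relInterior
  have hc := P.measurableSet_cone
  have hae := P.cone_ae_eq_relInterior
  rw [hasGerm_relInterior_iff hμ le_rfl hs]
  have hint : ∀ (d : ℕ) (b : Module.Basis (Fin d) ℤ P.lattice), ∀ z ∈ P.negDual, IntegrableOn
      (fun t : Fin d → ℝ => Real.exp (pairing (∑ i, t i • (b i : V)) z))
      {t | ∑ i, t i • (b i : V) ∈ P.cone} := by
    intro d b z hz
    have h1 := (integrableOn_congr_set_ae hae).2 (integrableOn_relInterior hμ le_rfl hz)
    rw [IntegrableOn, (P.isLatticeBasis b).intMeasure_eq, volMeasure,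
      Measure.restrict_map (measurable_sum_smul _) hc, integrable_map_measure
      (measurable_exp_pairing z).aestronglyMeasurable (measurable_sum_smul _).aemeasurable] at h1
    exact h1
  have e : ∀ (d : ℕ) (b : Module.Basis (Fin d) ℤ P.lattice) (z : ℕ → ℝ),
      ∫ x in P.relInterior, Real.exp (pairing x z) ∂(intMeasure P.lattice) =
      ∫ t in {t : Fin d → ℝ | ∑ i, t i • (b i : V) ∈ P.cone},
        Real.exp (pairing (∑ i, t i • (b i : V)) z) := by
    intro d b z
    rw [← setIntegral_congr_set hae, (P.isLatticeBasis b).intMeasure_eq, volMeasure,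
      setIntegral_map hc (measurable_exp_pairing z).aestronglyMeasurable
        (measurable_sum_smul _).aemeasurable]
    rfl
  constructor
  · rintro ⟨d, b, -, h⟩
    exact h.congr fun z _ => e d b z
  · intro h
    obtain ⟨d, ⟨b⟩⟩ := P.exists_basis
    exact ⟨d, b, hint d b, h.congr fun z _ => (e d b z).symm⟩

/-- Pieces of full span carry the same lattice as `C`, hence the same measure. The others are null,
so their germs are forced to be `0`, in agreement with the definition. -/
theorem isExpInt_iff {f : Mero ℕ} :
    IsExpInt C f ↔ HasGerm (intMeasure C.lattice) (C.relInterior.indicator 1) f := by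
  classical
  have hμ := C.isExpMeasure_intMeasure
  have hfull : ∀ {n : ℕ} {P : Fin n → LatticeCone}, C.IsSubdivision P → ∀ i,
      (P i).linSpan = C.linSpan → (P i).lattice = C.lattice := by
    intro n P hP i hi
    refine SetLike.coe_injective ?_
    rw [hP.lattice_eq, hi]
    exact Set.inter_eq_left.2 C.lattice_subset_linSpan
  have hnull : ∀ {n : ℕ} {P : Fin n → LatticeCone}, C.IsSubdivision P → ∀ i,
      (P i).linSpan ≠ C.linSpan →
      (P i).relInterior.indicator (1 : V → ℝ) =ᵐ[intMeasure C.lattice] 0 := by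
    intro n P hP i hi
    refine indicator_meas_zero (intMeasure_eq_zero (W := (P i).linSpan)
      (fun hle => hi (le_antisymm ?_ hle)) (P i).measurableSet_relInterior
      (P i).relInterior_subset_linSpan)
    rw [linSpan, linSpan, ← span_eq, ← span_eq]
    exact Submodule.span_mono (hP.lattice_le i)
  have key : ∀ {n : ℕ} {P : Fin n → LatticeCone}, C.IsSubdivision P → ∀ g : Fin n → Mero ℕ,
      (∀ i, HasGerm (intMeasure C.lattice) ((P i).relInterior.indicator 1) (g i)) →
      HasGerm (intMeasure C.lattice) (C.relInterior.indicator 1) (∑ i, g i) := by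
    intro n P hP g hg
    rw [indicator_subdivision hP]
    exact HasGerm.sum _ fun i _ => hg i
  constructor
  · rintro ⟨n, P, g, hP, hg, hg0, rfl⟩
    refine key hP g fun i => ?_
    by_cases hi : (P i).linSpan = C.linSpan
    · rw [← hfull hP i hi]
      exact (isConvergentExpInt_iff (hP.stronglyConvex i)).1 (hg i hi)
    -- A germ of the null piece exists and must vanish, so the prescribed value `0` is its germ.
    · obtain ⟨f, -, hf⟩ := exists_hasGerm hμ (hP.lattice_le i)
      rw [hg0 i hi, ← hf.eq_zero (hnull hP i hi)]
      exact hf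
  · intro hf
    obtain ⟨n, P, hP⟩ := C.exists_isSubdivision
    choose g _ hg using fun i => exists_hasGerm hμ (hP.lattice_le i)
    refine ⟨n, P, g, hP, fun i hi => ?_, fun i hi => (hg i).eq_zero (hnull hP i hi),
      hf.unique (key hP g hg) (ae_eq_refl _)⟩
    rw [isConvergentExpInt_iff (hP.stronglyConvex i), hfull hP i hi]
    exact hg i

end LatticeCone

end

/-! ### Well-definedness, variables and multiplicativity of the two maps -/

section

open MeasureTheory

namespace LatticeCone

variable {C D : LatticeCone} {Q : RatInnerProduct}

theorem existsUnique_isExpSum (C : LatticeCone) : ∃! f, IsExpSum C f := by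
  obtain ⟨f, -, hf⟩ := exists_hasGerm C.isExpMeasure_sumMeasure le_rfl
  exact ⟨f, isExpSum_iff.2 hf, fun g hg => (isExpSum_iff.1 hg).unique hf (ae_eq_refl _)⟩

theorem existsUnique_isExpInt (C : LatticeCone) : ∃! f, IsExpInt C f := by
  obtain ⟨f, -, hf⟩ := exists_hasGerm C.isExpMeasure_intMeasure le_rfl
  exact ⟨f, isExpInt_iff.2 hf, fun g hg => (isExpInt_iff.1 hg).unique hf (ae_eq_refl _)⟩

theorem hasGerm_expSum (C : LatticeCone) :
    HasGerm (sumMeasure C.lattice) (C.relInterior.indicator 1) (expSum C) :=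
  isExpSum_iff.1 (Classical.epsilon_spec C.existsUnique_isExpSum.exists)

theorem hasGerm_expInt (C : LatticeCone) :
    HasGerm (intMeasure C.lattice) (C.relInterior.indicator 1) (expInt C) :=
  isExpInt_iff.1 (Classical.epsilon_spec C.existsUnique_isExpInt.exists)

/-- The germ built from a triangulation involves only forms from the lattice, and by uniqueness it
is the exponential sum. -/
theorem dependsOn_expSum (C : LatticeCone) : DependsOn (ratSpan C.lattice) (expSum C) := by
  obtain ⟨f, h, hf⟩ := exists_hasGerm C.isExpMeasure_sumMeasure le_rfl
  rwa [C.hasGerm_expSum.unique hf (ae_eq_refl _)]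

theorem dependsOn_expInt (C : LatticeCone) : DependsOn (ratSpan C.lattice) (expInt C) := by
  obtain ⟨f, h, hf⟩ := exists_hasGerm C.isExpMeasure_intMeasure le_rfl
  rwa [C.hasGerm_expInt.unique hf (ae_eq_refl _)]

theorem Orth.expSum_mul (h : Orth Q C D) : expSum (C * D) = expSum C * expSum D :=
  (C * D).hasGerm_expSum.unique (hasGerm_mul h.disjoint_linSpan C.isExpMeasure_sumMeasure
    D.isExpMeasure_sumMeasure (C * D).isExpMeasure_sumMeasure
    (isProductMeasure_sumMeasure h.disjoint_linSpan) C.hasGerm_expSum D.hasGerm_expSum)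
    (ae_eq_refl _)

theorem Orth.expInt_mul (h : Orth Q C D) : expInt (C * D) = expInt C * expInt D :=
  (C * D).hasGerm_expInt.unique (hasGerm_mul h.disjoint_linSpan C.isExpMeasure_intMeasure
    D.isExpMeasure_intMeasure (C * D).isExpMeasure_intMeasure
    (isProductMeasure_intMeasure h.disjoint_linSpan) C.hasGerm_expInt D.hasGerm_expInt)
    (ae_eq_refl _)

end LatticeCone

end

end LocCones

end

theorem proposition3p7 (Q : LocCones.RatInnerProduct) :
    (∀ C : LocCones.LatticeCone, ∃! f : LocCones.Mero ℕ, LocCones.IsExpSum C f) ∧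
    (∀ C : LocCones.LatticeCone, ∃! f : LocCones.Mero ℕ, LocCones.IsExpInt C f) ∧
    (∀ C D : LocCones.LatticeCone, LocCones.LatticeCone.Orth Q C D →
      LocCones.expSum (C * D) = LocCones.expSum C * LocCones.expSum D ∧
      LocCones.expInt (C * D) = LocCones.expInt C * LocCones.expInt D) ∧
    LocCones.IsLocalitySemigroupHom (LocCones.LatticeCone.Orth Q) (fun C D => C * D)
      (LocCones.MeroOrth Q) (fun f g => f * g) LocCones.expSum ∧
    LocCones.IsLocalitySemigroupHom (LocCones.LatticeCone.Orth Q) (fun C D => C * D)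
      (LocCones.MeroOrth Q) (fun f g => f * g) LocCones.expInt := by
  refine ⟨LocCones.LatticeCone.existsUnique_isExpSum, LocCones.LatticeCone.existsUnique_isExpInt,
    fun C D h => ⟨h.expSum_mul, h.expInt_mul⟩, ?_, ?_⟩
  · exact ⟨LocCones.isLocalitySemigroup_latticeCone Q, LocCones.isLocalitySemigroup_mero Q,
      -- The orthogonal spaces of variables are the rational spans of the two lattices.
      fun C D h => LocCones.meroOrth_iff.2
        ⟨_, _, h.formOrth, C.dependsOn_expSum, D.dependsOn_expSum⟩, fun C D h => h.expSum_mul⟩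
  · exact ⟨LocCones.isLocalitySemigroup_latticeCone Q, LocCones.isLocalitySemigroup_mero Q,
      fun C D h => LocCones.meroOrth_iff.2
        ⟨_, _, h.formOrth, C.dependsOn_expInt, D.dependsOn_expInt⟩, fun C D h => h.expInt_mul⟩
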